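/- All graphs are finite, simple and undirected. Two vertices $u,v$ of a graph $G$ are twins if $N_G[u]=N_G[v]$. A twin-cover of $G$ is a set $X\subseteq V(G)$ such that for every edge $uv$ of $G$ we have $u\in X$, or $v\in X$, or $u$ and $v$ are twins; a vertex cover is a set containing an endpoint of every edge. For fixed $q$, in $q$-Coloring parameterized by twin-cover size (resp. vertex cover size) the input is a graph $G$ together with a number $k$ such that $G$ has a twin-cover (resp. a vertex cover) of size at most $k$, which need not be given, and the question is whether $G$ has a proper $q$-coloring. A kernel of size $h$ for such a problem is an algorithm that maps $(G,k)$, in time polynomial in $|G|+k$, to a pair $(G',k')$ such that $G'$ has a twin-cover (resp. a vertex cover) of size at most $k'$, $G'$ is $q$-colorable if and only if $G$ is, and both $k'$ and the length in bits of the encoding of $G'$ are at most $h(k)$. Graphs are encoded by adjacency lists in binary. **Corollary.** For each constant $q\ge 3$, $q$-Coloring parameterized by twin-cover size, and likewise $q$-Coloring parameterized by vertex cover size, has a kernel with $O(k^{q-1})$ vertices and $O(k^{q-1}\log k)$ bits, in which the reduced graph $G'$ is (up to renaming vertices) a subgraph of the input graph $G$. More precisely, there are a constant $C$ depending only on $q$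 and a map $G\mapsto G'$ on graphs such that $(G,k)\mapsto(G',k)$ is, for both problems, a kernel of size $C\,(k^{q-1}\lfloor\log_2 k\rfloor+1)$ (where the first summand is read as $0$ for $k=0$); $G'$ is isomorphic to a subgraph of $G$; and $|V(G')|\le C\,(k^{q-1}+1)$ whenever $G$ has a twin-cover of size at most $k$. -/

import Mathlib

/-! ### Random access machines

A program uses natural number variables `v₀, v₁, …` and arrays `a₀, a₁, …` of natural numbers
(indexed by natural numbers), of which it mentions finitely many, and an append-only output tape
of bits. The operations are addition, truncated subtraction and halving; there is no
multiplication, so that unit-cost time on this machine is polynomially related to time on a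
Turing machine. -/

namespace RAM

/-- Expressions: literals, variables, array cells `aᵢ[e]`, and arithmetic. -/
inductive Expr : Type
  | lit (n : ℕ)
  | var (x : ℕ)
  | cell (i : ℕ) (e : Expr)
  | add (e₁ e₂ : Expr)
  | sub (e₁ e₂ : Expr)
  | half (e : Expr)

/-- Programs. -/
inductive Prog : Type
  | skip
  | assign (x : ℕ) (e : Expr)
  | store (i : ℕ) (e₁ e₂ : Expr)
  | emit (e : Expr)
  | seq (p₁ p₂ : Prog)
  | ite (e : Expr) (p₁ p₂ : Prog)
  | loop (e : Expr) (p : Prog)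

/-- The contents of the variables, the arrays and the output tape. -/
structure State : Type where
  var : ℕ → ℕ
  arr : ℕ → ℕ → ℕ
  out : List Bool

/-- The value of an expression. -/
def Expr.eval (s : State) : Expr → ℕ
  | .lit n => n
  | .var x => s.var x
  | .cell i e => s.arr i (e.eval s)
  | .add e₁ e₂ => e₁.eval s + e₂.eval s
  | .sub e₁ e₂ => e₁.eval s - e₂.eval s
  | .half e => e.eval s / 2

/-- The number of elementary operations in the evaluation of an expression. -/
def Expr.cost : Expr → ℕ
  | .lit _ => 1
  | .var _ => 1
  | .cell _ e => e.cost + 1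
  | .add e₁ e₂ => e₁.cost + e₂.cost + 1
  | .sub e₁ e₂ => e₁.cost + e₂.cost + 1
  | .half e => e.cost + 1

/-- `Exec p s t s'`: started in the state `s`, the program `p` halts in the state `s'` after
exactly `t` steps. The conditions of `ite` and `loop` (a while loop) are true when nonzero. -/
inductive Exec : Prog → State → ℕ → State → Prop
  | skip (s : State) : Exec .skip s 1 s
  | assign (x : ℕ) (e : Expr) (s : State) :
      Exec (.assign x e) s (e.cost + 1)
        { s with var := Function.update s.var x (e.eval s) }
  | store (i : ℕ) (e₁ e₂ : Expr) (s : State) :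
      Exec (.store i e₁ e₂) s (e₁.cost + e₂.cost + 1)
        { s with
          arr := Function.update s.arr i
            (Function.update (s.arr i) (e₁.eval s) (e₂.eval s)) }
  | emit (e : Expr) (s : State) :
      Exec (.emit e) s (e.cost + 1) { s with out := s.out ++ [decide (e.eval s ≠ 0)] }
  | seq {p₁ p₂ : Prog} {s s₁ s₂ : State} {t₁ t₂ : ℕ} :
      Exec p₁ s t₁ s₁ → Exec p₂ s₁ t₂ s₂ → Exec (.seq p₁ p₂) s (t₁ + t₂) s₂
  | ite_true {e : Expr} {p₁ p₂ : Prog} {s s₁ : State} {t : ℕ} :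
      e.eval s ≠ 0 → Exec p₁ s t s₁ → Exec (.ite e p₁ p₂) s (e.cost + t) s₁
  | ite_false {e : Expr} {p₁ p₂ : Prog} {s s₁ : State} {t : ℕ} :
      e.eval s = 0 → Exec p₂ s t s₁ → Exec (.ite e p₁ p₂) s (e.cost + t) s₁
  | loop_done {e : Expr} {p : Prog} {s : State} :
      e.eval s = 0 → Exec (.loop e p) s e.cost s
  | loop_step {e : Expr} {p : Prog} {s s₁ s₂ : State} {t₁ t₂ : ℕ} :
      e.eval s ≠ 0 → Exec p s t₁ s₁ → Exec (.loop e p) s₁ t₂ s₂ →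
        Exec (.loop e p) s (e.cost + t₁ + t₂) s₂

/-- The initial state on the input `(w, k)`: the variable `v₀` holds the length of `w`, the cells
`a₀[0], a₀[1], …` hold the bits of `w`, the variable `v₁` holds `k`; everything else is zero. -/
def initState (w : List Bool) (k : ℕ) : State where
  var x := if x = 0 then w.length else if x = 1 then k else 0
  arr i j := if i = 0 then (w.getD j false).toNat else 0
  out := []

/-- On the input `(w, k)` the program `p` halts after at most `T` steps, with the string `w'` on
the output tape and the number `k'` in the variable `v₁`. -/
def OutputsWithin (p : Prog) (w : List Bool) (k : ℕ) (w' : List Bool) (k' T : ℕ) : Prop :=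
  ∃ t ≤ T, ∃ s : State, Exec p (initState w k) t s ∧ s.out = w' ∧ s.var 1 = k'

end RAM

/-! ### Parameterized problems and kernels -/

/-- A parameterized problem whose inputs are pairs `(x, k)` of an instance `x : I` and a natural
number `k`. `Valid x k` says that `k` is a legitimate value of the parameter for `x`, and `Yes x`
that the answer is yes. -/
structure ParamProblem (I : Type) where
  Valid : I → ℕ → Prop
  Yes : I → Prop

/-- The map `f` is a kernel of size `h` for the problem `Q`, where instances are encoded as
bit strings by `enc`. -/
structure IsKernel {I : Type} (enc : I → List Bool) (Q : ParamProblem I) (f : I × ℕ → I × ℕ)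
    (h : ℕ → ℕ) : Prop where
  /-- `f` is computed by an algorithm that takes time polynomial in `|x| + k` -/
  polyTime : ∃ (p : RAM.Prog) (T : Polynomial ℕ), ∀ (x : I) (k : ℕ),
    RAM.OutputsWithin p (enc x) k (enc (f (x, k)).1) (f (x, k)).2 (T.eval ((enc x).length + k))
  /-- valid inputs are mapped to valid outputs -/
  valid : ∀ (x : I) (k : ℕ), Q.Valid x k → Q.Valid (f (x, k)).1 (f (x, k)).2
  /-- input and output have the same answer -/
  equiv : ∀ (x : I) (k : ℕ), Q.Valid x k → (Q.Yes (f (x, k)).1 ↔ Q.Yes x)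
  /-- the size of the output is at most `h k` -/
  size : ∀ (x : I) (k : ℕ), Q.Valid x k →
    (enc (f (x, k)).1).length ≤ h k ∧ (f (x, k)).2 ≤ h k

/-! ### Graphs -/

namespace SimpleGraph

/-- Two vertices are (true) twins if they have the same closed neighborhood. -/
def AreTwins {V : Type*} (G : SimpleGraph V) (u v : V) : Prop :=
  insert u (G.neighborSet u) = insert v (G.neighborSet v)

/-- Every edge has an endpoint in `X` or joins two twins. -/
def IsTwinCover {V : Type*} (G : SimpleGraph V) (X : Set V) : Prop :=
  ∀ ⦃u v : V⦄, G.Adj u v → u ∈ X ∨ v ∈ X ∨ G.AreTwins u v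

end SimpleGraph

/-- Finite simple graphs, with vertices numbered `0, …, n - 1`. -/
abbrev FinGraph : Type := Σ n : ℕ, SimpleGraph (Fin n)

/-- Self-delimiting binary code of a natural number: each binary digit `b` (the least significant
one first) is written as `1b`, and `0` marks the end. -/
def encodeNumber (n : ℕ) : List Bool :=
  n.bits.flatMap (fun b => [true, b]) ++ [false]

open Classical in
/-- The adjacency list encoding of a graph: the number of vertices, and then for each vertex the
list of its neighbors in increasing order, where the vertex `w` is written as the number `w + 1`
and each list is terminated by the number `0`. -/
noncomputable def encodeGraph (G : FinGraph) : List Bool :=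
  encodeNumber G.1 ++ (List.finRange G.1).flatMap fun v =>
    ((List.finRange G.1).filter fun w => G.2.Adj v w).flatMap
      (fun w : Fin G.1 => encodeNumber ((w : ℕ) + 1)) ++ encodeNumber 0

/-- `q`-Coloring parameterized by the size of a twin-cover. -/
def coloringByTwinCover (q : ℕ) : ParamProblem FinGraph where
  Valid G k := ∃ X : Finset (Fin G.1), G.2.IsTwinCover (X : Set (Fin G.1)) ∧ X.card ≤ k
  Yes G := G.2.Colorable q

/-- `q`-Coloring parameterized by the size of a vertex cover. -/
def coloringByVertexCover (q : ℕ) : ParamProblem FinGraph where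
  Valid G k := ∃ X : Finset (Fin G.1), G.2.IsVertexCover (X : Set (Fin G.1)) ∧ X.card ≤ k
  Yes G := G.2.Colorable q

/-!
Let `Γ` be the input graph, regarded as a graph on the natural numbers below some `n`. The classes
of twins are cliques. If some class has more than `q` members, then `Γ` is not `q`-colorable, and
`q + 1` members of the class form the reduced graph. Otherwise the twin classes of the endpoints
of a maximal matching among the edges that do not join twins form a twin-cover `X` with at most
`2 q k` vertices (`IsApproxCover`), since every twin-cover contains an endpoint of each edge of the
matching.

Outside of `X` the graph is a disjoint union of twin classes, so a coloring of `X` extends to `Γ`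
if and only if, for each of these classes, the number of colors of the neighbors in `X` plus the
number `t` of members is at most `q` (`IsApproxCover.colorable`). A violation for the class of `u`
is witnessed by a row `(u, s₁, …, s_q)` with neighbors `sᵢ ∈ X` of `u`: more than `q - t` colors
appear among the `sᵢ`, where `s₁` is disregarded if `t > 1`. With a row goes a vector over `GF(2)`
whose coordinates are labelled by `t` and `q - 1` vertices in `X`: the vector is the sum of the
unit vectors for the tuples obtained by leaving out one `sᵢ`, where `i` ranges over all positions
if `t = 1`, and only `i = 1` is used otherwise. The reduced graph is the union of the graph
induced by `X` and of the graphs induced by the twins of the vertices of a maximal set of rows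
with independent vectors (`IsKeptFamily`, `keptGraph`). There are at most `(q + 1) |X| ^ (q - 1)`
such rows, one for each coordinate at most (`IsKeptFamily.card_le`).

A coloring of `X` defines a linear functional on the vectors that vanishes at the vector of a row
if and only if the row is not a witness (`rowVal_colorFunctional`). For `t > 1` this is immediate.
For `t = 1` the row is a witness if all `q` colors appear among the `sᵢ`, and the functional sends
a tuple to `1` if all colors but a fixed one appear in it; the number of positions that can be
left out so that this still holds is one for witnesses, and zero or two otherwise (`sum_omit`). A
coloring of the reduced graph extends to the twins of the vertices of each chosen row, so its
functional vanishes at the vectors of the chosen rows, hence at the vectors of all rows. So no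
condition is violated, and the coloring extends to `Γ` (`IsKeptFamily.colorable`).

The algorithm is written in a language of bounded loops, whose programs are compiled to programs
of the random access machine with polynomially bounded running time (`LoopLang.Cmd.ok_exec`). It
never reads the parameter, and it takes the length of the input code for `n`. All rows are listed,
and the vectors are compared with the chosen ones by Gaussian elimination.
-/

/-! ### A language of bounded loops -/

namespace LoopLang

/-- The registers of the loop language. In the kernelization program `N` is the length of the input,
`Q` is the number of colors plus one, and `R` is `N ^ Q`. -/
inductive Reg : Type
  | N | R | Q | TMP | I | J | X | Y | D | M | ACC | PH | VAL | PW | HD | VT | U | V | W | W'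
  | CNT | BIG | BU | OK | C | Z | L | T | FIN | PB | P | PIV | PVB | NV | B
  deriving DecidableEq

/-- The arrays of the loop language. In the kernelization program `INP` is the input, `MUL`, `DIV`
and `MOD` are tables of arithmetic with `N`, `CN` and `NT` are the matrices of the closed
neighborhoods and of the pairs that are not twins, `SIZE` holds the sizes of the twin classes, `COV`
and `FL` are sets of vertices, `S` is the current row and `VEC` its vector, `HAS` and `BAS` are the
leading coordinates and the vectors of an echelon basis, `KE` is the matrix of the reduced graph and
`KEPT` lists its vertices. -/
inductive Arr : Type
  | INP | MUL | DIV | MOD | CN | NT | SIZE | COV | FL | S | VEC | HAS | BAS | KE | KEPT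
  deriving DecidableEq

/-- Expressions over the registers and arrays. -/
inductive Exp : Type
  | lit (n : ℕ)
  | var (r : Reg)
  | cell (a : Arr) (e : Exp)
  | add (e₁ e₂ : Exp)
  | sub (e₁ e₂ : Exp)
  | half (e : Exp)

instance : Add Exp := ⟨.add⟩
instance : Sub Exp := ⟨.sub⟩
instance (n : ℕ) : OfNat Exp n := ⟨.lit n⟩
instance : Coe Reg Exp := ⟨.var⟩

/-- Commands. The only form of iteration is `for_ x b c`, which runs `c` with `x = 0, …, b - 1`. -/
inductive Cmd : Type
  | skip
  | assign (r : Reg) (e : Exp)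
  | store (a : Arr) (e₁ e₂ : Exp)
  | emit (e : Exp)
  | seq (c₁ c₂ : Cmd)
  | ite (e : Exp) (c₁ c₂ : Cmd)
  | for_ (x b : Reg) (c : Cmd)

/-- The contents of the registers, the arrays and the output tape. -/
structure Mem : Type where
  var : Reg → ℕ
  arr : Arr → ℕ → ℕ
  out : List Bool

namespace Mem

/-- Overwrite a register. -/
def set (m : Mem) (r : Reg) (n : ℕ) : Mem := { m with var := Function.update m.var r n }

/-- Overwrite an array cell. -/
def put (m : Mem) (a : Arr) (i n : ℕ) : Mem :=
  { m with arr := Function.update m.arr a (Function.update (m.arr a) i n) }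

/-- Append a bit to the output. -/
def push (m : Mem) (b : Bool) : Mem := { m with out := m.out ++ [b] }

variable (m : Mem) (r r' : Reg) (a a' : Arr) (i j n : ℕ) (b : Bool)

@[simp] lemma set_arr : (m.set r n).arr = m.arr := rfl
@[simp] lemma set_out : (m.set r n).out = m.out := rfl
@[simp] lemma put_var : (m.put a i n).var = m.var := rfl
@[simp] lemma push_var : (m.push b).var = m.var := rfl
@[simp] lemma push_out : (m.push b).out = m.out ++ [b] := rfl
@[simp] lemma set_var_self : (m.set r n).var r = n := by simp [set]
lemma set_var : (m.set r n).var r' = if r' = r then n else m.var r' := by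
  simp [set, Function.update_apply]
@[simp] lemma set_var_ne {r r' : Reg} (h : r' ≠ r) : (m.set r n).var r' = m.var r' := by
  simp [set, h]
@[simp] lemma put_arr_self : (m.put a i n).arr a j = if j = i then n else m.arr a j := by
  simp [put, Function.update_apply]
@[simp] lemma put_arr_ne {a a' : Arr} (h : a' ≠ a) : (m.put a i n).arr a' = m.arr a' := by
  simp [put, h]

variable (p : Prop) [Decidable p] (m' : Mem)

@[simp] lemma ite_var : (if p then m else m').var r = if p then m.var r else m'.var r := by
  split_ifs <;> rfl
@[simp] lemma ite_arr : (if p then m else m').arr a j = if p then m.arr a j else m'.arr a j := by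
  split_ifs <;> rfl

end Mem

/-- The value of an expression. -/
def Exp.eval (m : Mem) : Exp → ℕ
  | .lit n => n
  | .var r => m.var r
  | .cell a e => m.arr a (e.eval m)
  | .add e₁ e₂ => e₁.eval m + e₂.eval m
  | .sub e₁ e₂ => e₁.eval m - e₂.eval m
  | .half e => e.eval m / 2

-- The proofs `(rfl)` keep these from being definitional rewrite rules, so that `simp` can use them
-- in the condition of an `if`, where the `Decidable` instance has to change along.
section eval
variable (m : Mem) (e e₁ e₂ : Exp)
@[simp] lemma eval_zero : (0 : Exp).eval m = 0 := (rfl)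
@[simp] lemma eval_one : (1 : Exp).eval m = 1 := (rfl)
@[simp] lemma eval_var (r : Reg) : (Exp.var r).eval m = m.var r := (rfl)
@[simp] lemma eval_cell (a : Arr) : (Exp.cell a e).eval m = m.arr a (e.eval m) := (rfl)
@[simp] lemma eval_add : (e₁ + e₂).eval m = e₁.eval m + e₂.eval m := (rfl)
@[simp] lemma eval_sub : (e₁ - e₂).eval m = e₁.eval m - e₂.eval m := (rfl)
@[simp] lemma eval_half : (Exp.half e).eval m = e.eval m / 2 := (rfl)
end eval

/-- The state of a loop with body `f` and counter `x` after `n` iterations. -/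
def iter (f : Mem → Mem) (x : Reg) (m : Mem) : ℕ → Mem
  | 0 => m.set x 0
  | n + 1 => (f (iter f x m n)).set x (n + 1)

/-- The effect of a command. The bound of a loop is evaluated once, and afterwards the counter has
the value of the bound. -/
def Cmd.sem : Cmd → Mem → Mem
  | .skip, m => m
  | .assign r e, m => m.set r (e.eval m)
  | .store a e₁ e₂, m => m.put a (e₁.eval m) (e₂.eval m)
  | .emit e, m => m.push (decide (e.eval m ≠ 0))
  | .seq c₁ c₂, m => c₂.sem (c₁.sem m)
  | .ite e c₁ c₂, m => if e.eval m = 0 then c₂.sem m else c₁.sem m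
  | .for_ x b c, m => iter c.sem x m (m.var b)

/-- Sequential composition of a list of commands. -/
def Cmd.block : List Cmd → Cmd
  | [] => .skip
  | [c] => c
  | c :: cs => .seq c (block cs)

/-- Conditional execution. -/
abbrev Cmd.when (e : Exp) (c : Cmd) : Cmd := .ite e c .skip

section sem
variable (m : Mem) (e e₁ e₂ : Exp) (c c₁ c₂ : Cmd)
@[simp] lemma sem_skip : Cmd.skip.sem m = m := (rfl)
@[simp] lemma sem_assign (r : Reg) : (Cmd.assign r e).sem m = m.set r (e.eval m) := (rfl)
@[simp] lemma sem_store (a : Arr) :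
    (Cmd.store a e₁ e₂).sem m = m.put a (e₁.eval m) (e₂.eval m) := (rfl)
@[simp] lemma sem_emit : (Cmd.emit e).sem m = m.push (decide (e.eval m ≠ 0)) := (rfl)
@[simp] lemma sem_seq : (Cmd.seq c₁ c₂).sem m = c₂.sem (c₁.sem m) := (rfl)
@[simp] lemma sem_ite :
    (Cmd.ite e c₁ c₂).sem m = if e.eval m = 0 then c₂.sem m else c₁.sem m := (rfl)
@[simp] lemma sem_block_nil : (Cmd.block []).sem m = m := (rfl)
@[simp] lemma sem_block_cons (cs : List Cmd) :
    (Cmd.block (c :: cs)).sem m = (Cmd.block cs).sem (c.sem m) := by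
  cases cs <;> rfl
end sem

/-- The command may change the register `r`. -/
def Cmd.writes (r : Reg) : Cmd → Bool
  | .assign r' _ => r = r'
  | .seq c₁ c₂ => c₁.writes r || c₂.writes r
  | .ite _ c₁ c₂ => c₁.writes r || c₂.writes r
  | .for_ x _ c => r = x || c.writes r
  | _ => false

/-- The command may change the array `a`. -/
def Cmd.stores (a : Arr) : Cmd → Bool
  | .store a' _ _ => a = a'
  | .seq c₁ c₂ => c₁.stores a || c₂.stores a
  | .ite _ c₁ c₂ => c₁.stores a || c₂.stores a
  | .for_ _ _ c => c.stores a
  | _ => false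

/-- The command may produce output. -/
def Cmd.emits : Cmd → Bool
  | .emit _ => true
  | .seq c₁ c₂ => c₁.emits || c₂.emits
  | .ite _ c₁ c₂ => c₁.emits || c₂.emits
  | .for_ _ _ c => c.emits
  | _ => false

lemma sem_var {c : Cmd} {r : Reg} (m : Mem) (h : c.writes r = false) :
    (c.sem m).var r = m.var r := by
  induction c generalizing m with
  | skip | store | emit => rfl
  | assign r' e => simp_all [Cmd.writes]
  | seq c₁ c₂ h₁ h₂ =>
    simp only [Cmd.writes, Bool.or_eq_false_iff] at h
    rw [sem_seq, h₂ _ h.2, h₁ _ h.1]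
  | ite e c₁ c₂ h₁ h₂ =>
    simp only [Cmd.writes, Bool.or_eq_false_iff] at h
    rw [sem_ite]
    split_ifs
    exacts [h₂ _ h.2, h₁ _ h.1]
  | for_ x b c ih =>
    simp only [Cmd.writes, Bool.or_eq_false_iff, decide_eq_false_iff_not] at h
    have key : ∀ n, (iter c.sem x m n).var r = m.var r := by
      intro n
      induction n with
      | zero => simp [iter, h.1]
      | succ n hn => rw [iter, Mem.set_var_ne _ _ h.1, ih _ h.2, hn]
    exact key _

lemma sem_arr {c : Cmd} {a : Arr} (m : Mem) (h : c.stores a = false) :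
    (c.sem m).arr a = m.arr a := by
  induction c generalizing m with
  | skip | assign | emit => rfl
  | store a' e => simp_all [Cmd.stores]
  | seq c₁ c₂ h₁ h₂ =>
    simp only [Cmd.stores, Bool.or_eq_false_iff] at h
    rw [sem_seq, h₂ _ h.2, h₁ _ h.1]
  | ite e c₁ c₂ h₁ h₂ =>
    simp only [Cmd.stores, Bool.or_eq_false_iff] at h
    rw [sem_ite]
    split_ifs
    exacts [h₂ _ h.2, h₁ _ h.1]
  | for_ x b c ih =>
    have key : ∀ n, (iter c.sem x m n).arr a = m.arr a := by
      intro n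
      induction n with
      | zero => simp [iter]
      | succ n hn => rw [iter, Mem.set_arr, ih _ h, hn]
    exact key _

lemma sem_out {c : Cmd} (m : Mem) (h : c.emits = false) : (c.sem m).out = m.out := by
  induction c generalizing m with
  | skip | assign | store => rfl
  | emit e => simp [Cmd.emits] at h
  | seq c₁ c₂ h₁ h₂ =>
    simp only [Cmd.emits, Bool.or_eq_false_iff] at h
    rw [sem_seq, h₂ _ h.2, h₁ _ h.1]
  | ite e c₁ c₂ h₁ h₂ =>
    simp only [Cmd.emits, Bool.or_eq_false_iff] at h
    rw [sem_ite]
    split_ifs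
    exacts [h₂ _ h.2, h₁ _ h.1]
  | for_ x b c ih =>
    have key : ∀ n, (iter c.sem x m n).out = m.out := by
      intro n
      induction n with
      | zero => simp [iter]
      | succ n hn => rw [iter, Mem.set_out, ih _ h, hn]
    exact key _

/-- The memories agree in everything that `c` does not change. -/
structure Agree (c : Cmd) (m m' : Mem) : Prop where
  var : ∀ {r}, c.writes r = false → m'.var r = m.var r
  arr : ∀ {a}, c.stores a = false → m'.arr a = m.arr a
  out : c.emits = false → m'.out = m.out

/-- The invariant rule for loops. Everything that the body does not change keeps its value, so
invariants need to speak only of what is changed. -/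
lemma for_rule {x b : Reg} {c : Cmd} {m : Mem} (P : ℕ → Mem → Prop)
    (h0 : P 0 (m.set x 0))
    (hs : ∀ i < m.var b, ∀ m', Agree (.for_ x b c) m m' → m'.var x = i → P i m' →
      P (i + 1) ((c.sem m').set x (i + 1))) :
    P (m.var b) ((Cmd.for_ x b c).sem m) := by
  have key : ∀ n ≤ m.var b, P n (iter c.sem x m n) ∧ Agree (.for_ x b c) m (iter c.sem x m n) ∧
      (iter c.sem x m n).var x = n := by
    intro n
    induction n with
    | zero =>
      refine fun _ => ⟨h0, ⟨?_, fun _ => rfl, fun _ => rfl⟩, by simp [iter]⟩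
      intro r hr
      simp only [Cmd.writes, Bool.or_eq_false_iff, decide_eq_false_iff_not] at hr
      simp [iter, hr.1]
    | succ n ih =>
      intro hn
      obtain ⟨hP, hA, hv⟩ := ih (by omega)
      refine ⟨hs n hn _ hA hv hP, ⟨?_, ?_, ?_⟩, by simp [iter]⟩
      · intro r hr
        have hr' := hr
        simp only [Cmd.writes, Bool.or_eq_false_iff, decide_eq_false_iff_not] at hr
        rw [iter, Mem.set_var_ne _ _ hr.1, sem_var _ hr.2, hA.var hr']
      · intro a ha
        rw [iter, Mem.set_arr, sem_arr (c := c) _ ha, hA.arr ha]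
      · intro ha
        rw [iter, Mem.set_out, sem_out (c := c) _ ha, hA.out ha]
  exact (key _ le_rfl).1

/-! ### Compilation to random access machines -/

/-- The variable that holds a register. The variable `1` is left out: it holds the parameter. -/
def Reg.id (r : Reg) : ℕ := if r.ctorIdx = 0 then 0 else r.ctorIdx + 1

lemma Reg.id_injective : Function.Injective Reg.id := by
  intro r r' h
  have : r.ctorIdx = r'.ctorIdx := by unfold Reg.id at h; split_ifs at h <;> omega
  rw [← Reg.ofNat_ctorIdx r, this, Reg.ofNat_ctorIdx]

lemma Reg.id_ne_one (r : Reg) : r.id ≠ 1 := by unfold Reg.id; split_ifs <;> omega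

lemma Arr.ctorIdx_injective : Function.Injective Arr.ctorIdx := by
  intro r r' h
  rw [← Arr.ofNat_ctorIdx r, h, Arr.ofNat_ctorIdx]

/-- Translation of expressions. -/
def Exp.compile : Exp → RAM.Expr
  | .lit n => .lit n
  | .var r => .var r.id
  | .cell a e => .cell a.ctorIdx e.compile
  | .add e₁ e₂ => .add e₁.compile e₂.compile
  | .sub e₁ e₂ => .sub e₁.compile e₂.compile
  | .half e => .half e.compile

/-- Translation of commands. The loop of the machine tests `b - x` instead of `x < b`, and reads the
bound `b` again in each round; by `Cmd.ok` it is never changed. -/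
def Cmd.compile : Cmd → RAM.Prog
  | .skip => .skip
  | .assign r e => .assign r.id e.compile
  | .store a e₁ e₂ => .store a.ctorIdx e₁.compile e₂.compile
  | .emit e => .emit e.compile
  | .seq c₁ c₂ => .seq c₁.compile c₂.compile
  | .ite e c₁ c₂ => .ite e.compile c₁.compile c₂.compile
  | .for_ x b c => .seq (.assign x.id (.lit 0))
      (.loop (.sub (.var b.id) (.var x.id))
        (.seq c.compile (.assign x.id (.add (.var x.id) (.lit 1)))))

/-- The machine state `s` represents the memory `m`, with the parameter `k` kept aside. -/
structure Sim (k : ℕ) (m : Mem) (s : RAM.State) : Prop where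
  param : s.var 1 = k
  var : ∀ r : Reg, s.var r.id = m.var r
  arr : ∀ a : Arr, s.arr a.ctorIdx = m.arr a
  out : s.out = m.out

lemma Sim.eval {k : ℕ} {m : Mem} {s : RAM.State} (h : Sim k m s) (e : Exp) :
    e.compile.eval s = e.eval m := by
  induction e with
  | lit => rfl
  | var r => exact h.var r
  | cell a e ih => simp [Exp.compile, RAM.Expr.eval, Exp.eval, ih, h.arr]
  | add e₁ e₂ h₁ h₂ => simp [Exp.compile, RAM.Expr.eval, Exp.eval, h₁, h₂]
  | sub e₁ e₂ h₁ h₂ => simp [Exp.compile, RAM.Expr.eval, Exp.eval, h₁, h₂]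
  | half e ih => simp [Exp.compile, RAM.Expr.eval, Exp.eval, ih]

lemma Sim.set {k : ℕ} {m : Mem} {s : RAM.State} (h : Sim k m s) (r : Reg) (n : ℕ) :
    Sim k (m.set r n) { s with var := Function.update s.var r.id n } where
  param := by simp [Function.update_of_ne r.id_ne_one.symm, h.param]
  var r' := by
    simp only [Mem.set_var, Function.update_apply, Reg.id_injective.eq_iff, h.var]
  arr := h.arr
  out := h.out

lemma Sim.put {k : ℕ} {m : Mem} {s : RAM.State} (h : Sim k m s) (a : Arr) (i n : ℕ) :
    Sim k (m.put a i n) { s with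
      arr := Function.update s.arr a.ctorIdx (Function.update (s.arr a.ctorIdx) i n) } where
  param := h.param
  var := h.var
  arr a' := by
    simp only [Mem.put, Function.update_apply, Arr.ctorIdx_injective.eq_iff, h.arr]
  out := h.out

lemma Sim.push {k : ℕ} {m : Mem} {s : RAM.State} (h : Sim k m s) (b : Bool) :
    Sim k (m.push b) { s with out := s.out ++ [b] } where
  param := h.param
  var := h.var
  arr := h.arr
  out := by simp [h.out]

/-- All loops of the command are bounded by registers from `B`, none of these registers is ever
changed, and no loop body changes its counter. -/
def Cmd.ok (B : List Reg) : Cmd → Bool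
  | .assign r _ => !B.contains r
  | .seq c₁ c₂ => c₁.ok B && c₂.ok B
  | .ite _ c₁ c₂ => c₁.ok B && c₂.ok B
  | .for_ x b c => B.contains b && (!B.contains x && (!c.writes x && c.ok B))
  | _ => true

open Polynomial in
/-- A bound for the running time, as a polynomial in a bound for all loop bounds. Each round of a
loop takes `7` steps for the test and the counter; the initialization of the counter and the last
test take `5` steps. -/
noncomputable def Cmd.time : Cmd → ℕ[X]
  | .skip => 1
  | .assign _ e => C (e.compile.cost + 1)
  | .store _ e₁ e₂ => C (e₁.compile.cost + e₂.compile.cost + 1)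
  | .emit e => C (e.compile.cost + 1)
  | .seq c₁ c₂ => c₁.time + c₂.time
  | .ite e c₁ c₂ => C e.compile.cost + c₁.time + c₂.time
  | .for_ _ _ c => X * (c.time + 7) + 5

lemma Cmd.ok_sem_var {B : List Reg} {c : Cmd} (h : c.ok B = true) {r : Reg} (hr : r ∈ B) (m : Mem) :
    (c.sem m).var r = m.var r := by
  apply LoopLang.sem_var
  induction c with
  | skip | store | emit => rfl
  | assign r' e =>
    simp only [Cmd.ok, Bool.not_eq_true', List.contains_eq_mem, decide_eq_false_iff_not] at h
    simp only [Cmd.writes, decide_eq_false_iff_not]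
    rintro rfl
    exact h hr
  | seq c₁ c₂ h₁ h₂ | ite e c₁ c₂ h₁ h₂ =>
    simp only [Cmd.ok, Bool.and_eq_true] at h
    simp [Cmd.writes, h₁ h.1, h₂ h.2]
  | for_ x b c ih =>
    simp only [Cmd.ok, Bool.and_eq_true, Bool.not_eq_true', List.contains_eq_mem,
      decide_eq_false_iff_not] at h
    simp only [Cmd.writes, Bool.or_eq_false_iff, decide_eq_false_iff_not, ih h.2.2.2, and_true]
    rintro rfl
    exact h.2.1 hr

/-- The compiled program does what the command says, in polynomial time. -/
theorem Cmd.ok_exec {B : List Reg} {c : Cmd} (h : c.ok B = true) {K k : ℕ} {m : Mem}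
    {s : RAM.State} (hK : ∀ r ∈ B, m.var r ≤ K) (hs : Sim k m s) :
    ∃ t ≤ c.time.eval K, ∃ s', RAM.Exec c.compile s t s' ∧ Sim k (c.sem m) s' := by
  induction c generalizing m s with
  | skip => exact ⟨1, by simp [Cmd.time], s, .skip s, hs⟩
  | assign r e =>
    refine ⟨_, le_of_eq ?_, _, .assign _ _ _, ?_⟩
    · simp [Cmd.time]
    · rw [hs.eval]; exact hs.set _ _
  | store a e₁ e₂ =>
    refine ⟨_, le_of_eq ?_, _, .store _ _ _ _, ?_⟩
    · simp [Cmd.time]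
    · rw [hs.eval, hs.eval]; exact hs.put _ _ _
  | emit e =>
    refine ⟨_, le_of_eq ?_, _, .emit _ _, ?_⟩
    · simp [Cmd.time]
    · rw [hs.eval]; exact hs.push _
  | seq c₁ c₂ h₁ h₂ =>
    simp only [Cmd.ok, Bool.and_eq_true] at h
    obtain ⟨t₁, ht₁, s₁, e₁, hs₁⟩ := h₁ h.1 hK hs
    obtain ⟨t₂, ht₂, s₂, e₂, hs₂⟩ := h₂ h.2
      (fun r hr => (Cmd.ok_sem_var h.1 hr m).trans_le (hK r hr)) hs₁
    refine ⟨_, ?_, _, .seq e₁ e₂, hs₂⟩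
    simpa [Cmd.time] using add_le_add ht₁ ht₂
  | ite e c₁ c₂ h₁ h₂ =>
    simp only [Cmd.ok, Bool.and_eq_true] at h
    by_cases he : e.eval m = 0
    · obtain ⟨t₂, ht₂, s₂, e₂, hs₂⟩ := h₂ h.2 hK hs
      refine ⟨_, ?_, _, .ite_false ((hs.eval e).trans he) e₂, by simpa [he] using hs₂⟩
      simp only [Cmd.time, Polynomial.eval_add, Polynomial.eval_C]
      omega
    · obtain ⟨t₁, ht₁, s₁, e₁, hs₁⟩ := h₁ h.1 hK hs
      refine ⟨_, ?_, _, .ite_true (by rwa [hs.eval e]) e₁, by simpa [he] using hs₁⟩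
      simp only [Cmd.time, Polynomial.eval_add, Polynomial.eval_C]
      omega
  | for_ x b c ih =>
    have hb := h
    simp only [Cmd.ok, Bool.and_eq_true, Bool.not_eq_true', List.contains_eq_mem,
      decide_eq_false_iff_not, decide_eq_true_eq] at h
    obtain ⟨hbB, hxB, hxc, hc⟩ := h
    have hbx : b ≠ x := by rintro rfl; exact hxB hbB
    have hB : ∀ n, ∀ r ∈ B, (iter c.sem x m n).var r = m.var r := by
      intro n r hr
      have hrx : r ≠ x := by rintro rfl; exact hxB hr
      induction n with
      | zero => simp [iter, hrx]
      | succ n ihn => rw [iter, Mem.set_var_ne _ _ hrx, Cmd.ok_sem_var hc hr, ihn]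
    have hx : ∀ n, (iter c.sem x m n).var x = n := by
      rintro (_ | n) <;> simp [iter]
    -- the remaining `j` iterations
    have key : ∀ j n, n + j = m.var b → ∀ s, Sim k (iter c.sem x m n) s →
        ∃ t ≤ j * (c.time.eval K + 7) + 3, ∃ s', RAM.Exec
          (.loop (.sub (.var b.id) (.var x.id))
            (.seq c.compile (.assign x.id (.add (.var x.id) (.lit 1))))) s t s' ∧
          Sim k (iter c.sem x m (m.var b)) s' := by
      intro j
      induction j with
      | zero =>
        intro n hn s hs
        refine ⟨_, le_of_eq ?_, s, .loop_done ?_, ?_⟩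
        · simp [RAM.Expr.cost]
        · simp only [RAM.Expr.eval, hs.var, hB _ b hbB, hx]; omega
        · rwa [← hn]
      | succ j ihj =>
        intro n hn s hs
        obtain ⟨t₁, ht₁, s₁, e₁, hs₁⟩ := ih hc
          (fun r hr => (hB n r hr).trans_le (hK r hr)) hs
        have hs₂ := hs₁.set x (n + 1)
        obtain ⟨t₂, ht₂, s₂, e₂, hs₂⟩ := ihj (n + 1) (by omega) _ hs₂
        have hv : (RAM.Expr.add (.var x.id) (.lit 1)).eval s₁ = n + 1 := by
          simp only [RAM.Expr.eval, hs₁.var, LoopLang.sem_var _ hxc, hx]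
        refine ⟨_, ?_, s₂, .loop_step ?_ (.seq e₁ (.assign _ _ _)) (by rwa [hv]), hs₂⟩
        · simp only [RAM.Expr.cost]
          have := add_mul j 1 (Polynomial.eval K c.time + 7)
          omega
        · simp only [RAM.Expr.eval, hs.var, hB _ b hbB, hx]; omega
    obtain ⟨t, ht, s', e, hs'⟩ := key (m.var b) 0 (by omega) _ (hs.set x 0)
    refine ⟨_, ?_, s', .seq (.assign _ _ _) e, hs'⟩
    simp only [Cmd.time, RAM.Expr.cost, Polynomial.eval_add, Polynomial.eval_mul, Polynomial.eval_X,
      Polynomial.eval_ofNat]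
    have := Nat.mul_le_mul_right (Polynomial.eval K c.time + 7) (hK b hbB)
    omega

/-- The memory with the input `w` in the array `INP`, its length in the register `N`, and zeros
everywhere else. -/
def Mem.start (w : List Bool) : Mem where
  var r := if r = .N then w.length else 0
  arr a j := if a = .INP then (w.getD j false).toNat else 0
  out := []

lemma Sim.start (w : List Bool) (k : ℕ) : Sim k (Mem.start w) (RAM.initState w k) where
  param := rfl
  var r := by
    have h0 : r.id = 0 ↔ r = .N :=
      ⟨fun h => Reg.id_injective (h.trans (by rfl : 0 = Reg.id .N)), by rintro rfl; rfl⟩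
    simp [RAM.initState, Mem.start, r.id_ne_one, h0]
  arr a := by
    have h0 : a.ctorIdx = 0 ↔ a = .INP :=
      ⟨fun h => Arr.ctorIdx_injective (h.trans (by rfl : 0 = Arr.ctorIdx .INP)),
        by rintro rfl; rfl⟩
    funext j
    simp [RAM.initState, Mem.start, h0]
  out := rfl

end LoopLang

/-! ### The kernelization program -/

namespace LoopLang

open Cmd Reg Arr

/-- The array index of the pair `(e₁, e₂)` of numbers below `N`, looked up in the table `MUL` of
multiples of `N`. -/
abbrev Exp.pair (e₁ e₂ : Exp) : Exp := .cell MUL e₁ + e₂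

/-- An expression that is nonzero if and only if the two values differ. -/
abbrev Exp.ne (e₁ e₂ : Exp) : Exp := (e₁ - e₂) + (e₂ - e₁)

/-- `R := N ^ Q` -/
def powers : Cmd := block [
  assign R 1,
  for_ I Q (block [
    assign TMP 0,
    for_ J N (assign TMP (TMP + R)),
    assign R TMP])]

/-- Tables of `x * N`, `x / N` and `x % N` for `x < R`. -/
def tables : Cmd :=
  for_ X R (block [
    store MUL X ACC,
    store DIV X D,
    store MOD X M,
    assign ACC (ACC + N),
    assign M (M + 1),
    ite (N - M) skip (block [assign M 0, assign D (D + 1)])])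

/-- Process the next bit of the input: `PH` tells whether it is a binary digit of a number, or else
a flag; `VAL` is the value of the digits read so far and `PW` the value of the next digit; `HD`
tells whether the number of vertices has been read; `VT` is the vertex whose neighbors are being
read. -/
def parseStep : Cmd :=
  ite PH
    (block [when (.cell INP I) (assign VAL (VAL + PW)), assign PW (PW + PW), assign PH 0])
    (ite (.cell INP I)
      (assign PH 1)
      (block [
        ite HD
          (ite VAL (store CN (.pair VT VAL - 1) 1) (assign VT (VT + 1)))
          (assign HD 1),
        assign VAL 0,
        assign PW 1]))

/-- Read the graph into the array `CN`, as the matrix of the relation `v ∈ N[u]`. -/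
def parse : Cmd := block [
  assign PW 1,
  for_ I N parseStep,
  for_ I N (store CN (.pair I I) 1)]

/-- The matrix of the relation `N[u] ≠ N[v]`. -/
def nonTwins : Cmd :=
  for_ U N (for_ V N (for_ W N
    (ite (.cell CN (.pair U W))
      (ite (.cell CN (.pair V W)) skip (store NT (.pair U V) 1))
      (when (.cell CN (.pair V W)) (store NT (.pair U V) 1)))))

/-- The sizes of the twin classes; if there is a class with at least `Q` members, then `BIG` is set
and `BU` is one of its members. -/
def classSizes : Cmd :=
  for_ U N (block [
    assign CNT 0,
    for_ V N (ite (.cell NT (.pair U V)) skip (assign CNT (CNT + 1))),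
    store SIZE U CNT,
    when (CNT + 1 - Q) (block [assign BU U, assign BIG 1])])

/-- Keep the subgraph that is induced by the set in `FL`. -/
def keepInduced : Cmd :=
  for_ W N (for_ W' N
    (when (.cell FL W) (when (.cell FL W') (when (.cell CN (.pair W W'))
      (store KE (.pair W W') 1)))))

/-- Put `Q` twins of `BU` into `FL`. -/
def bigClique : Cmd := block [
  assign CNT 0,
  for_ W N (ite (.cell NT (.pair BU W)) skip
    (when (Q - CNT) (block [store FL W 1, assign CNT (CNT + 1)])))]

/-- A twin-cover `COV`: the twin classes of the endpoints of the edges of a greedy matching among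
the edges between vertices that are not twins. -/
def greedyCover : Cmd :=
  for_ U N (for_ V N
    (when (.cell CN (.pair U V)) (when (.cell NT (.pair U V))
      (ite (.cell COV U) skip (ite (.cell COV V) skip
        (for_ W N (block [
          ite (.cell NT (.pair U W)) skip (store COV W 1),
          ite (.cell NT (.pair V W)) skip (store COV W 1)])))))))

/-- Write the base `N` digits of `X` into `S`. -/
def digits : Cmd := block [
  assign Y X,
  for_ I Q (block [store S I (.cell MOD Y), assign Y (.cell DIV Y)])]

/-- Set `OK` if the vertex `S[0]` is not in the cover, and the vertices `S[1], …, S[Q - 1]` are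
neighbors of `S[0]` in the cover. -/
def checkRow : Cmd := block [
  ite (.cell COV (.cell S 0)) (assign OK 0) (assign OK 1),
  for_ I Q (when I
    (ite (.cell CN (.pair (.cell S 0) (.cell S I)))
      (ite (.cell COV (.cell S I)) skip (assign OK 0))
      (assign OK 0)))]

/-- Write into `VEC` the vector over `GF(2)` of the row `S`. Its coordinates are numbered by a class
size followed by `Q - 2` vertices, read as the base `N` digits of a number. -/
def rowVector : Cmd := block [
  for_ C R (store VEC C 0),
  assign T (.cell SIZE (.cell S 0)),
  for_ I Q (when I
    (ite (.ne T 1)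
      (ite (.ne I 1) skip flip)
      flip))]
where
  flip : Cmd := block [
    assign Z T,
    for_ L Q (when L (when (.ne L I) (assign Z (.cell MUL Z + .cell S L)))),
    store VEC Z (1 - .cell VEC Z)]

/-- Reduce `VEC` by the basis in `BAS`, whose vectors are numbered by their leading coordinates,
which are marked in `HAS`. If the result is not zero, set `FIN`, and `PIV` to the leading
coordinate. -/
def reduce : Cmd := block [
  assign FIN 0,
  assign PB 0,
  for_ P R (block [
    when (.cell VEC P) (ite FIN skip
      (ite (.cell HAS P)
        (for_ C R (when (.cell BAS (PB + C)) (store VEC C (1 - .cell VEC C))))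
        (block [assign FIN 1, assign PIV P, assign PVB PB]))),
    assign PB (PB + R)])]

/-- Add `VEC` to the basis. -/
def addToBasis : Cmd := block [
  store HAS PIV 1,
  for_ C R (store BAS (PVB + C) (.cell VEC C))]

/-- Put the twins of all vertices in `S` into `FL`. -/
def rowClasses : Cmd := block [
  for_ W N (store FL W 0),
  for_ I Q (for_ W N (ite (.cell NT (.pair (.cell S I) W)) skip (store FL W 1)))]

/-- Process the row with the number `X`: if it is valid and its vector does not depend on the basis,
then add the vector to the basis and keep the graph induced by the twins of the vertices of the
row. -/
def row : Cmd := block [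
  digits,
  checkRow,
  when OK (block [
    rowVector,
    reduce,
    when FIN (block [addToBasis, rowClasses, keepInduced])])]

/-- Compute the matrix `KE` of the reduced graph, whose diagonal marks the vertices. -/
def select : Cmd :=
  ite BIG
    (block [bigClique, keepInduced])
    (block [greedyCover, for_ W N (store FL W (.cell COV W)), keepInduced, for_ X R row])

/-- List the vertices that are kept. -/
def listKept : Cmd :=
  for_ V N (when (.cell KE (.pair V V)) (block [store KEPT NV V, assign NV (NV + 1)]))

/-- Output the code of the number `Z`, which has to have at most `N` binary digits. -/
def emitNumber : Cmd := block [
  for_ B N (when Z (block [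
    emit 1,
    emit (Z - (.half Z + .half Z)),
    assign Z (.half Z)])),
  emit 0]

/-- Output the reduced graph. -/
def output : Cmd := block [
  assign Z NV,
  emitNumber,
  for_ I NV (block [
    for_ J NV (when (.ne I J) (when (.cell KE (.pair (.cell KEPT I) (.cell KEPT J)))
      (block [assign Z (J + 1), emitNumber]))),
    emit 0])]

/-- The main part of the program. -/
def main : Cmd := block [tables, parse, nonTwins, classSizes, select, listKept]

/-- The kernelization program for coloring with `q` colors. -/
def kernelization (q : ℕ) : Cmd := block [assign Q (.lit (q + 1)), powers, main, output]

lemma ok_powers : powers.ok [N, Q] = true := rfl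
lemma ok_main : main.ok [N, Q, R] = true := rfl
lemma ok_output : output.ok [N, NV] = true := rfl

end LoopLang

/-! ### Tables and parsing -/

namespace LoopLang

open Cmd Reg Arr

lemma powers_R (m : Mem) : (powers.sem m).var R = m.var N ^ m.var Q := by
  simp only [powers, sem_block_cons, sem_block_nil, sem_assign]
  have := for_rule (x := I) (b := Q) (m := m.set R (Exp.eval m 1)) (c := block [
    assign TMP 0, for_ J N (assign TMP (TMP + R)), assign R TMP])
    (fun i m' => m'.var R = m.var N ^ i) (by simp) ?_
  · simpa using this
  intro i _ m₁ hA _ hP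
  have hN : m₁.var N = m.var N := by rw [hA.var rfl]; simp
  have h2 := for_rule (x := J) (b := N) (m := m₁.set TMP 0) (c := assign TMP (TMP + R))
    (fun j m' => m'.var TMP = j * m.var N ^ i) (by simp) (by
      intro j _ m₂ hA₂ _ hP₂
      have : m₂.var R = m.var N ^ i := by rw [hA₂.var rfl]; simpa using hP
      simp [this, hP₂]; ring)
  simp only [ne_eq, reduceCtorEq, not_false_eq_true, Mem.set_var_ne, hN] at h2
  simp [h2]
  ring

/-- The tables of the products, quotients and remainders with `N` are correct below `R`. -/
structure Tables (N R : ℕ) (m : Mem) : Prop where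
  mul : ∀ x < R, m.arr MUL x = x * N
  div : ∀ x < R, m.arr DIV x = x / N
  mod : ∀ x < R, m.arr MOD x = x % N

lemma tables_spec (m : Mem) (hN : 0 < m.var N) (h1 : m.var ACC = 0) (h2 : m.var D = 0)
    (h3 : m.var M = 0) : Tables (m.var N) (m.var R) (tables.sem m) := by
  have := for_rule (x := X) (b := R) (m := m) (c := block [
    store MUL X ACC,
    store DIV X D,
    store MOD X M,
    assign ACC (ACC + N),
    assign M (M + 1),
    ite (N - M) skip (block [assign M 0, assign D (D + 1)])])
    (fun i m' => Tables (m.var N) i m' ∧ m'.var ACC = i * m.var N ∧ m'.var D = i / m.var N ∧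
      m'.var M = i % m.var N) (by
      refine ⟨⟨?_, ?_, ?_⟩, ?_⟩ <;> simp [h1, h2, h3]) ?_
  · exact this.1
  intro i _ m₁ hA hi ⟨⟨t1, t2, t3⟩, ha, hd, hm⟩
  have hN' : m₁.var N = m.var N := hA.var rfl
  have hlt : i % m.var N < m.var N := Nat.mod_lt _ hN
  have hsplit : (i + 1) % m.var N = (if i % m.var N + 1 < m.var N then i % m.var N + 1 else 0) ∧
      (i + 1) / m.var N = (if i % m.var N + 1 < m.var N then i / m.var N else i / m.var N + 1) := by
    have h := Nat.div_add_mod i (m.var N)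
    split_ifs with hc
    · have : i + 1 = (i % m.var N + 1) + m.var N * (i / m.var N) := by omega
      constructor
      · rw [this, Nat.add_mul_mod_self_left, Nat.mod_eq_of_lt hc]
      · rw [this, Nat.add_mul_div_left _ _ hN, Nat.div_eq_of_lt hc, zero_add]
    · have : i + 1 = 0 + m.var N * (i / m.var N + 1) := by rw [mul_add]; omega
      constructor
      · rw [this, Nat.add_mul_mod_self_left, Nat.zero_mod]
      · rw [this, Nat.add_mul_div_left _ _ hN, Nat.zero_div, zero_add]
  have harr : ∀ f : ℕ → ℕ, ∀ g : ℕ → ℕ, (∀ x < i, g x = f x) →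
      ∀ x ≤ i, (if x = i then f i else g x) = f x := by
    intro f g h x hx
    split_ifs with hx'
    · rw [hx']
    · exact h x (by omega)
  have hmul := harr (fun x => x * m.var N) _ t1
  have hdiv := harr (fun x => x / m.var N) _ t2
  have hmod := harr (fun x => x % m.var N) _ t3
  by_cases hcc : i % m.var N + 1 < m.var N
  · have hc0 : ¬ (m.var N - (i % m.var N + 1) = 0) := by omega
    refine ⟨⟨?_, ?_, ?_⟩, ?_, ?_, ?_⟩ <;>
      simp [hi, ha, hN', hm, hd, hc0, hsplit, hcc, add_mul] <;> assumption
  · have hc0 : m.var N - (i % m.var N + 1) = 0 := by omega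
    refine ⟨⟨?_, ?_, ?_⟩, ?_, ?_, ?_⟩ <;>
      simp [hi, ha, hN', hm, hd, hc0, hsplit, hcc, add_mul] <;> assumption

/-- The state of the parser, with one field for each register or array that `parseStep` changes. -/
@[ext] structure Reader : Type where
  ph : ℕ
  val : ℕ
  pw : ℕ
  hd : ℕ
  vt : ℕ
  cn : ℕ → ℕ

/-- The part of the memory that the parser uses. -/
def Mem.reader (m : Mem) : Reader :=
  ⟨m.var PH, m.var VAL, m.var PW, m.var HD, m.var VT, m.arr CN⟩

namespace Reader

/-- What the parser does with a number. -/
def token (mul : ℕ → ℕ) (r : Reader) (n : ℕ) : Reader :=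
  if r.hd = 0 then { r with ph := 0, val := 0, pw := 1, hd := 1 }
  else if n = 0 then { r with ph := 0, val := 0, pw := 1, vt := r.vt + 1 }
  else { r with ph := 0, val := 0, pw := 1, cn := Function.update r.cn (mul r.vt + n - 1) 1 }

/-- What the parser does with a bit. -/
def step (mul : ℕ → ℕ) (r : Reader) (b : Bool) : Reader :=
  if r.ph = 0 then
    if b then { r with ph := 1 } else r.token mul r.val
  else { r with val := if b then r.val + r.pw else r.val, pw := r.pw + r.pw, ph := 0 }

variable (mul : ℕ → ℕ)

/-- Reading binary digits adds their value, scaled by the value of the next digit. -/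
lemma foldl_step_digits (n : ℕ) (r : Reader) (h : r.ph = 0) :
    ∃ p, (n.bits.flatMap (fun b => [true, b])).foldl (step mul) r =
      { r with val := r.val + r.pw * n, pw := p } := by
  induction n using Nat.binaryRec' generalizing r with
  | zero => exact ⟨r.pw, by simp⟩
  | bit b n hb ih =>
    rw [Nat.bits_append_bit _ _ hb]
    obtain ⟨p, hp⟩ := ih { r with val := if b then r.val + r.pw else r.val, pw := r.pw + r.pw } h
    refine ⟨p, ?_⟩
    simp only [List.flatMap_cons, List.foldl_append, List.foldl_cons, List.foldl_nil]
    have : ((r.step mul true).step mul b) =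
        { r with val := if b then r.val + r.pw else r.val, pw := r.pw + r.pw } := by
      cases r
      simp_all [step]
    rw [this, hp]
    cases b <;> simp [Nat.bit] <;> ring

lemma foldl_step_encodeNumber (n : ℕ) (r : Reader) (h : r.ph = 0) (hv : r.val = 0)
    (hp : r.pw = 1) : (encodeNumber n).foldl (step mul) r = r.token mul n := by
  obtain ⟨p, hp'⟩ := foldl_step_digits mul n r h
  rw [encodeNumber, List.foldl_append, hp']
  simp [step, token, hv, hp, h]

lemma foldl_step_tokens (l : List ℕ) (r : Reader) (h : r.ph = 0) (hv : r.val = 0)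
    (hp : r.pw = 1) : (l.flatMap encodeNumber).foldl (step mul) r = l.foldl (token mul) r := by
  induction l generalizing r with
  | nil => rfl
  | cons n l ih =>
    rw [List.flatMap_cons, List.foldl_append, foldl_step_encodeNumber mul n r h hv hp,
      List.foldl_cons, ih] <;>
    · simp only [token]
      split_ifs <;> rfl

/-- Reading the neighbors of a vertex. -/
lemma foldl_token_list (l : List ℕ) (r : Reader) (hd : r.hd ≠ 0) :
    ((l.map (· + 1)).foldl (token mul) r).hd ≠ 0 ∧ ((l.map (· + 1)).foldl (token mul) r).vt = r.vt ∧
    ∀ c, ((l.map (· + 1)).foldl (token mul) r).cn c ≠ 0 ↔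
      r.cn c ≠ 0 ∨ ∃ w ∈ l, mul r.vt + w = c := by
  induction l generalizing r with
  | nil => simp [hd]
  | cons n l ih =>
    obtain ⟨h1, h2, h3⟩ := ih (r.token mul (n + 1)) (by simp [token, hd])
    simp only [List.map_cons, List.foldl_cons]
    refine ⟨h1, h2.trans (by simp [token, hd]), fun c => ?_⟩
    rw [h3]
    simp only [token, hd, if_false, Nat.add_eq_zero_iff, one_ne_zero, and_false,
      Function.update_apply, List.mem_cons, exists_eq_or_imp]
    have : mul r.vt + (n + 1) - 1 = mul r.vt + n := by omega
    rw [this, ← or_assoc]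
    refine or_congr ?_ Iff.rfl
    split_ifs with hc
    · simp [hc]
    · simp [Ne.symm hc]

/-- Reading the adjacency lists of the vertices `r.vt, r.vt + 1, …`. -/
lemma foldl_token_lists (L : List (List ℕ)) (r : Reader) (hd : r.hd ≠ 0) :
    ∀ c, ((L.flatMap fun l => l.map (· + 1) ++ [0]).foldl (token mul) r).cn c ≠ 0 ↔
      r.cn c ≠ 0 ∨ ∃ v, ∃ h : v < L.length, ∃ w ∈ L[v], mul (r.vt + v) + w = c := by
  induction L generalizing r with
  | nil => simp
  | cons l L ih =>
    intro c
    obtain ⟨h1, h2, h3⟩ := foldl_token_list mul l r hd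
    simp only [List.flatMap_cons, List.foldl_append, List.foldl_cons, List.foldl_nil]
    generalize (l.map (· + 1)).foldl (token mul) r = r' at *
    have ht : r'.token mul 0 = ⟨0, 0, 1, r'.hd, r'.vt + 1, r'.cn⟩ := by simp [token, h1]
    rw [ht, ih ⟨0, 0, 1, r'.hd, r'.vt + 1, r'.cn⟩ h1]
    dsimp only
    rw [h3, h2, or_assoc]
    refine or_congr Iff.rfl ⟨?_, ?_⟩
    · rintro (⟨w, hw, h⟩ | ⟨v, hv, w, hw, h⟩)
      · exact ⟨0, by simp, w, by simpa using hw, by simpa using h⟩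
      · exact ⟨v + 1, by simpa using hv, w, by simpa using hw, by rw [← h]; congr 2; omega⟩
    · rintro ⟨_ | v, hv, w, hw, h⟩
      · exact .inl ⟨w, by simpa using hw, by simpa using h⟩
      · exact .inr ⟨v, by simpa using hv, w, by simpa using hw, by rw [← h]; congr 2; omega⟩

end Reader

/-- The command `parseStep` acts on its part of the memory like `Reader.step`. -/
lemma reader_parseStep (m : Mem) (w : List Bool)
    (h : m.arr INP (m.var I) = (w.getD (m.var I) false).toNat) :
    (parseStep.sem m).reader = m.reader.step (m.arr MUL) (w.getD (m.var I) false) := by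
  generalize w.getD (m.var I) false = b at h
  simp only [parseStep, Mem.reader, Reader.step, Reader.token]
  ext1 <;> cases b <;> by_cases h1 : m.var PH = 0 <;> by_cases h2 : m.var HD = 0 <;>
    by_cases h3 : m.var VAL = 0 <;> simp [h, h1, h2, h3]
  ext c
  simp [Function.update_apply]

end LoopLang

/-! ### Reading the input graph -/

lemma Nat.pair_inj {N a b a' b' : ℕ} (hb : b < N) (hb' : b' < N) :
    a * N + b = a' * N + b' ↔ a = a' ∧ b = b' := by
  refine ⟨fun h => ?_, by rintro ⟨rfl, rfl⟩; rfl⟩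
  have h1 := congrArg (· % N) h
  have h2 := congrArg (· / N) h
  have hN : 0 < N := by omega
  simp only [Nat.mul_add_mod', Nat.mod_eq_of_lt hb, Nat.mod_eq_of_lt hb'] at h1
  simp only [add_comm (_ * N), Nat.add_mul_div_right _ _ hN, Nat.div_eq_of_lt hb,
    Nat.div_eq_of_lt hb', zero_add] at h2
  exact ⟨h2, h1⟩

lemma encodeNumber_length_pos (n : ℕ) : 0 < (encodeNumber n).length := by simp [encodeNumber]

open Classical in
/-- The code of a graph, in terms of numbers instead of elements of `Fin n`. -/
lemma encodeGraph_eq (G : FinGraph) (A : ℕ → ℕ → Prop)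
    (hA : ∀ i j : Fin G.1, G.2.Adj i j ↔ A i j) :
    encodeGraph G = encodeNumber G.1 ++ (List.range G.1).flatMap fun v =>
      ((List.range G.1).filter fun w => A v w).flatMap (fun w => encodeNumber (w + 1)) ++
        encodeNumber 0 := by
  simp only [encodeGraph, ← List.map_coe_finRange_eq_range, List.flatMap_map, List.filter_map,
    Function.comp_def, hA]

/-- The length of the code of a graph can serve as a bound for its vertices. -/
lemma lt_length_encodeGraph (G : FinGraph) : G.1 < (encodeGraph G).length := by
  rw [encodeGraph, List.length_append, List.length_flatMap]
  have h1 := encodeNumber_length_pos G.1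
  have h2 : G.1 ≤ ((List.finRange G.1).map fun v => (((List.finRange G.1).filter
      fun w => @decide (G.2.Adj v w) (Classical.propDecidable _)).flatMap
        (fun w : Fin G.1 => encodeNumber ((w : ℕ) + 1)) ++ encodeNumber 0).length).sum := by
    refine le_trans (le_of_eq ?_) (List.card_nsmul_le_sum _ 1 ?_)
    · simp
    · intro x hx
      obtain ⟨v, -, rfl⟩ := List.mem_map.1 hx
      rw [List.length_append]
      have := encodeNumber_length_pos 0
      omega
  omega

/-- The graph on the natural numbers with the edges of `G`; the numbers that are not vertices of `G`
become isolated vertices. -/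
def FinGraph.onNat (G : FinGraph) : SimpleGraph ℕ := G.2.map Fin.valEmbedding

lemma FinGraph.onNat_adj_coe (G : FinGraph) (i j : Fin G.1) :
    G.onNat.Adj i j ↔ G.2.Adj i j :=
  SimpleGraph.map_adj_apply (f := Fin.valEmbedding)

lemma FinGraph.onNat_adj_lt {G : FinGraph} {u v : ℕ} (h : G.onNat.Adj u v) :
    u < G.1 ∧ v < G.1 := by
  obtain ⟨a, b, -, rfl, rfl⟩ := (SimpleGraph.map_adj _ _ _ _).1 h
  exact ⟨a.2, b.2⟩

namespace LoopLang

open Cmd Reg Arr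

/-- The array `CN` holds the matrix of the relation `v ∈ N[u]`. -/
def ClosedNbhds (Γ : SimpleGraph ℕ) (N : ℕ) (m : Mem) : Prop :=
  ∀ u < N, ∀ v < N, m.arr CN (u * N + v) ≠ 0 ↔ u = v ∨ Γ.Adj u v

open Classical in
/-- Reading the code of a graph marks the cells of its edges. -/
lemma foldl_step_encodeGraph (G : FinGraph) (mul : ℕ → ℕ) (c : ℕ) :
    ((encodeGraph G).foldl (Reader.step mul) ⟨0, 0, 1, 0, 0, fun _ => 0⟩).cn c ≠ 0 ↔
      ∃ v w, G.onNat.Adj v w ∧ mul v + w = c := by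
  have : encodeGraph G = (G.1 :: ((List.range G.1).map fun v =>
      (List.range G.1).filter fun w => G.onNat.Adj v w).flatMap
        (fun l => l.map (· + 1) ++ [0])).flatMap encodeNumber := by
    rw [encodeGraph_eq G G.onNat.Adj fun i j => (G.onNat_adj_coe i j).symm]
    simp [List.flatMap_cons, List.flatMap_assoc, List.flatMap_map]
  rw [this, Reader.foldl_step_tokens _ _ _ rfl rfl rfl, List.foldl_cons,
    Reader.foldl_token_lists _ _ _ (by simp [Reader.token])]
  simp only [Reader.token, if_true, ne_eq, not_true_eq_false, false_or, List.length_map,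
    List.length_range, List.getElem_map, List.getElem_range, List.mem_filter, List.mem_range,
    decide_eq_true_eq, zero_add]
  constructor
  · rintro ⟨v, _, w, ⟨_, hw⟩, h⟩
    exact ⟨v, w, hw, h⟩
  · rintro ⟨v, w, hw, h⟩
    exact ⟨v, (FinGraph.onNat_adj_lt hw).1, w, ⟨(FinGraph.onNat_adj_lt hw).2, hw⟩, h⟩

/-- Isolated numbers between the number of vertices and `N` are included, since the diagonal is
filled up to `N`. -/
lemma parse_spec (G : FinGraph) (m : Mem) (hm : m.reader = ⟨0, 0, 0, 0, 0, fun _ => 0⟩)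
    (hN : m.var N = (encodeGraph G).length)
    (hI : ∀ j, m.arr INP j = ((encodeGraph G).getD j false).toNat)
    (hT : Tables (m.var N) (m.var R) m) (hR : m.var N ≤ m.var R) :
    ClosedNbhds G.onNat (m.var N) (parse.sem m) := by
  set n := m.var N with hn
  simp only [parse, sem_block_cons, sem_block_nil, sem_assign]
  set m₀ := m.set PW (Exp.eval m 1) with hm₀
  have h1 := for_rule (x := I) (b := N) (m := m₀) (c := parseStep)
    (fun i m' => m'.reader = ((encodeGraph G).take i).foldl (Reader.step (m.arr MUL))
      ⟨0, 0, 1, 0, 0, fun _ => 0⟩) (by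
      simp only [Mem.reader, Reader.mk.injEq] at hm
      simp [Mem.reader, hm, hm₀]) (by
      intro i hi m₁ hA hv hP
      have hi' : i < (encodeGraph G).length := by simpa [hm₀, ← hn, hN] using hi
      rw [List.take_succ_eq_append_getElem hi', List.foldl_append, ← hP]
      have := reader_parseStep m₁ (encodeGraph G) (by rw [hA.arr rfl, hv]; exact hI i)
      rw [hA.arr (a := MUL) rfl, hv, List.getD_eq_getElem _ _ hi'] at this
      exact this)
  set m₁ := (for_ I N parseStep).sem m₀ with hm₁
  have hN₁ : m₁.var N = n := by rw [hm₁, sem_var _ rfl]; simp [hm₀, hn]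
  have hM₁ : m₁.arr MUL = m.arr MUL := by rw [hm₁, sem_arr _ rfl]; simp [hm₀]
  have h0N : m₀.var N = (encodeGraph G).length := by simp [hm₀, ← hn, hN]
  rw [h0N, List.take_length] at h1
  have h1' : m₁.arr CN = _ := congrArg Reader.cn h1
  have h2 := for_rule (x := I) (b := N) (m := m₁) (c := store CN (.pair I I) 1)
    (fun i m' => ∀ c, m'.arr CN c ≠ 0 ↔ (∃ u < i, c = u * n + u) ∨ m₁.arr CN c ≠ 0)
    (by simp) (by
      intro i hi m₂ hA hv hP c
      rw [hN₁] at hi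
      have : m₂.arr MUL i = i * n := by
        rw [hA.arr rfl, hM₁]; exact hT.mul i (by omega)
      simp only [sem_store, Mem.set_arr, Mem.put_arr_self, eval_add, eval_cell, eval_var, hv, this,
        eval_one]
      split_ifs with hc
      · simp only [ne_eq, one_ne_zero, not_false_eq_true, true_iff]
        exact .inl ⟨i, by omega, hc⟩
      · rw [hP c]
        refine or_congr ⟨fun ⟨u, hu, h⟩ => ⟨u, by omega, h⟩, fun ⟨u, hu, h⟩ => ⟨u, ?_, h⟩⟩ Iff.rfl
        have : u ≠ i := by rintro rfl; exact hc h
        omega)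
  rw [hN₁] at h2
  intro u hu v hv
  rw [h2, h1', foldl_step_encodeGraph]
  refine or_congr ⟨?_, ?_⟩ ⟨?_, ?_⟩
  · rintro ⟨a, ha, h⟩
    obtain ⟨rfl, rfl⟩ := (Nat.pair_inj hv ha).1 h
    rfl
  · rintro rfl
    exact ⟨u, hu, rfl⟩
  · rintro ⟨a, b, hab, h⟩
    have hlt := FinGraph.onNat_adj_lt hab
    have := lt_length_encodeGraph G
    rw [hT.mul a (by omega)] at h
    obtain ⟨rfl, rfl⟩ := (Nat.pair_inj (by omega) hv).1 h
    exact hab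
  · intro hab
    have hlt := FinGraph.onNat_adj_lt hab
    have := lt_length_encodeGraph G
    exact ⟨u, v, hab, by rw [hT.mul u (by omega)]⟩

end LoopLang

/-! ### Twin classes -/

namespace SimpleGraph

variable {V : Type*} {Γ : SimpleGraph V}

lemma areTwins_iff {u v : V} : Γ.AreTwins u v ↔ ∀ w, (u = w ∨ Γ.Adj u w) ↔ (v = w ∨ Γ.Adj v w) := by
  simp [AreTwins, Set.ext_iff, eq_comm]

@[refl] lemma AreTwins.refl (u : V) : Γ.AreTwins u u := rfl

lemma AreTwins.symm {u v : V} (h : Γ.AreTwins u v) : Γ.AreTwins v u := Eq.symm h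

lemma AreTwins.trans {u v w : V} (h : Γ.AreTwins u v) (h' : Γ.AreTwins v w) : Γ.AreTwins u w :=
  Eq.trans h h'

lemma AreTwins.adj {u v : V} (h : Γ.AreTwins u v) (huv : u ≠ v) : Γ.Adj u v := by
  simpa [huv] using (areTwins_iff.1 h v).2 (.inl rfl)

lemma AreTwins.adj_of_adj {u v w : V} (h : Γ.AreTwins u v) (huw : Γ.Adj u w) (hvw : v ≠ w) :
    Γ.Adj v w := by
  simpa [hvw] using (areTwins_iff.1 h w).1 (.inr huw)

lemma AreTwins.exists_adj {u v w : V} (h : Γ.AreTwins u v) (huw : Γ.Adj u w) : ∃ w, Γ.Adj v w := by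
  by_cases hvw : v = w
  · exact ⟨u, hvw ▸ huw.symm⟩
  · exact ⟨w, h.adj_of_adj huw hvw⟩

/-- All edges are between numbers below `n`. -/
def BoundedBy (Γ : SimpleGraph ℕ) (n : ℕ) : Prop := ∀ ⦃u v⦄, Γ.Adj u v → u < n

lemma BoundedBy.areTwins_iff {Γ : SimpleGraph ℕ} {n : ℕ} (h : Γ.BoundedBy n) {u v : ℕ} (hu : u < n)
    (hv : v < n) : Γ.AreTwins u v ↔ ∀ w < n, (u = w ∨ Γ.Adj u w) ↔ (v = w ∨ Γ.Adj v w) := by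
  rw [SimpleGraph.areTwins_iff]
  refine ⟨fun H w _ => H w, fun H w => ?_⟩
  by_cases hw : w < n
  · exact H w hw
  · have h1 : u ≠ w := by omega
    have h2 : v ≠ w := by omega
    have h3 : ¬ Γ.Adj u w := fun h' => hw (h h'.symm)
    have h4 : ¬ Γ.Adj v w := fun h' => hw (h h'.symm)
    simp [h1, h2, h3, h4]

open Classical in
/-- The twins of `u` among the numbers below `n`. -/
noncomputable def twinClass (Γ : SimpleGraph ℕ) (n u : ℕ) : Finset ℕ :=
  (Finset.range n).filter (Γ.AreTwins u)

lemma mem_twinClass {Γ : SimpleGraph ℕ} {n u v : ℕ} :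
    v ∈ Γ.twinClass n u ↔ v < n ∧ Γ.AreTwins u v := by
  simp [twinClass]

lemma AreTwins.twinClass_eq {Γ : SimpleGraph ℕ} {u v : ℕ} (h : Γ.AreTwins u v) (n : ℕ) :
    Γ.twinClass n u = Γ.twinClass n v := by
  ext w
  simp only [mem_twinClass]
  exact and_congr_right fun _ => ⟨h.symm.trans, h.trans⟩

end SimpleGraph

namespace LoopLang

open Cmd Reg Arr

lemma agree_sem (c : Cmd) (m : Mem) : Agree c m (c.sem m) :=
  ⟨fun h => sem_var m h, fun h => sem_arr m h, fun h => sem_out m h⟩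

/-- The rule for loops whose body only ever makes cells of the array `a` nonzero. -/
lemma acc_rule {x b : Reg} {c : Cmd} {m : Mem} {a : Arr} {n : ℕ} (hn : m.var b = n)
    (D : ℕ → ℕ → Prop) (hs : ∀ i < n, ∀ m', Agree (.for_ x b c) m m' → m'.var x = i →
      ∀ k, (c.sem m').arr a k ≠ 0 ↔ m'.arr a k ≠ 0 ∨ D i k) :
    ∀ k, ((for_ x b c).sem m).arr a k ≠ 0 ↔ m.arr a k ≠ 0 ∨ ∃ i < n, D i k := by
  subst hn
  refine for_rule (fun n m' => ∀ k, m'.arr a k ≠ 0 ↔ m.arr a k ≠ 0 ∨ ∃ i < n, D i k) (by simp) ?_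
  intro i hi m' hA hv hP k
  rw [Mem.set_arr, hs i hi m' hA hv k, hP k, or_assoc]
  refine or_congr Iff.rfl ⟨?_, ?_⟩
  · rintro (⟨j, hj, h⟩ | h)
    exacts [⟨j, by omega, h⟩, ⟨i, by omega, h⟩]
  · rintro ⟨j, hj, h⟩
    rcases Nat.lt_succ_iff_lt_or_eq.1 hj with hj | rfl
    exacts [.inl ⟨j, hj, h⟩, .inr h]

/-- The memory after reading the graph `Γ`. -/
structure GraphData (Γ : SimpleGraph ℕ) (n q r : ℕ) (m : Mem) : Prop where
  varN : m.var N = n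
  varQ : m.var Q = q
  varR : m.var R = r
  tables : Tables n r m
  le : n ≤ r
  bounded : Γ.BoundedBy n
  nbhds : ClosedNbhds Γ n m

section GraphData

variable {Γ : SimpleGraph ℕ} {n q r : ℕ} {m m' : Mem}

/-- The command leaves the parts of the memory alone that describe the input graph. -/
def Cmd.preservesGraph (c : Cmd) : Bool :=
  !(c.writes N || c.writes Q || c.writes R || c.stores MUL || c.stores DIV || c.stores MOD ||
    c.stores CN)

lemma GraphData.agree (h : GraphData Γ n q r m) {c : Cmd} (hA : Agree c m m')
    (hc : c.preservesGraph = true) : GraphData Γ n q r m' := by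
  simp only [Cmd.preservesGraph, Bool.not_eq_true', Bool.or_eq_false_iff] at hc
  obtain ⟨⟨⟨⟨⟨⟨h1, h2⟩, h3⟩, h4⟩, h5⟩, h6⟩, h7⟩ := hc
  constructor
  · rw [hA.var h1, h.varN]
  · rw [hA.var h2, h.varQ]
  · rw [hA.var h3, h.varR]
  · constructor
    · rw [hA.arr h4]; exact h.tables.mul
    · rw [hA.arr h5]; exact h.tables.div
    · rw [hA.arr h6]; exact h.tables.mod
  · exact h.le
  · exact h.bounded
  · unfold ClosedNbhds
    rw [hA.arr h7]; exact h.nbhds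

lemma GraphData.pair (h : GraphData Γ n q r m) {e₁ e₂ : Exp} (h₁ : e₁.eval m < n) :
    (Exp.pair e₁ e₂).eval m = e₁.eval m * n + e₂.eval m := by
  rw [eval_add, eval_cell, h.tables.mul _ (by have := h.le; omega)]

lemma nonTwins_spec (h : GraphData Γ n q r m) (h0 : ∀ k, m.arr NT k = 0) :
    ∀ u < n, ∀ v < n, (nonTwins.sem m).arr NT (u * n + v) ≠ 0 ↔ ¬ Γ.AreTwins u v := by
  have key := acc_rule (x := U) (b := N) (m := m) (a := NT) h.varN (c := for_ V N (for_ W N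
    (ite (.cell CN (.pair U W))
      (ite (.cell CN (.pair V W)) skip (store NT (.pair U V) 1))
      (when (.cell CN (.pair V W)) (store NT (.pair U V) 1)))))
    (fun u k => ∃ v < n, ∃ w < n, k = u * n + v ∧
      ¬ ((u = w ∨ Γ.Adj u w) ↔ (v = w ∨ Γ.Adj v w))) (by
    intro u hu m₁ hA₁ hv₁
    have h₁ := h.agree hA₁ rfl
    refine acc_rule h₁.varN _ ?_
    intro v hv m₂ hA₂ hv₂
    have h₂ := h₁.agree hA₂ rfl
    have hu₂ : m₂.var U = u := by rw [hA₂.var rfl, hv₁]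
    refine acc_rule h₂.varN _ ?_
    intro w hw m₃ hA₃ hv₃ k
    have h₃ := h₂.agree hA₃ rfl
    have hu₃ : m₃.var U = u := by rw [hA₃.var rfl, hu₂]
    have hv₃' : m₃.var V = v := by rw [hA₃.var rfl, hv₂]
    have e1 : (Exp.pair U W).eval m₃ = u * n + w := by
      rw [h₃.pair (by simpa [hu₃] using hu)]; simp [hu₃, hv₃]
    have e2 : (Exp.pair V W).eval m₃ = v * n + w := by
      rw [h₃.pair (by simpa [hv₃'] using hv)]; simp [hv₃', hv₃]
    have e3 : (Exp.pair U V).eval m₃ = u * n + v := by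
      rw [h₃.pair (by simpa [hu₃] using hu)]; simp [hu₃, hv₃']
    simp only [sem_ite, eval_cell, e1, e2, ← h₃.nbhds u hu w hw, ← h₃.nbhds v hv w hw, sem_skip,
      sem_store, e3, eval_one]
    by_cases c1 : m₃.arr CN (u * n + w) = 0 <;> by_cases c2 : m₃.arr CN (v * n + w) = 0 <;>
      by_cases c3 : k = u * n + v <;> simp [c1, c2, c3])
  intro u hu v hv
  rw [nonTwins, key, h0, h.bounded.areTwins_iff hu hv]
  simp only [ne_eq, not_true_eq_false, false_or, not_forall]
  constructor
  · rintro ⟨u', _, v', hv', w, hw, he, H⟩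
    obtain ⟨rfl, rfl⟩ := (Nat.pair_inj hv hv').1 he
    exact ⟨w, hw, H⟩
  · rintro ⟨w, hw, H⟩
    exact ⟨u, hu, v, hv, w, hw, rfl, H⟩

lemma keepInduced_spec (h : GraphData Γ n q r m) :
    ∀ u < n, ∀ v < n, (keepInduced.sem m).arr KE (u * n + v) ≠ 0 ↔ m.arr KE (u * n + v) ≠ 0 ∨
      (m.arr FL u ≠ 0 ∧ m.arr FL v ≠ 0 ∧ (u = v ∨ Γ.Adj u v)) := by
  have key := acc_rule (x := W) (b := N) (m := m) (a := KE) h.varN (c := for_ W' N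
    (when (.cell FL W) (when (.cell FL W') (when (.cell CN (.pair W W'))
      (store KE (.pair W W') 1)))))
    (fun u k => ∃ v < n, k = u * n + v ∧ m.arr FL u ≠ 0 ∧ m.arr FL v ≠ 0 ∧ (u = v ∨ Γ.Adj u v)) (by
    intro u hu m₁ hA₁ hv₁
    have h₁ := h.agree hA₁ rfl
    refine acc_rule h₁.varN _ ?_
    intro v hv m₂ hA₂ hv₂ k
    have h₂ := h₁.agree hA₂ rfl
    have hu₂ : m₂.var W = u := by rw [hA₂.var rfl, hv₁]
    have hF : m₂.arr FL = m.arr FL := by rw [hA₂.arr rfl, hA₁.arr rfl]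
    have e1 : (Exp.pair W W').eval m₂ = u * n + v := by
      rw [h₂.pair (by simpa [hu₂] using hu)]; simp [hu₂, hv₂]
    simp only [sem_ite, eval_cell, eval_var, hu₂, hv₂, hF, e1, ← h₂.nbhds u hu v hv, sem_store,
      sem_skip, eval_one]
    by_cases c1 : m.arr FL u = 0 <;> by_cases c2 : m.arr FL v = 0 <;>
      by_cases c3 : m₂.arr CN (u * n + v) = 0 <;> by_cases c4 : k = u * n + v <;>
      simp [c1, c2, c3, c4])
  intro u hu v hv
  rw [keepInduced, key]
  refine or_congr Iff.rfl ⟨?_, fun H => ⟨u, hu, v, hv, rfl, H⟩⟩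
  rintro ⟨u', _, v', hv', he, H⟩
  obtain ⟨rfl, rfl⟩ := (Nat.pair_inj hv hv').1 he
  exact H

end GraphData

/-- The memory after the computation of the twin relation. -/
structure TwinData (Γ : SimpleGraph ℕ) (n q r : ℕ) (m : Mem) : Prop extends
    GraphData Γ n q r m where
  twins : ∀ u < n, ∀ v < n, m.arr NT (u * n + v) ≠ 0 ↔ ¬ Γ.AreTwins u v

section TwinData

variable {Γ : SimpleGraph ℕ} {n q r : ℕ} {m m' : Mem}

/-- The command leaves the parts of the memory alone that describe the input graph and the twin
relation. -/
def Cmd.preservesTwins (c : Cmd) : Bool := !c.stores NT && c.preservesGraph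

lemma TwinData.agree (h : TwinData Γ n q r m) {c : Cmd} (hA : Agree c m m')
    (hc : c.preservesTwins = true) : TwinData Γ n q r m' := by
  simp only [Cmd.preservesTwins, Bool.and_eq_true, Bool.not_eq_true'] at hc
  exact ⟨h.toGraphData.agree hA hc.2, by rw [hA.arr hc.1]; exact h.twins⟩

lemma TwinData.eval_eq_zero (h : TwinData Γ n q r m) {e₁ e₂ : Exp} (h₁ : e₁.eval m < n)
    (h₂ : e₂.eval m < n) : (Exp.cell NT (.pair e₁ e₂)).eval m = 0 ↔
      Γ.AreTwins (e₁.eval m) (e₂.eval m) := by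
  have := h.twins _ h₁ _ h₂
  rw [eval_cell, h.pair h₁]
  tauto

lemma _root_.Finset.card_filter_range_succ (p : ℕ → Prop) [DecidablePred p] (n : ℕ) :
    ((Finset.range (n + 1)).filter p).card =
      ((Finset.range n).filter p).card + if p n then 1 else 0 := by
  rw [Finset.range_add_one, Finset.filter_insert]
  split_ifs <;> simp

lemma classSizes_spec (h : TwinData Γ n q r m) (hb : m.var BIG = 0) :
    (∀ u < n, (classSizes.sem m).arr SIZE u = (Γ.twinClass n u).card) ∧
    ((classSizes.sem m).var BIG = 0 → ∀ u < n, (Γ.twinClass n u).card < q) ∧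
    ((classSizes.sem m).var BIG ≠ 0 → (classSizes.sem m).var BU < n ∧
      q ≤ (Γ.twinClass n ((classSizes.sem m).var BU)).card) := by
  classical
  have key := for_rule (x := U) (b := N) (m := m) (c := block [
    assign CNT 0,
    for_ V N (ite (.cell NT (.pair U V)) skip (assign CNT (CNT + 1))),
    store SIZE U CNT,
    when (CNT + 1 - Q) (block [assign BU U, assign BIG 1])])
    (fun i m' => (∀ u < i, m'.arr SIZE u = (Γ.twinClass n u).card) ∧
      (m'.var BIG = 0 → ∀ u < i, (Γ.twinClass n u).card < q) ∧
      (m'.var BIG ≠ 0 → m'.var BU < n ∧ q ≤ (Γ.twinClass n (m'.var BU)).card))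
    (by simp [hb]) (by
      intro u hu m₁ hA₁ hv₁ ⟨P1, P2, P3⟩
      rw [h.varN] at hu
      have h₁ := h.agree hA₁ rfl
      set m₂ := m₁.set CNT 0 with hm₂
      have hin := for_rule (x := V) (b := N) (m := m₂)
        (c := ite (.cell NT (.pair U V)) skip (assign CNT (CNT + 1)))
        (fun i m' => m'.var CNT = ((Finset.range i).filter (Γ.AreTwins u)).card) (by simp [hm₂]) (by
          intro v hv m₃ hA₃ hv₃ hP
          have h₂ : TwinData Γ n q r m₂ := h₁.agree (c := assign CNT 0) (agree_sem _ _) rfl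
          have h₃ := h₂.agree hA₃ rfl
          rw [h₂.varN] at hv
          have hu₃ : m₃.var U = u := by rw [hA₃.var rfl]; simp [hm₂, hv₁]
          have := h₃.eval_eq_zero (e₁ := U) (e₂ := V) (by simpa [hu₃]) (by simpa [hv₃])
          simp only [eval_var, hu₃, hv₃] at this
          rw [Finset.card_filter_range_succ, ← hP]
          by_cases ht : Γ.AreTwins u v
          · rw [sem_ite, if_pos (this.2 ht)]; simp [ht]
          · rw [sem_ite, if_neg (fun h' => ht (this.1 h'))]; simp [ht])
      have hC : ((for_ V N (ite (.cell NT (.pair U V)) skip (assign CNT (CNT + 1)))).sem m₂).var CNT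
          = (Γ.twinClass n u).card := by
        rw [hin]; simp [hm₂, h₁.varN, SimpleGraph.twinClass]
      have hA := agree_sem (for_ V N (ite (.cell NT (.pair U V)) skip (assign CNT (CNT + 1)))) m₂
      simp only [sem_block_cons, sem_assign, sem_store, sem_ite, eval_zero, ← hm₂, sem_block_nil,
        sem_skip]
      generalize
        (for_ V N (ite (.cell NT (.pair U V)) skip (assign CNT (CNT + 1)))).sem m₂ = m₃ at *
      have a1 : m₃.var U = u := by rw [hA.var rfl]; simp [hm₂, hv₁]
      have a2 : m₃.arr SIZE = m₁.arr SIZE := by rw [hA.arr rfl]; simp [hm₂]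
      have a3 : m₃.var Q = q := by rw [hA.var rfl]; simp [hm₂, h₁.varQ]
      have a4 : m₃.var BIG = m₁.var BIG := by rw [hA.var rfl]; simp [hm₂]
      have a5 : m₃.var BU = m₁.var BU := by rw [hA.var rfl]; simp [hm₂]
      have hS : ∀ v ≤ u, (if v = u then (Γ.twinClass n u).card else m₁.arr SIZE v) =
          (Γ.twinClass n v).card := by
        intro v hv
        split_ifs with hvu
        · rw [hvu]
        · exact P1 v (by omega)
      by_cases hq : (Γ.twinClass n u).card + 1 - q = 0
      · simp only [a1, a2, hC, a3, Mem.set_arr, Mem.put_arr_self, eval_add, eval_sub, eval_var,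
          eval_one, Mem.put_var, hq, if_true, ne_eq, reduceCtorEq,
          not_false_eq_true, Mem.set_var_ne, a4, a5, Nat.lt_succ_iff]
        refine ⟨hS, fun hb v hv => ?_, P3⟩
        rcases hv.lt_or_eq with hv | rfl
        · exact P2 hb v hv
        · omega
      · simp only [a1, a2, hC, a3, Mem.set_arr, Mem.put_arr_self, eval_add, eval_sub, eval_var,
          eval_one, Mem.put_var, hq, if_false, ne_eq, not_false_eq_true, reduceCtorEq,
          Mem.set_var_ne, Mem.set_var_self, Nat.lt_succ_iff, one_ne_zero, false_imp_iff, true_and]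
        exact ⟨hS, fun _ => ⟨hu, by omega⟩⟩)
  rw [h.varN] at key
  exact key

lemma bigClique_spec (h : TwinData Γ n q r m) (h0 : ∀ k, m.arr FL k = 0) (hu : m.var BU < n)
    (hq : q ≤ (Γ.twinClass n (m.var BU)).card) : ∃ F ⊆ Γ.twinClass n (m.var BU), F.card = q ∧
      ∀ k, (bigClique.sem m).arr FL k ≠ 0 ↔ k ∈ F := by
  classical
  have key := for_rule (x := W) (b := N) (m := m.set CNT 0)
    (c := ite (.cell NT (.pair BU W)) skip
      (when (Q - CNT) (block [store FL W 1, assign CNT (CNT + 1)])))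
    (fun i m' => m'.var CNT = min q ((Finset.range i).filter (Γ.AreTwins (m.var BU))).card ∧
      ∃ F ⊆ (Finset.range i).filter (Γ.AreTwins (m.var BU)), F.card = m'.var CNT ∧
        ∀ k, m'.arr FL k ≠ 0 ↔ k ∈ F) (by simp [h0]) (by
      intro w hw m₁ hA hv ⟨P1, F, hF, hc, P2⟩
      have h₀ : TwinData Γ n q r (m.set CNT 0) :=
        h.agree (c := assign CNT 0) (agree_sem _ _) rfl
      have h₁ := h₀.agree hA rfl
      rw [h₀.varN] at hw
      have hu₁ : m₁.var BU = m.var BU := by rw [hA.var rfl]; simp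
      have ht := h₁.eval_eq_zero (e₁ := BU) (e₂ := W) (by simpa [hu₁]) (by simpa [hv])
      simp only [eval_var, hu₁, hv] at ht
      have hsub : (Finset.range w).filter (Γ.AreTwins (m.var BU)) ⊆
          (Finset.range (w + 1)).filter (Γ.AreTwins (m.var BU)) :=
        Finset.filter_subset_filter _ (by simp)
      simp only [Finset.card_filter_range_succ]
      by_cases htw : Γ.AreTwins (m.var BU) w
      · by_cases hfull : m₁.var CNT < q
        · have hne : ¬ (q - m₁.var CNT = 0) := by omega
          have hwF : w ∉ F := fun h => by simpa using hF h
          simp only [sem_ite, ht.2 htw, if_true, eval_sub, eval_var,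
            h₁.varQ, hne, if_false, sem_block_cons, sem_block_nil, sem_store,
            sem_assign, Mem.set_arr, Mem.put_arr_self, hv, htw]
          refine ⟨by simp; omega, insert w F, ?_, by simp [hwF, hc], fun k => ?_⟩
          · rw [Finset.insert_subset_iff]
            exact ⟨by simp [htw], hF.trans hsub⟩
          · rw [Finset.mem_insert, ← P2]
            by_cases hk : k = w <;> simp [hk]
        · have hne : (q - m₁.var CNT = 0) := by omega
          simp only [sem_ite, ht.2 htw, if_true, eval_sub, eval_var,
            h₁.varQ, hne, sem_skip, htw, if_true]
          exact ⟨by simp; omega, F, hF.trans hsub, by simpa using hc, P2⟩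
      · have hne : ¬ ((Exp.cell NT (.pair BU W)).eval m₁ = 0) := by rwa [ht]
        simp only [sem_ite, hne, sem_skip, htw, if_false]
        exact ⟨by simpa using P1, F, hF.trans hsub, by simpa using hc, P2⟩)
  obtain ⟨P1, F, hF, hc, P2⟩ := key
  simp only [ne_eq, reduceCtorEq, not_false_eq_true, Mem.set_var_ne, h.varN] at P1 hF hc P2
  refine ⟨F, hF, ?_, by simpa [bigClique] using P2⟩
  rw [hc, P1]
  exact min_eq_left hq

end TwinData

end LoopLang

/-! ### Approximating the twin-cover -/

namespace SimpleGraph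

variable {Γ : SimpleGraph ℕ} {n : ℕ}

/-- A matching among the edges that do not join twins. -/
structure IsNonTwinMatching (Γ : SimpleGraph ℕ) (M : Finset (ℕ × ℕ)) : Prop where
  adj : ∀ e ∈ M, Γ.Adj e.1 e.2
  not_twins : ∀ e ∈ M, ¬ Γ.AreTwins e.1 e.2
  disjoint : ∀ e ∈ M, ∀ f ∈ M, e ≠ f → e.1 ≠ f.1 ∧ e.1 ≠ f.2 ∧ e.2 ≠ f.1 ∧ e.2 ≠ f.2

/-- Every twin-cover contains an endpoint of each of the edges of the matching. -/
lemma IsNonTwinMatching.card_le {M : Finset (ℕ × ℕ)} (h : Γ.IsNonTwinMatching M) {Y : Finset ℕ}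
    (hY : Γ.IsTwinCover Y) : M.card ≤ Y.card := by
  refine Finset.card_le_card_of_injOn (fun e => if e.1 ∈ Y then e.1 else e.2) ?_ ?_
  · intro e he
    rcases hY (h.adj e he) with h1 | h1 | h1
    · simp [Finset.mem_coe.1 h1]
    · dsimp only
      split_ifs with h2
      exacts [h2, h1]
    · exact absurd h1 (h.not_twins e he)
  · intro e he f hf hef
    by_contra hne
    obtain ⟨h1, h2, h3, h4⟩ := h.disjoint e he f hf hne
    dsimp only at hef
    split_ifs at hef <;> contradiction

/-- The vertices below `n` that are twins of an endpoint of one of the edges in `M`. -/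
noncomputable def closedEnds (Γ : SimpleGraph ℕ) (n : ℕ) (M : Finset (ℕ × ℕ)) : Finset ℕ :=
  M.biUnion fun e => Γ.twinClass n e.1 ∪ Γ.twinClass n e.2

lemma mem_closedEnds {M : Finset (ℕ × ℕ)} {w : ℕ} :
    w ∈ Γ.closedEnds n M ↔ w < n ∧ ∃ e ∈ M, Γ.AreTwins e.1 w ∨ Γ.AreTwins e.2 w := by
  simp only [closedEnds, Finset.mem_biUnion, Finset.mem_union, mem_twinClass]
  constructor
  · rintro ⟨e, he, h | h⟩
    exacts [⟨h.1, e, he, .inl h.2⟩, ⟨h.1, e, he, .inr h.2⟩]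
  · rintro ⟨hw, e, he, h | h⟩
    exacts [⟨e, he, .inl ⟨hw, h⟩⟩, ⟨e, he, .inr ⟨hw, h⟩⟩]

lemma card_closedEnds_le {q : ℕ} (hq : ∀ u < n, (Γ.twinClass n u).card ≤ q) (hb : Γ.BoundedBy n)
    {M : Finset (ℕ × ℕ)} (h : Γ.IsNonTwinMatching M) :
    (Γ.closedEnds n M).card ≤ M.card * (2 * q) := by
  refine Finset.card_biUnion_le_card_mul _ _ _ fun e he => (Finset.card_union_le _ _).trans ?_
  have h1 := hq e.1 (hb (h.adj e he))
  have h2 := hq e.2 (hb (h.adj e he).symm)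
  omega

lemma IsNonTwinMatching.insert {M : Finset (ℕ × ℕ)} (h : Γ.IsNonTwinMatching M) {u v : ℕ}
    (huv : Γ.Adj u v) (hnt : ¬ Γ.AreTwins u v)
    (hu : ∀ e ∈ M, e.1 ≠ u ∧ e.2 ≠ u) (hv : ∀ e ∈ M, e.1 ≠ v ∧ e.2 ≠ v) :
    Γ.IsNonTwinMatching (insert (u, v) M) where
  adj := by simpa [huv] using h.adj
  not_twins := by simpa [hnt] using h.not_twins
  disjoint := by
    intro e he f hf hef
    rcases Finset.mem_insert.1 he with rfl | he' <;> rcases Finset.mem_insert.1 hf with rfl | hf'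
    · exact absurd rfl hef
    · exact ⟨(hu f hf').1.symm, (hu f hf').2.symm, (hv f hf').1.symm, (hv f hf').2.symm⟩
    · exact ⟨(hu e he').1, (hv e he').1, (hu e he').2, (hv e he').2⟩
    · exact h.disjoint e he' f hf' hef

lemma closedEnds_insert {M : Finset (ℕ × ℕ)} {u v w : ℕ} :
    w ∈ Γ.closedEnds n (insert (u, v) M) ↔
      w ∈ Γ.closedEnds n M ∨ w < n ∧ (Γ.AreTwins u w ∨ Γ.AreTwins v w) := by
  simp only [mem_closedEnds, Finset.mem_insert, exists_eq_or_imp]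
  rw [and_or_left, or_comm]

end SimpleGraph

namespace LoopLang

open Cmd Reg Arr

variable {Γ : SimpleGraph ℕ} {n q r : ℕ} {m m' : Mem}

/-- After the greedy algorithm has dealt with the pairs in `D`, the array `a` marks the twin classes
of the endpoints of a matching that is maximal among the edges in `D`. -/
def Greedy (Γ : SimpleGraph ℕ) (n : ℕ) (D : ℕ → ℕ → Prop) (a : ℕ → ℕ) : Prop :=
  ∃ M : Finset (ℕ × ℕ), Γ.IsNonTwinMatching M ∧ (∀ w, a w ≠ 0 ↔ w ∈ Γ.closedEnds n M) ∧
    ∀ u v, D u v → Γ.Adj u v → ¬ Γ.AreTwins u v → u ∈ Γ.closedEnds n M ∨ v ∈ Γ.closedEnds n M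

lemma Greedy.mono {D D' : ℕ → ℕ → Prop} {a : ℕ → ℕ} (h : Greedy Γ n D a)
    (hD : ∀ u < n, ∀ v < n, D' u v → D u v) (hb : Γ.BoundedBy n) : Greedy Γ n D' a := by
  obtain ⟨M, h1, h2, h3⟩ := h
  exact ⟨M, h1, h2, fun u v hd ha => h3 u v (hD u (hb ha) v (hb ha.symm) hd) ha⟩

lemma greedyStep_spec (h : TwinData Γ n q r m) {D : ℕ → ℕ → Prop} {u v : ℕ} (hu : u < n)
    (hv : v < n) (hU : m.var U = u) (hV : m.var V = v) (hD : Greedy Γ n D (m.arr COV)) :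
    Greedy Γ n (fun a b => D a b ∨ a = u ∧ b = v) (((when (.cell CN (.pair U V))
      (when (.cell NT (.pair U V))
        (ite (.cell COV U) skip (ite (.cell COV V) skip
          (for_ W N (block [
            ite (.cell NT (.pair U W)) skip (store COV W 1),
            ite (.cell NT (.pair V W)) skip (store COV W 1)])))))).sem m).arr COV) := by
  obtain ⟨M, hM, hc, hd⟩ := hD
  have e1 : (Exp.pair U V).eval m = u * n + v := by
    rw [h.pair (by simpa [hU] using hu)]; simp [hU, hV]
  have same : (Γ.Adj u v → ¬ Γ.AreTwins u v → u ∈ Γ.closedEnds n M ∨ v ∈ Γ.closedEnds n M) →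
      Greedy Γ n (fun a b => D a b ∨ a = u ∧ b = v) (m.arr COV) := by
    intro H
    refine ⟨M, hM, hc, ?_⟩
    rintro a b (hab | ⟨rfl, rfl⟩)
    exacts [hd a b hab, H]
  simp only [sem_ite, eval_cell, eval_var, e1, hU, hV, sem_skip]
  split_ifs with c1 c2 c3 c4
  · exact same fun ha => absurd c1 ((h.nbhds u hu v hv).2 (.inr ha))
  · exact same fun _ hnt => absurd c2 ((h.twins u hu v hv).2 hnt)
  · have hnt := (h.twins u hu v hv).1 c2
    have hadj : Γ.Adj u v := ((h.nbhds u hu v hv).1 c1).resolve_left (by rintro rfl; exact hnt rfl)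
    have key := acc_rule (x := W) (a := COV) h.varN (c := block [
            ite (.cell NT (.pair U W)) skip (store COV W 1),
            ite (.cell NT (.pair V W)) skip (store COV W 1)])
      (fun w k => k = w ∧ (Γ.AreTwins u w ∨ Γ.AreTwins v w)) (by
        intro w hw m₁ hA hW k
        have h₁ := h.agree hA rfl
        have hU₁ : m₁.var U = u := by rw [hA.var rfl, hU]
        have hV₁ : m₁.var V = v := by rw [hA.var rfl, hV]
        have f1 := h₁.eval_eq_zero (e₁ := U) (e₂ := W) (by simpa [hU₁]) (by simpa [hW])
        have f2 := h₁.eval_eq_zero (e₁ := V) (e₂ := W) (by simpa [hV₁]) (by simpa [hW])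
        simp only [eval_var, eval_cell, eval_add, hU₁, hV₁, hW] at f1 f2
        simp only [← f1, ← f2]
        simp only [sem_block_cons, sem_block_nil, sem_ite, sem_skip, eval_cell, eval_add, eval_var,
          sem_store, eval_one, Mem.ite_var, Mem.put_var, ite_self, hU₁, hV₁, hW]
        by_cases g1 : m₁.arr NT (m₁.arr MUL u + w) = 0 <;>
          by_cases g2 : m₁.arr NT (m₁.arr MUL v + w) = 0 <;> by_cases g3 : k = w <;>
          simp [g1, g2, g3])
    refine ⟨insert (u, v) M, ?_, ?_, ?_⟩
    · refine hM.insert hadj hnt (fun e he => ⟨?_, ?_⟩) (fun e he => ⟨?_, ?_⟩) <;> rintro rfl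
      · exact (hc _).2 (SimpleGraph.mem_closedEnds.2 ⟨hu, e, he, .inl rfl⟩) c3
      · exact (hc _).2 (SimpleGraph.mem_closedEnds.2 ⟨hu, e, he, .inr rfl⟩) c3
      · exact (hc _).2 (SimpleGraph.mem_closedEnds.2 ⟨hv, e, he, .inl rfl⟩) c4
      · exact (hc _).2 (SimpleGraph.mem_closedEnds.2 ⟨hv, e, he, .inr rfl⟩) c4
    · intro w
      rw [key, SimpleGraph.closedEnds_insert, hc]
      refine or_congr Iff.rfl ⟨?_, ?_⟩
      · rintro ⟨w', hw', rfl, H⟩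
        exact ⟨hw', H⟩
      · rintro ⟨hw, H⟩
        exact ⟨w, hw, rfl, H⟩
    · rintro a b (hab | ⟨rfl, rfl⟩) h1 h2
      · exact (hd a b hab h1 h2).imp (fun h => SimpleGraph.closedEnds_insert.2 (.inl h))
          (fun h => SimpleGraph.closedEnds_insert.2 (.inl h))
      · exact .inl (SimpleGraph.closedEnds_insert.2 (.inr ⟨hu, .inl rfl⟩))
  · exact same fun _ _ => .inr ((hc v).1 c4)
  · exact same fun _ _ => .inl ((hc u).1 c3)

lemma greedyCover_spec (h : TwinData Γ n q r m) (h0 : ∀ k, m.arr COV k = 0) :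
    Greedy Γ n (fun _ _ => True) ((greedyCover.sem m).arr COV) := by
  have := for_rule (x := U) (b := N) (m := m) (c := for_ V N
    (when (.cell CN (.pair U V)) (when (.cell NT (.pair U V))
      (ite (.cell COV U) skip (ite (.cell COV V) skip
        (for_ W N (block [
          ite (.cell NT (.pair U W)) skip (store COV W 1),
          ite (.cell NT (.pair V W)) skip (store COV W 1)])))))))
    (fun u m' => Greedy Γ n (fun a _ => a < u) (m'.arr COV)) ?_ ?_
  · rw [h.varN] at this
    exact this.mono (fun u hu _ _ _ => hu) h.bounded
  · refine ⟨∅, ⟨by simp, by simp, by simp⟩, fun w => ?_, by simp⟩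
    simp [h0, SimpleGraph.closedEnds]
  · intro u hu m₁ hA₁ hU hP
    have h₁ := h.agree hA₁ rfl
    rw [h.varN] at hu
    have := for_rule (x := V) (b := N) (m := m₁) (c :=
      (when (.cell CN (.pair U V)) (when (.cell NT (.pair U V))
        (ite (.cell COV U) skip (ite (.cell COV V) skip
          (for_ W N (block [
            ite (.cell NT (.pair U W)) skip (store COV W 1),
            ite (.cell NT (.pair V W)) skip (store COV W 1)])))))))
      (fun v m' => Greedy Γ n (fun a b => a < u ∨ a = u ∧ b < v) (m'.arr COV)) ?_ ?_
    · rw [h₁.varN] at this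
      exact this.mono (fun a ha b hb' H => by omega) h.bounded
    · exact hP.mono (fun a ha b hb' H => by simpa using H) h.bounded
    · intro v hv m₂ hA₂ hV hP₂
      have h₂ := h₁.agree hA₂ rfl
      rw [h₁.varN] at hv
      exact (greedyStep_spec h₂ hu hv (by rw [hA₂.var rfl, hU]) hV hP₂).mono
        (fun a ha b hb' H => by omega) h.bounded

end LoopLang

namespace SimpleGraph

/-- A twin-cover that consists of full twin classes, contains no isolated vertices, and exceeds the
smallest twin-cover by at most the factor `2 * q`. -/
structure IsApproxCover (Γ : SimpleGraph ℕ) (n q : ℕ) (X : Finset ℕ) : Prop where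
  lt : ∀ u ∈ X, u < n
  cover : Γ.IsTwinCover (X : Set ℕ)
  closed : ∀ u ∈ X, ∀ v, Γ.AreTwins u v → v ∈ X
  exists_adj : ∀ u ∈ X, ∃ v, Γ.Adj u v
  card_le : ∀ Y : Finset ℕ, Γ.IsTwinCover (Y : Set ℕ) → X.card ≤ Y.card * (2 * q)

end SimpleGraph

lemma LoopLang.Greedy.isApproxCover {Γ : SimpleGraph ℕ} {n q : ℕ} {a : ℕ → ℕ}
    (h : Greedy Γ n (fun _ _ => True) a) (hb : Γ.BoundedBy n)
    (hq : ∀ u < n, (Γ.twinClass n u).card ≤ q) :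
    ∃ X, Γ.IsApproxCover n q X ∧ ∀ w, a w ≠ 0 ↔ w ∈ X := by
  obtain ⟨M, h1, h2, h3⟩ := h
  refine ⟨Γ.closedEnds n M, ⟨fun u hu => (SimpleGraph.mem_closedEnds.1 hu).1, ?_, ?_, ?_, ?_⟩, h2⟩
  · intro u v huv
    by_cases ht : Γ.AreTwins u v
    · exact .inr (.inr ht)
    · rcases h3 u v trivial huv ht with h | h
      exacts [.inl h, .inr (.inl h)]
  · intro u hu v huv
    obtain ⟨hlt, e, he, H⟩ := SimpleGraph.mem_closedEnds.1 hu
    refine SimpleGraph.mem_closedEnds.2 ⟨?_, e, he, H.imp (·.trans huv) (·.trans huv)⟩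
    by_cases hne : u = v
    · exact hne ▸ hlt
    · exact hb (huv.adj hne).symm
  · intro u hu
    obtain ⟨_, e, he, H | H⟩ := SimpleGraph.mem_closedEnds.1 hu
    exacts [H.exists_adj (h1.adj e he), H.exists_adj (h1.adj e he).symm]
  · exact fun Y hY => (SimpleGraph.card_closedEnds_le hq hb h1).trans
      (Nat.mul_le_mul_right _ (h1.card_le hY))

/-! ### Rows and their vectors -/

/-- The value at the `GF(2)`-vector `a` of length `r` of the linear functional `φ`. The nonzero
numbers in `a` stand for the entries `1`. -/
def dot (φ : ℕ → ZMod 2) (r : ℕ) (a : ℕ → ℕ) : ZMod 2 :=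
  ∑ c ∈ Finset.range r, if a c = 0 then 0 else φ c

lemma dot_congr {φ : ℕ → ZMod 2} {r : ℕ} {a b : ℕ → ℕ} (h : ∀ c < r, a c = b c) :
    dot φ r a = dot φ r b :=
  Finset.sum_congr rfl fun c hc => by rw [h c (Finset.mem_range.1 hc)]

lemma dot_eq_zero {φ : ℕ → ZMod 2} {r : ℕ} {a : ℕ → ℕ} (h : ∀ c < r, a c = 0) : dot φ r a = 0 :=
  Finset.sum_eq_zero fun c hc => by rw [h c (Finset.mem_range.1 hc), if_pos rfl]

lemma dot_flip (φ : ℕ → ZMod 2) {r z : ℕ} (hz : z < r) (a : ℕ → ℕ) :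
    dot φ r (fun c => if c = z then 1 - a z else a c) = dot φ r a + φ z := by
  have : ∀ c ∈ Finset.range r, (if (if c = z then 1 - a z else a c) = 0 then 0 else φ c) =
      (if a c = 0 then 0 else φ c) + if c = z then φ z else 0 := by
    intro c _
    by_cases hc : c = z
    · subst hc
      by_cases h0 : a c = 0
      · simp [h0]
      · have : 1 - a c = 0 := by omega
        simp [h0, this, CharTwo.add_self_eq_zero]
    · simp [hc]
  rw [dot, Finset.sum_congr rfl this, Finset.sum_add_distrib]
  simp [dot, hz]

lemma dot_xor (φ : ℕ → ZMod 2) {r : ℕ} (a b : ℕ → ℕ) :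
    dot φ r (fun c => if b c = 0 then a c else 1 - a c) = dot φ r a + dot φ r b := by
  rw [dot, dot, dot, ← Finset.sum_add_distrib]
  refine Finset.sum_congr rfl fun c _ => ?_
  by_cases hb : b c = 0
  · simp [hb]
  · by_cases ha : a c = 0
    · simp [ha, hb]
    · have : 1 - a c = 0 := by omega
      simp [ha, hb, this, CharTwo.add_self_eq_zero]

/-- The `i`-th base `n` digit of `x`. -/
def digit (n x i : ℕ) : ℕ := x / n ^ i % n

lemma digit_lt {n : ℕ} (hn : 0 < n) (x i : ℕ) : digit n x i < n := Nat.mod_lt _ hn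

/-- The number of the coordinate for the class size `t` and the tuple that is obtained from
`s 1, …, s (q - 1)` by leaving out `s i`. -/
def coord (n q t : ℕ) (s : ℕ → ℕ) (i : ℕ) : ℕ :=
  (List.range q).foldl (fun z l => if l = 0 ∨ l = i then z else z * n + s l) t

/-- The positions that are left out in the coordinates of the vector of a row, where `t` is
the size of the twin class of the row: all positions but `0` if `t = 1`, and only the position `1`
otherwise, when `q - 2` neighbors are enough to witness that there are too few colors. -/
def omitted (q t : ℕ) : Finset ℕ := (Finset.range q).filter fun i => i ≠ 0 ∧ (t = 1 ∨ i = 1)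

namespace SimpleGraph

/-- The size of the twin class of the first vertex of the row `x`. -/
noncomputable def rowSize (Γ : SimpleGraph ℕ) (n x : ℕ) : ℕ := (Γ.twinClass n (digit n x 0)).card

/-- The value of a linear functional at the vector of the row `x`. -/
noncomputable def rowVal (Γ : SimpleGraph ℕ) (n q : ℕ) (φ : ℕ → ZMod 2) (x : ℕ) : ZMod 2 :=
  ∑ i ∈ omitted q (Γ.rowSize n x), φ (coord n q (Γ.rowSize n x) (digit n x) i)

/-- The row consists of a vertex that is not in `X` and of neighbors of it in `X`. -/
def ValidRow (Γ : SimpleGraph ℕ) (X : Finset ℕ) (n q x : ℕ) : Prop :=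
  digit n x 0 ∉ X ∧ ∀ i < q, i ≠ 0 → Γ.Adj (digit n x 0) (digit n x i) ∧ digit n x i ∈ X

/-- The twins of the vertices of a row. -/
noncomputable def rowClasses (Γ : SimpleGraph ℕ) (n q x : ℕ) : Finset ℕ :=
  (Finset.range q).biUnion fun i => Γ.twinClass n (digit n x i)

lemma mem_rowClasses {Γ : SimpleGraph ℕ} {n q x w : ℕ} :
    w ∈ Γ.rowClasses n q x ↔ w < n ∧ ∃ i < q, Γ.AreTwins (digit n x i) w := by
  simp only [rowClasses, Finset.mem_biUnion, Finset.mem_range, mem_twinClass]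
  constructor
  · rintro ⟨i, hi, hw, h⟩
    exact ⟨hw, i, hi, h⟩
  · rintro ⟨hw, i, hi, h⟩
    exact ⟨i, hi, hw, h⟩

end SimpleGraph

namespace LoopLang

open Cmd Reg Arr

variable {Γ : SimpleGraph ℕ} {n q r : ℕ} {m m' : Mem}

lemma digits_spec (h : GraphData Γ n q r m) {x : ℕ} (hx : m.var X = x) (hr : x < r) :
    ∀ i < q, (digits.sem m).arr S i = digit n x i := by
  have := for_rule (x := I) (b := Q) (m := m.set Y x)
    (c := block [store S I (.cell MOD Y), assign Y (.cell DIV Y)])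
    (fun j m' => (∀ i < j, m'.arr S i = digit n x i) ∧ m'.var Y = x / n ^ j) (by simp) (by
      intro i hi m₁ hA hI ⟨P1, P2⟩
      have h₀ : GraphData Γ n q r (m.set Y x) := h.agree (c := assign Y 0) (m' := m.set Y x)
        ⟨fun {r'} hr' => by
          have : r' ≠ Y := by simpa [Cmd.writes] using hr'
          simp [this], fun _ => rfl, fun _ => rfl⟩ rfl
      have h₁ := h₀.agree hA rfl
      have hlt : x / n ^ i < r := (Nat.div_le_self _ _).trans_lt hr
      have e1 := h₁.tables.mod _ hlt
      have e2 := h₁.tables.div _ hlt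
      simp only [sem_block_cons, sem_block_nil, sem_store, sem_assign, eval_cell, eval_var,
        Mem.set_arr, Mem.put_arr_self, hI, P2, e1, Mem.put_var]
      refine ⟨fun j hj => ?_, ?_⟩
      · split_ifs with hji
        · rw [hji, digit]
        · exact P1 j (by omega)
      · simp [e2, pow_succ, Nat.div_div_eq_div_mul])
  rw [Mem.set_var_ne _ _ (by simp), h.varQ] at this
  simpa [digits, hx] using this.1

/-- The memory after the computation of the cover `X`. -/
structure CoverData (Γ : SimpleGraph ℕ) (X : Finset ℕ) (n q r : ℕ) (m : Mem) : Prop extends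
    TwinData Γ n q r m where
  size : ∀ u < n, m.arr SIZE u = (Γ.twinClass n u).card
  cov : ∀ u < n, m.arr COV u ≠ 0 ↔ u ∈ X

/-- The command leaves the parts of the memory alone that describe the input graph, its twin
classes and the cover. -/
def Cmd.preservesCover (c : Cmd) : Bool := !c.stores SIZE && (!c.stores COV && c.preservesTwins)

variable {X : Finset ℕ}

lemma CoverData.agree (h : CoverData Γ X n q r m) {c : Cmd} (hA : Agree c m m')
    (hc : c.preservesCover = true) : CoverData Γ X n q r m' := by
  simp only [Cmd.preservesCover, Bool.and_eq_true, Bool.not_eq_true'] at hc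
  refine ⟨h.toTwinData.agree hA hc.2.2, ?_, ?_⟩
  · rw [hA.arr hc.1]; exact h.size
  · rw [hA.arr hc.2.1]; exact h.cov

lemma checkRow_spec (h : CoverData Γ X n q r m) (hn : 0 < n) (hq : 0 < q) {x : ℕ}
    (hS : ∀ i < q, m.arr S i = digit n x i) :
    (checkRow.sem m).var OK ≠ 0 ↔ Γ.ValidRow X n q x := by
  have hlt := digit_lt hn x
  simp only [checkRow, sem_block_cons, sem_block_nil]
  have a0 : ((ite (.cell COV (.cell S 0)) (assign OK 0) (assign OK 1)).sem m).var OK ≠ 0 ↔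
      digit n x 0 ∉ X := by
    rw [← h.cov _ (hlt 0), ← hS 0 hq]
    by_cases h0 : m.arr COV (m.arr S 0) = 0 <;> simp [h0]
  have hA₀ := agree_sem (ite (.cell COV (.cell S 0)) (assign OK 0) (assign OK 1)) m
  set m₀ := (ite (.cell COV (.cell S 0)) (assign OK 0) (assign OK 1)).sem m
  have h₀ := h.agree hA₀ rfl
  have hS₀ : m₀.arr S = m.arr S := hA₀.arr rfl
  have := for_rule (x := I) (b := Q) (m := m₀) (c := when I
    (ite (.cell CN (.pair (.cell S 0) (.cell S I)))
      (ite (.cell COV (.cell S I)) skip (assign OK 0))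
      (assign OK 0)))
    (fun j m' => m'.var OK ≠ 0 ↔ digit n x 0 ∉ X ∧ ∀ i < j, i ≠ 0 →
      (digit n x 0 = digit n x i ∨ Γ.Adj (digit n x 0) (digit n x i)) ∧ digit n x i ∈ X)
    (by simpa using a0) (by
      intro i hi m₁ hA hI hP
      rw [h₀.varQ] at hi
      have h₁ := h₀.agree hA rfl
      have hS₁ : ∀ i < q, m₁.arr S i = digit n x i := by
        rw [hA.arr rfl, hS₀]; exact hS
      have e1 : (Exp.pair (.cell S 0) (.cell S I)).eval m₁ = digit n x 0 * n + digit n x i := by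
        rw [h₁.pair] <;> simp [hS₁ 0 hq, hI, hS₁ i hi, hlt]
      have hsplit : (digit n x 0 ∉ X ∧ ∀ j < i + 1, j ≠ 0 →
          (digit n x 0 = digit n x j ∨ Γ.Adj (digit n x 0) (digit n x j)) ∧ digit n x j ∈ X) ↔
          m₁.var OK ≠ 0 ∧ (i ≠ 0 → (digit n x 0 = digit n x i ∨
            Γ.Adj (digit n x 0) (digit n x i)) ∧ digit n x i ∈ X) := by
        rw [hP]
        constructor
        · rintro ⟨b0, b⟩
          exact ⟨⟨b0, fun j hj => b j (by omega)⟩, b i (by omega)⟩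
        · rintro ⟨⟨b0, b⟩, b'⟩
          refine ⟨b0, fun j hj => ?_⟩
          rcases Nat.lt_succ_iff_lt_or_eq.1 hj with hj | rfl
          exacts [b j hj, b']
      rw [hsplit, ← h₁.nbhds _ (hlt 0) _ (hlt i), ← h₁.cov _ (hlt i)]
      simp only [sem_ite, eval_cell, eval_var, e1, hI, hS₁ i hi, sem_skip, sem_assign, eval_zero]
      by_cases b1 : i = 0 <;> by_cases b2 : m₁.arr CN (digit n x 0 * n + digit n x i) = 0 <;>
        by_cases b3 : m₁.arr COV (digit n x i) = 0 <;> simp [b1, b2, b3])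
  rw [h₀.varQ] at this
  rw [this, SimpleGraph.ValidRow]
  refine and_congr_right fun h0 => forall₃_congr fun i hi hi0 => ?_
  constructor
  · rintro ⟨b | b, b'⟩
    · exact absurd (b ▸ b') h0
    · exact ⟨b, b'⟩
  · rintro ⟨b, b'⟩
    exact ⟨.inr b, b'⟩

/-- The partial sums of Horner's rule. -/
lemma coord_prefix_lt {t : ℕ} {s : ℕ → ℕ} (ht : t < n) (hs : ∀ l, s l < n) (i j : ℕ) :
    (List.range j).foldl (fun z l => if l = 0 ∨ l = i then z else z * n + s l) t <
      n ^ (max j 1) := by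
  have hn : 0 < n := by omega
  induction j with
  | zero => simpa
  | succ j ih =>
    rw [List.range_succ, List.foldl_append]
    generalize (List.range j).foldl _ t = z at *
    simp only [List.foldl_cons, List.foldl_nil]
    split_ifs with hj
    · exact ih.trans_le (Nat.pow_le_pow_right hn (by omega))
    · have hj1 : max (j + 1) 1 = max j 1 + 1 := by omega
      rw [hj1, pow_succ]
      have : (z + 1) * n ≤ n ^ (max j 1) * n := Nat.mul_le_mul_right _ ih
      have := hs j
      rw [add_mul] at *
      omega

/-- A class size and `q - 2` vertices make a number below `n ^ q`, with room to spare. -/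
lemma coord_lt {t : ℕ} {s : ℕ → ℕ} (hq : 0 < q) (ht : t < n) (hs : ∀ l, s l < n) (i : ℕ) :
    coord n q t s i < n ^ q := by
  have := coord_prefix_lt ht hs i q
  rwa [max_eq_left (by omega)] at this

/-- The subroutine adds the unit vector for the coordinate that leaves out the position `I`. -/
lemma flip_spec (h : GraphData Γ n q r m) (hr : r = n ^ q) (hq : 0 < q) {s : ℕ → ℕ} {t i : ℕ}
    (hS : ∀ i < q, m.arr S i = s i) (hs : ∀ l, s l < n) (ht : t < n) (hT : m.var T = t)
    (hI : m.var I = i) :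
    (rowVector.flip.sem m).arr VEC = fun c => if c = coord n q t s i then
      1 - m.arr VEC (coord n q t s i) else m.arr VEC c := by
  have key := for_rule (x := L) (b := Q) (m := m.set Z (m.var T))
    (c := when L (when (.ne L I) (assign Z (.cell MUL Z + .cell S L))))
    (fun j m' => m'.var Z =
      (List.range j).foldl (fun z l => if l = 0 ∨ l = i then z else z * n + s l) t)
    (by simp [hT]) (by
      intro j hj m₁ hA hL hP
      have hj' : j < q := by simpa [h.varQ] using hj
      have hI₁ : m₁.var I = i := by rw [hA.var rfl]; simp [hI]
      have hM₁ : m₁.arr MUL = m.arr MUL := by rw [hA.arr rfl]; simp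
      have hS₁ : m₁.arr S = m.arr S := by rw [hA.arr rfl]; simp
      have hz := coord_prefix_lt ht hs i j
      rw [List.range_succ, List.foldl_append, List.foldl_cons, List.foldl_nil, ← hP]
      rw [← hP] at hz
      have hzr : m₁.var Z < r := hz.trans_le (hr ▸ Nat.pow_le_pow_right (by omega) (by omega))
      have hne : j - i + (i - j) = 0 ↔ j = i := by omega
      simp only [sem_ite, eval_var, hL, eval_add, eval_sub, hI₁, sem_skip, sem_assign, eval_cell,
        hM₁, hS₁, hS j hj', h.tables.mul _ hzr, hne]
      by_cases b1 : j = 0 <;> by_cases b2 : j = i <;> simp [b1, b2])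
  have hA := agree_sem (for_ L Q (when L (when (.ne L I) (assign Z (.cell MUL Z + .cell S L)))))
    (m.set Z (m.var T))
  rw [Mem.set_var_ne _ _ (by simp), h.varQ] at key
  have key' : _ = coord n q t s i := key
  simp only [rowVector.flip, sem_block_cons, sem_block_nil, sem_store, sem_assign, eval_var,
    eval_sub, eval_cell, eval_one, key', hA.arr (a := VEC) rfl, Mem.set_arr]
  funext c
  simp [hA.arr (a := VEC) rfl]

lemma rowVector_spec (h : CoverData Γ X n q r m) (hr : r = n ^ q) (hn : 0 < n) (hq : 0 < q) {x : ℕ}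
    (hS : ∀ i < q, m.arr S i = digit n x i) (ht : Γ.rowSize n x < n) :
    (∀ φ, dot φ r ((rowVector.sem m).arr VEC) = Γ.rowVal n q φ x) ∧
    ∀ c < r, (rowVector.sem m).arr VEC c ≠ 0 → ∃ i ∈ omitted q (Γ.rowSize n x),
      c = coord n q (Γ.rowSize n x) (digit n x) i := by
  set t := Γ.rowSize n x with htdef
  have h0 := for_rule (x := C) (b := R) (m := m) (c := store VEC C 0)
    (fun j m' => ∀ c < j, m'.arr VEC c = 0) (by simp) (by
      intro i hi m₁ hA hC hP c hc
      simp only [sem_store, Mem.set_arr, Mem.put_arr_self, eval_var, hC, eval_zero]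
      split_ifs with hci
      · rfl
      · exact hP c (by omega))
  rw [h.varR] at h0
  have hA₁ := agree_sem (for_ C R (store VEC C 0)) m
  simp only [rowVector, sem_block_cons, sem_block_nil, sem_assign]
  generalize (for_ C R (store VEC C 0)).sem m = m₁ at *
  have h₁ := h.agree hA₁ rfl
  have hS₁ : ∀ i < q, m₁.arr S i = digit n x i := by rw [hA₁.arr rfl]; exact hS
  have e0 : Exp.eval m₁ (.cell SIZE (.cell S 0)) = t := by
    simp only [eval_cell, eval_zero, hS₁ 0 hq, h₁.size _ (digit_lt hn x 0)]
    rfl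
  rw [e0]
  have h₂ : CoverData Γ X n q r (m₁.set T t) := by
    have := h₁.agree (agree_sem (assign T (.cell SIZE (.cell S 0))) m₁) rfl
    rwa [sem_assign, e0] at this
  have key := for_rule (x := I) (b := Q) (m := m₁.set T t) (c := when I
    (ite (.ne T 1)
      (ite (.ne I 1) skip rowVector.flip)
      rowVector.flip))
    (fun j m' => (∀ φ, dot φ r (m'.arr VEC) =
        ∑ i ∈ (Finset.range j).filter fun i => i ≠ 0 ∧ (t = 1 ∨ i = 1),
          φ (coord n q t (digit n x) i)) ∧
      ∀ c < r, m'.arr VEC c ≠ 0 → ∃ i < j, (i ≠ 0 ∧ (t = 1 ∨ i = 1)) ∧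
        c = coord n q t (digit n x) i) ?_ ?_
  · rw [Mem.set_var_ne _ _ (by simp), h₁.varQ] at key
    refine ⟨key.1, fun c hc hv => ?_⟩
    obtain ⟨i, hi, h1, h2⟩ := key.2 c hc hv
    exact ⟨i, by simp [omitted, hi, h1], h2⟩
  · refine ⟨fun φ => ?_, fun c hc hv => absurd (h0 c hc) hv⟩
    simpa using dot_eq_zero h0
  · intro i hi m₂ hA hI ⟨P1, P2⟩
    rw [h₂.varQ] at hi
    have h₃ := h₂.agree hA rfl
    have hT : m₂.var T = t := by rw [hA.var rfl]; simp
    have hS₂ : ∀ i < q, m₂.arr S i = digit n x i := by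
      rw [hA.arr rfl, Mem.set_arr]; exact hS₁
    have hf := flip_spec h₃.toGraphData hr hq hS₂ (digit_lt hn x) ht hT hI
    have hne : ∀ a b : ℕ, a - b + (b - a) = 0 ↔ a = b := by omega
    rw [Finset.range_add_one, Finset.filter_insert]
    have hskip : ¬ (i ≠ 0 ∧ (t = 1 ∨ i = 1)) → (m₂.set I (i + 1)).arr VEC = m₂.arr VEC ∧
        (Cmd.sem (when I (ite (.ne T 1) (ite (.ne I 1) skip rowVector.flip) rowVector.flip)) m₂) =
          m₂ := by
      intro H
      refine ⟨rfl, ?_⟩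
      simp only [sem_ite, eval_var, hI, eval_add, eval_sub, eval_one, hT, hne, sem_skip]
      by_cases b1 : i = 0 <;> by_cases b2 : t = 1 <;> by_cases b3 : i = 1 <;> simp_all
    by_cases hc : i ≠ 0 ∧ (t = 1 ∨ i = 1)
    · have : (Cmd.sem (when I (ite (.ne T 1) (ite (.ne I 1) skip rowVector.flip) rowVector.flip))
          m₂) = rowVector.flip.sem m₂ := by
        simp only [sem_ite, eval_var, hI, eval_add, eval_sub, eval_one, hT, hne, sem_skip]
        by_cases b2 : t = 1 <;> by_cases b3 : i = 1 <;> simp_all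
      rw [this, Mem.set_arr, hf]
      refine ⟨fun φ => ?_, fun c hcr hv => ?_⟩
      · rw [dot_flip φ (hr ▸ coord_lt hq ht (digit_lt hn x) i), P1, if_pos hc,
          Finset.sum_insert (by simp), add_comm]
      · dsimp only at hv
        split_ifs at hv with hci
        · exact ⟨i, by omega, hc, hci⟩
        · obtain ⟨j, hj, h1, h2⟩ := P2 c hcr hv
          exact ⟨j, by omega, h1, h2⟩
    · rw [(hskip hc).2, if_neg hc]
      refine ⟨P1, fun c hcr hv => ?_⟩
      obtain ⟨j, hj, h1, h2⟩ := P2 c hcr hv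
      exact ⟨j, by omega, h1, h2⟩

end LoopLang

/-! ### Elimination -/

namespace LoopLang

open Cmd Reg Arr

variable {Γ : SimpleGraph ℕ} {X : Finset ℕ} {n q r : ℕ} {m m' : Mem}

/-- The vectors `bas (p * r), …, bas (p * r + r - 1)`, for the indices `p` marked in `has`, have
their leading entry at the coordinate `p`. -/
def Echelon (r : ℕ) (has bas : ℕ → ℕ) : Prop :=
  ∀ p < r, has p ≠ 0 → bas (p * r + p) ≠ 0 ∧ ∀ c < p, bas (p * r + c) = 0

/-- Add the basis vector with the offset `PB` to `VEC`. -/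
lemma xor_spec (m : Mem) :
    ((for_ C R (when (.cell BAS (PB + C)) (store VEC C (1 - .cell VEC C)))).sem m).arr VEC =
      fun c => if c < m.var R then
        (if m.arr BAS (m.var PB + c) = 0 then m.arr VEC c else 1 - m.arr VEC c)
      else m.arr VEC c := by
  refine for_rule (fun j m' => m'.arr VEC = fun c => if c < j then
        (if m.arr BAS (m.var PB + c) = 0 then m.arr VEC c else 1 - m.arr VEC c)
      else m.arr VEC c) (by simp) ?_
  intro j hj m₁ hA hC hP
  have h1 : m₁.arr BAS = m.arr BAS := hA.arr rfl
  have h2 : m₁.var PB = m.var PB := hA.var rfl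
  funext c
  simp only [sem_ite, eval_cell, eval_add, eval_var, hC, h1, h2, sem_store, sem_skip, eval_sub,
    eval_one, hP, lt_irrefl, if_false, Mem.set_arr, Mem.ite_arr, Mem.put_arr_self]
  by_cases b1 : m.arr BAS (m.var PB + j) = 0 <;> rcases lt_trichotomy c j with b2 | rfl | b2
  · simp [b1, b2, b2.trans (Nat.lt_succ_self j)]
  · simp [b1]
  · have : ¬ c < j + 1 := by omega
    have : ¬ c < j := by omega
    simp [*]
  · simp [b1, b2, b2.ne, b2.trans (Nat.lt_succ_self j)]
  · simp [b1]
  · have : ¬ c < j + 1 := by omega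
    have : ¬ c < j := by omega
    simp [b2.ne', *]

/-- What reduction by the basis achieves, from the memory `m` to the memory `m'`; `p` is the number
of coordinates dealt with so far. The values of functionals that vanish on the basis are unchanged,
and the support stays in every set that contains the supports of the vector and of the basis. -/
structure Reduced (r : ℕ) (m m' : Mem) (p : ℕ) : Prop where
  dot : ∀ φ, (∀ p < r, m.arr HAS p ≠ 0 → dot φ r (fun c => m.arr BAS (p * r + c)) = 0) →
    dot φ r (m'.arr VEC) = dot φ r (m.arr VEC)
  support : ∀ K : Set ℕ, (∀ c < r, m.arr VEC c ≠ 0 → c ∈ K) →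
    (∀ p < r, m.arr HAS p ≠ 0 → ∀ c < r, m.arr BAS (p * r + c) ≠ 0 → c ∈ K) →
    ∀ c < r, m'.arr VEC c ≠ 0 → c ∈ K
  unfinished : m'.var FIN = 0 → ∀ c < p, m'.arr VEC c = 0
  finished : m'.var FIN ≠ 0 → m'.var PIV < r ∧ m'.var PVB = m'.var PIV * r ∧
    m.arr HAS (m'.var PIV) = 0 ∧ m'.arr VEC (m'.var PIV) ≠ 0 ∧
    ∀ c < m'.var PIV, m'.arr VEC c = 0

lemma reduce_spec (hR : m.var R = r) (hE : Echelon r (m.arr HAS) (m.arr BAS)) :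
    Reduced r m (reduce.sem m) r := by
  have key := for_rule (x := P) (b := R) (m := (m.set FIN 0).set PB 0) (c := block [
    when (.cell VEC P) (ite FIN skip
      (ite (.cell HAS P)
        (for_ C R (when (.cell BAS (PB + C)) (store VEC C (1 - .cell VEC C))))
        (block [assign FIN 1, assign PIV P, assign PVB PB]))),
    assign PB (PB + R)])
    (fun p m' => Reduced r m m' p ∧ m'.var PB = p * r) ?_ ?_
  · simpa [reduce, hR] using key.1
  · refine ⟨⟨fun _ _ => rfl, fun K h _ => h, by simp, by simp⟩, by simp⟩
  · intro p hp m₁ hA hPv ⟨hP, hPB⟩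
    rw [Mem.set_var_ne _ _ (by simp), Mem.set_var_ne _ _ (by simp), hR] at hp
    have hR₁ : m₁.var R = r := by rw [hA.var rfl]; simp [hR]
    have hH₁ : m₁.arr HAS = m.arr HAS := by rw [hA.arr rfl]; simp
    have hB₁ : m₁.arr BAS = m.arr BAS := by rw [hA.arr rfl]; simp
    simp only [sem_block_cons, sem_block_nil, sem_assign]
    set m₂ := (when (.cell VEC P) (ite FIN skip
      (ite (.cell HAS P)
        (for_ C R (when (.cell BAS (PB + C)) (store VEC C (1 - .cell VEC C))))
        (block [assign FIN 1, assign PIV P, assign PVB PB])))).sem m₁ with hm₂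
    have hA₂ := agree_sem (when (.cell VEC P) (ite FIN skip
      (ite (.cell HAS P)
        (for_ C R (when (.cell BAS (PB + C)) (store VEC C (1 - .cell VEC C))))
        (block [assign FIN 1, assign PIV P, assign PVB PB])))) m₁
    rw [← hm₂] at hA₂
    have hR₂ : m₂.var R = r := by rw [hA₂.var rfl, hR₁]
    have hPB₂ : m₂.var PB = p * r := by rw [hA₂.var rfl, hPB]
    suffices h : Reduced r m m₂ (p + 1) by
      refine ⟨⟨h.dot, h.support, ?_, ?_⟩, ?_⟩
      · simpa using h.unfinished
      · simpa using h.finished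
      · simp [hPB₂, hR₂, add_mul]
    have same : (m₁.var FIN = 0 → m₁.arr VEC p = 0) → Reduced r m m₁ (p + 1) := by
      refine fun H => ⟨hP.dot, hP.support, fun hF c hc => ?_, hP.finished⟩
      rcases Nat.lt_succ_iff_lt_or_eq.1 hc with hc | rfl
      exacts [hP.unfinished hF c hc, H hF]
    simp only [sem_ite, eval_cell, eval_var, hPv, sem_skip, hH₁] at hm₂
    split_ifs at hm₂ with b1 b2 b3
    · exact hm₂ ▸ same fun _ => b1
    · simp only [sem_block_cons, sem_block_nil, sem_assign, eval_one, eval_var] at hm₂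
      refine ⟨by simpa [hm₂] using hP.dot, by simpa [hm₂] using hP.support, by simp [hm₂],
        fun _ => ?_⟩
      simp only [hm₂, Mem.set_arr, ne_eq, reduceCtorEq, not_false_eq_true, Mem.set_var_ne,
        Mem.set_var_self, hPv, hPB]
      exact ⟨hp, trivial, b3, b1, hP.unfinished b2⟩
    · have hv := xor_spec m₁
      rw [← hm₂] at hv
      have hF : m₂.var FIN = m₁.var FIN := by rw [hm₂, sem_var _ rfl]
      have hv' : ∀ c < r, m₂.arr VEC c = if m.arr BAS (p * r + c) = 0 then m₁.arr VEC c else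
          1 - m₁.arr VEC c := by
        intro c hc
        simp [hv, hR₁, hc, hPB, hB₁]
      obtain ⟨hE1, hE2⟩ := hE p hp b3
      refine ⟨fun φ hφ => ?_, fun K hK hK' c hc hcv => ?_, fun _ c hc => ?_, fun h => ?_⟩
      · rw [dot_congr hv', dot_xor, hφ p hp b3, add_zero, hP.dot φ hφ]
      · rw [hv' c hc] at hcv
        split_ifs at hcv with h0
        · exact hP.support K hK hK' c hc hcv
        · exact hK' p hp b3 c hc h0
      · rcases Nat.lt_succ_iff_lt_or_eq.1 hc with hc | rfl
        · rw [hv' c (by omega), if_pos (hE2 c hc), hP.unfinished b2 c hc]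
        · rw [hv' c hp, if_neg hE1]
          omega
      · exact absurd (hF ▸ b2) h
    · exact hm₂ ▸ same fun h => absurd h b2

lemma addToBasis_spec (hR : m.var R = r) (hpiv : m.var PVB = m.var PIV * r) :
    ((addToBasis.sem m).arr HAS = fun p => if p = m.var PIV then 1 else m.arr HAS p) ∧
    ∀ p, ∀ c < r, (addToBasis.sem m).arr BAS (p * r + c) =
      if p = m.var PIV then m.arr VEC c else m.arr BAS (p * r + c) := by
  simp only [addToBasis, sem_block_cons, sem_block_nil, sem_store, eval_var, eval_one]
  refine ⟨?_, ?_⟩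
  · rw [sem_arr _ rfl]
    funext p
    simp
  have key := for_rule (x := C) (b := R) (m := m.put HAS (m.var PIV) 1)
    (c := store BAS (PVB + C) (.cell VEC C))
    (fun j m' => ∀ p, ∀ c < r, m'.arr BAS (p * r + c) =
      if p = m.var PIV ∧ c < j then m.arr VEC c else m.arr BAS (p * r + c)) (by simp) (by
      intro j hj m₁ hA hC hP p c hc
      rw [Mem.put_var, hR] at hj
      have h1 : m₁.var PVB = m.var PIV * r := by rw [hA.var rfl]; simpa using hpiv
      have h2 : m₁.arr VEC = m.arr VEC := by rw [hA.arr rfl]; simp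
      simp only [sem_store, Mem.set_arr, eval_add, eval_var, h1, hC, eval_cell, h2,
        Mem.put_arr_self, Nat.pair_inj hc hj, hP p c hc]
      by_cases b1 : p = m.var PIV <;> rcases lt_trichotomy c j with b2 | rfl | b2
      · simp [b1, b2, b2.ne, b2.trans (Nat.lt_succ_self j)]
      · simp [b1]
      · have : ¬ c < j + 1 := by omega
        have : ¬ c < j := by omega
        simp [b2.ne', *]
      all_goals simp [b1])
  intro p c hc
  rw [key p c hc]
  simp [hR, hc]

lemma rowClasses_spec (h : TwinData Γ n q r m) (hn : 0 < n) {x : ℕ}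
    (hS : ∀ i < q, m.arr S i = digit n x i) :
    ∀ w < n, (rowClasses.sem m).arr FL w ≠ 0 ↔ w ∈ Γ.rowClasses n q x := by
  have h0 := for_rule (x := W) (b := N) (m := m) (c := store FL W 0)
    (fun j m' => ∀ c < j, m'.arr FL c = 0) (by simp) (by
      intro i hi m₁ hA hC hP c hc
      simp only [sem_store, Mem.set_arr, Mem.put_arr_self, eval_var, hC, eval_zero]
      split_ifs with hci
      · rfl
      · exact hP c (by omega))
  rw [h.varN] at h0
  have hA₁ := agree_sem (for_ W N (store FL W 0)) m
  simp only [rowClasses, sem_block_cons, sem_block_nil]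
  generalize (for_ W N (store FL W 0)).sem m = m₁ at *
  have h₁ := h.agree hA₁ rfl
  have hS₁ : ∀ i < q, m₁.arr S i = digit n x i := by rw [hA₁.arr rfl]; exact hS
  have key := acc_rule (x := I) (m := m₁) (a := FL) h₁.varQ
    (c := for_ W N (ite (.cell NT (.pair (.cell S I) W)) skip (store FL W 1)))
    (fun i k => ∃ w < n, k = w ∧ Γ.AreTwins (digit n x i) w) (by
      intro i hi m₂ hA₂ hI
      have h₂ := h₁.agree hA₂ rfl
      refine acc_rule h₂.varN _ ?_
      intro w hw m₃ hA₃ hW k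
      have h₃ := h₂.agree hA₃ rfl
      have hI₃ : m₃.var I = i := by rw [hA₃.var rfl, hI]
      have hS₃ : m₃.arr S i = digit n x i := by rw [hA₃.arr rfl, hA₂.arr rfl, hS₁ i hi]
      have e := h₃.eval_eq_zero (e₁ := .cell S I) (e₂ := W)
        (by simpa [hI₃, hS₃] using digit_lt hn x i) (by simpa [hW])
      simp only [eval_var, eval_cell, eval_add, hI₃, hS₃, hW] at e
      simp only [← e]
      simp only [sem_ite, eval_cell, eval_add, eval_var, hI₃, hS₃, hW, sem_skip, sem_store,
        eval_one]
      by_cases b1 : m₃.arr NT (m₃.arr MUL (digit n x i) + w) = 0 <;> by_cases b2 : k = w <;>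
        simp [b1, b2])
  intro w hw
  rw [key, h0 w hw, SimpleGraph.mem_rowClasses]
  constructor
  · rintro (h | ⟨i, hi, w', hw', rfl, H⟩)
    · exact absurd rfl h
    · exact ⟨hw', i, hi, H⟩
  · rintro ⟨_, i, hi, H⟩
    exact .inr ⟨i, hi, w, hw, rfl, H⟩

end LoopLang

namespace SimpleGraph

/-- The coordinates that occur in the vectors of valid rows. -/
def coords (Γ : SimpleGraph ℕ) (X : Finset ℕ) (n q : ℕ) : Set ℕ :=
  {c | ∃ x, Γ.ValidRow X n q x ∧ ∃ i ∈ omitted q (Γ.rowSize n x),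
    c = coord n q (Γ.rowSize n x) (digit n x) i}

end SimpleGraph

namespace LoopLang

open Cmd Reg Arr

variable {Γ : SimpleGraph ℕ} {X : Finset ℕ} {n q r : ℕ} {m m' : Mem}

/-- The memory after the rows `0, …, j - 1` have been dealt with, and the rows in `M` among them
have been marked. That one family of vectors lies in the span of another is expressed by linear
functionals: those that vanish on the latter vanish on the former. -/
structure Eliminated (Γ : SimpleGraph ℕ) (X : Finset ℕ) (n q r : ℕ) (j : ℕ) (M : Finset ℕ)
    (m : Mem) : Prop where
  lt : ∀ x ∈ M, x < j
  valid : ∀ x ∈ M, Γ.ValidRow X n q x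
  echelon : Echelon r (m.arr HAS) (m.arr BAS)
  basis_zero : ∀ φ, (∀ x ∈ M, Γ.rowVal n q φ x = 0) → ∀ p < r, m.arr HAS p ≠ 0 →
    dot φ r (fun c => m.arr BAS (p * r + c)) = 0
  row_zero : ∀ φ, (∀ x ∈ M, Γ.rowVal n q φ x = 0) → ∀ x < j, Γ.ValidRow X n q x →
    Γ.rowVal n q φ x = 0
  support : ∀ p < r, m.arr HAS p ≠ 0 → ∀ c < r, m.arr BAS (p * r + c) ≠ 0 → c ∈ Γ.coords X n q
  card : M.card = ((Finset.range r).filter fun p => m.arr HAS p ≠ 0).card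
  kept : ∀ u < n, ∀ v < n, m.arr KE (u * n + v) ≠ 0 ↔
    ((u ∈ X ∧ v ∈ X) ∨ ∃ x ∈ M, u ∈ Γ.rowClasses n q x ∧ v ∈ Γ.rowClasses n q x) ∧
      (u = v ∨ Γ.Adj u v)

/-- The size of the twin class of a row can serve as a digit in base `n`. -/
lemma _root_.SimpleGraph.ValidRow.rowSize_lt (hX : Γ.IsApproxCover n q X) {k x : ℕ} (hq : 2 ≤ k)
    (hn : 0 < n) (h : Γ.ValidRow X n k x) : Γ.rowSize n x < n := by
  obtain ⟨h0, h1⟩ := h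
  have hs : Γ.twinClass n (digit n x 0) ⊆ (Finset.range n).erase (digit n x 1) := by
    intro w hw
    obtain ⟨hw1, hw2⟩ := SimpleGraph.mem_twinClass.1 hw
    refine Finset.mem_erase.2 ⟨?_, by simpa using hw1⟩
    rintro rfl
    exact h0 (hX.closed _ (h1 1 (by omega) one_ne_zero).2 _ hw2.symm)
  refine (Finset.card_le_card hs).trans_lt ?_
  rw [Finset.card_erase_of_mem (by simpa using digit_lt hn x 1), Finset.card_range]
  omega

lemma row_spec {q' : ℕ} (h : CoverData Γ X n q r m) (hX : Γ.IsApproxCover n q' X) (hr : r = n ^ q)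
    (hn : 0 < n) (hq : 2 ≤ q) {x : ℕ} (hx : x < r) (hXv : m.var Reg.X = x) {M : Finset ℕ}
    (hM : Eliminated Γ X n q r x M m) : ∃ M', Eliminated Γ X n q r (x + 1) M' (row.sem m) := by
  have hS := digits_spec h.toGraphData hXv hx
  simp only [row, sem_block_cons, sem_block_nil]
  have hA₁ := agree_sem digits m
  generalize digits.sem m = m₁ at *
  have h₁ := h.agree hA₁ rfl
  have hok := checkRow_spec h₁ hn (by omega) hS
  have hA₂ := agree_sem checkRow m₁
  generalize checkRow.sem m₁ = m₂ at *
  have h₂ := h₁.agree hA₂ rfl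
  have hS₂ : ∀ i < q, m₂.arr S i = digit n x i := by rw [hA₂.arr rfl]; exact hS
  have hH₂ : m₂.arr HAS = m.arr HAS := by rw [hA₂.arr rfl, hA₁.arr rfl]
  have hB₂ : m₂.arr BAS = m.arr BAS := by rw [hA₂.arr rfl, hA₁.arr rfl]
  have hK₂ : m₂.arr KE = m.arr KE := by rw [hA₂.arr rfl, hA₁.arr rfl]
  -- if nothing is marked, then it remains to see that the vector depends on the marked ones
  have same : ∀ m' : Mem, m'.arr HAS = m.arr HAS → m'.arr BAS = m.arr BAS →
      m'.arr KE = m.arr KE → (∀ φ, (∀ x ∈ M, Γ.rowVal n q φ x = 0) → Γ.ValidRow X n q x →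
        Γ.rowVal n q φ x = 0) → Eliminated Γ X n q r (x + 1) M m' := by
    intro m' e1 e2 e3 H
    refine ⟨fun y hy => (hM.lt y hy).trans (Nat.lt_succ_self _), hM.valid, ?_, ?_, ?_, ?_, ?_, ?_⟩
    · rw [e1, e2]; exact hM.echelon
    · rw [e1, e2]; exact hM.basis_zero
    · intro φ hφ y hy hv
      rcases Nat.lt_succ_iff_lt_or_eq.1 hy with hy | rfl
      exacts [hM.row_zero φ hφ y hy hv, H φ hφ hv]
    · rw [e1, e2]; exact hM.support
    · rw [e1]; exact hM.card
    · rw [e3]; exact hM.kept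
  rw [sem_ite, eval_var]
  split_ifs with c1
  · exact ⟨M, same _ hH₂ hB₂ hK₂ fun _ _ hv => absurd c1 (hok.2 hv)⟩
  have hv := hok.1 c1
  have hlt := SimpleGraph.ValidRow.rowSize_lt hX hq hn hv
  obtain ⟨hdot, hsup⟩ := rowVector_spec h₂ hr hn (by omega) hS₂ hlt
  rw [sem_block_cons, sem_block_cons, sem_block_cons, sem_block_nil]
  have hA₃ := agree_sem rowVector m₂
  generalize rowVector.sem m₂ = m₃ at *
  have h₃ := h₂.agree hA₃ rfl
  have hH₃ : m₃.arr HAS = m.arr HAS := by rw [hA₃.arr rfl, hH₂]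
  have hB₃ : m₃.arr BAS = m.arr BAS := by rw [hA₃.arr rfl, hB₂]
  have hred := reduce_spec h₃.varR (by rw [hH₃, hB₃]; exact hM.echelon)
  have hA₄ := agree_sem reduce m₃
  generalize reduce.sem m₃ = m₄ at *
  have h₄ := h₃.agree hA₄ rfl
  have hH₄ : m₄.arr HAS = m.arr HAS := by rw [hA₄.arr rfl, hH₃]
  have hB₄ : m₄.arr BAS = m.arr BAS := by rw [hA₄.arr rfl, hB₃]
  have hK₄ : m₄.arr KE = m.arr KE := by rw [hA₄.arr rfl, hA₃.arr rfl, hK₂]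
  have hS₄ : ∀ i < q, m₄.arr S i = digit n x i := by rw [hA₄.arr rfl, hA₃.arr rfl]; exact hS₂
  have hval : ∀ φ, (∀ x ∈ M, Γ.rowVal n q φ x = 0) →
      dot φ r (m₄.arr VEC) = Γ.rowVal n q φ x := by
    intro φ hφ
    rw [← hdot φ]
    refine hred.dot φ ?_
    rw [hH₃, hB₃]
    exact hM.basis_zero φ hφ
  have hsup₄ : ∀ c < r, m₄.arr VEC c ≠ 0 → c ∈ Γ.coords X n q := by
    refine hred.support _ (fun c hc hcv => ⟨x, hv, hsup c hc hcv⟩) ?_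
    rw [hH₃, hB₃]
    exact hM.support
  rw [sem_ite, eval_var]
  split_ifs with c2
  · refine ⟨M, same _ hH₄ hB₄ hK₄ fun φ hφ _ => ?_⟩
    rw [← hval φ hφ]
    exact dot_eq_zero (hred.unfinished c2)
  obtain ⟨f1, f2, f3, f4, f5⟩ := hred.finished c2
  rw [hH₃] at f3
  obtain ⟨g1, g2⟩ := addToBasis_spec h₄.varR f2
  rw [sem_block_cons, sem_block_cons, sem_block_cons, sem_block_nil]
  have hA₅ := agree_sem addToBasis m₄
  generalize addToBasis.sem m₄ = m₅ at *
  have h₅ := h₄.agree hA₅ rfl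
  have hS₅ : ∀ i < q, m₅.arr S i = digit n x i := by rw [hA₅.arr rfl]; exact hS₄
  have hF := rowClasses_spec h₅.toTwinData hn hS₅
  have hA₆ := agree_sem rowClasses m₅
  generalize rowClasses.sem m₅ = m₆ at *
  have h₆ := h₅.agree hA₆ rfl
  have hK₆ : m₆.arr KE = m.arr KE := by rw [hA₆.arr rfl, hA₅.arr rfl, hK₄]
  have hK := keepInduced_spec h₆.toGraphData
  have hA₇ := agree_sem keepInduced m₆
  generalize keepInduced.sem m₆ = m₇ at *
  have hH₇ : m₇.arr HAS = fun p => if p = m₄.var PIV then 1 else m.arr HAS p := by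
    rw [hA₇.arr rfl, hA₆.arr rfl, g1, hH₄]
  have hB₇ : ∀ p, ∀ c < r, m₇.arr BAS (p * r + c) =
      if p = m₄.var PIV then m₄.arr VEC c else m.arr BAS (p * r + c) := by
    rw [hA₇.arr rfl, hA₆.arr rfl]
    simpa only [hB₄] using g2
  have hxM : x ∉ M := fun hx => (hM.lt x hx).false
  refine ⟨insert x M, ?_, ?_, ?_, ?_, ?_, ?_, ?_, ?_⟩
  · intro y hy
    rcases Finset.mem_insert.1 hy with rfl | hy
    exacts [Nat.lt_succ_self _, (hM.lt y hy).trans (Nat.lt_succ_self _)]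
  · intro y hy
    rcases Finset.mem_insert.1 hy with rfl | hy
    exacts [hv, hM.valid y hy]
  · intro p hp hH
    rw [hH₇] at hH
    rw [hB₇ p p hp]
    split_ifs with hpp
    · refine ⟨hpp ▸ f4, fun c hc => ?_⟩
      rw [hB₇ p c (hc.trans hp), if_pos hpp]
      exact f5 c (hpp ▸ hc)
    · simp only [hpp, if_false] at hH
      refine ⟨(hM.echelon p hp hH).1, fun c hc => ?_⟩
      rw [hB₇ p c (hc.trans hp), if_neg hpp]
      exact (hM.echelon p hp hH).2 c hc
  · intro φ hφ p hp hH
    have hφM : ∀ x ∈ M, Γ.rowVal n q φ x = 0 := fun y hy => hφ y (Finset.mem_insert_of_mem hy)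
    rw [dot_congr (hB₇ p)]
    split_ifs with hpp
    · rw [hval φ hφM]
      exact hφ x (Finset.mem_insert_self _ _)
    · simp only [hH₇, hpp, if_false] at hH
      exact hM.basis_zero φ hφM p hp hH
  · intro φ hφ y hy hyv
    rcases Nat.lt_succ_iff_lt_or_eq.1 hy with hy | rfl
    · exact hM.row_zero φ (fun y hy => hφ y (Finset.mem_insert_of_mem hy)) y hy hyv
    · exact hφ _ (Finset.mem_insert_self _ _)
  · intro p hp hH c hc hcv
    rw [hB₇ p c hc] at hcv
    split_ifs at hcv with hpp
    · exact hsup₄ c hc hcv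
    · simp only [hH₇, hpp, if_false] at hH
      exact hM.support p hp hH c hc hcv
  · have : ((Finset.range r).filter fun p => m₇.arr HAS p ≠ 0) =
        insert (m₄.var PIV) ((Finset.range r).filter fun p => m.arr HAS p ≠ 0) := by
      ext p
      simp only [hH₇, Finset.mem_filter, Finset.mem_range, Finset.mem_insert]
      by_cases hpp : p = m₄.var PIV
      · simp [hpp, f1]
      · simp [hpp]
    rw [this, Finset.card_insert_of_notMem hxM, hM.card,
      Finset.card_insert_of_notMem (by simp [f3])]
  · intro u hu v hv'
    rw [hK u hu v hv', hF u hu, hF v hv', hK₆, hM.kept u hu v hv']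
    simp only [Finset.mem_insert, exists_eq_or_imp]
    constructor
    · rintro (⟨h | h, hP⟩ | ⟨h, h', hP⟩)
      exacts [⟨.inl h, hP⟩, ⟨.inr (.inr h), hP⟩, ⟨.inr (.inl ⟨h, h'⟩), hP⟩]
    · rintro ⟨h | h | h, hP⟩
      exacts [.inl ⟨.inl h, hP⟩, .inr ⟨h.1, h.2, hP⟩, .inl ⟨.inr h, hP⟩]

end LoopLang

/-! ### Selection of the reduced graph -/

namespace SimpleGraph

/-- The rows in `M` are valid, their vectors span the vectors of all valid rows, and there are at
most as many of them as there are coordinates. Spanning is expressed by linear functionals. -/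
structure IsMarking (Γ : SimpleGraph ℕ) (X : Finset ℕ) (n q : ℕ) (M : Finset ℕ) : Prop where
  valid : ∀ x ∈ M, Γ.ValidRow X n q x
  row_zero : ∀ φ, (∀ x ∈ M, Γ.rowVal n q φ x = 0) → ∀ x < n ^ q, Γ.ValidRow X n q x →
    Γ.rowVal n q φ x = 0
  card_le : ∃ P : Finset ℕ, (P : Set ℕ) ⊆ Γ.coords X n q ∧ M.card ≤ P.card

/-- The sets of vertices whose induced subgraphs make up the reduced graph: a clique of `q + 1`
twins if there is one; otherwise a twin-cover and the twins of the vertices of the marked rows. -/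
inductive IsKeptFamily (Γ : SimpleGraph ℕ) (n q : ℕ) : Finset (Finset ℕ) → Prop
  | clique (u : ℕ) (F : Finset ℕ) (hF : F ⊆ Γ.twinClass n u) (hc : F.card = q + 1) :
      IsKeptFamily Γ n q {F}
  | cover (X M : Finset ℕ) (hq : ∀ u < n, (Γ.twinClass n u).card ≤ q)
      (hX : Γ.IsApproxCover n q X) (hM : Γ.IsMarking X n (q + 1) M) :
      IsKeptFamily Γ n q (insert X (M.image (Γ.rowClasses n (q + 1))))

end SimpleGraph

namespace LoopLang

open Cmd Reg Arr

variable {Γ : SimpleGraph ℕ} {X : Finset ℕ} {n q r : ℕ} {m m' : Mem}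

/-- The array `KE` describes the union of the subgraphs of `Γ` that are induced by the sets in `𝓕`;
the diagonal marks the vertices. -/
def Keeps (Γ : SimpleGraph ℕ) (n : ℕ) (𝓕 : Finset (Finset ℕ)) (m : Mem) : Prop :=
  ∀ u < n, ∀ v < n, m.arr KE (u * n + v) ≠ 0 ↔
    (∃ F ∈ 𝓕, u ∈ F ∧ v ∈ F) ∧ (u = v ∨ Γ.Adj u v)

lemma rows_spec {q' : ℕ} (h : CoverData Γ X n q r m) (hX : Γ.IsApproxCover n q' X)
    (hr : r = n ^ q) (hn : 0 < n) (hq : 2 ≤ q) (hM : Eliminated Γ X n q r 0 ∅ m) :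
    ∃ M, Eliminated Γ X n q r r M ((for_ Reg.X R row).sem m) := by
  have := for_rule (x := Reg.X) (b := R) (m := m) (c := row)
    (fun j m' => ∃ M, Eliminated Γ X n q r j M m') ⟨∅, ?_⟩ ?_
  · rwa [h.varR] at this
  · exact ⟨hM.lt, hM.valid, hM.echelon, hM.basis_zero, hM.row_zero, hM.support, hM.card, hM.kept⟩
  · rintro x hx m₁ hA hv ⟨M, hM⟩
    rw [h.varR] at hx
    obtain ⟨M', hM'⟩ := row_spec (h.agree hA rfl) hX hr hn hq hx hv hM
    exact ⟨M', hM'.lt, hM'.valid, hM'.echelon, hM'.basis_zero, hM'.row_zero, hM'.support, hM'.card,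
      hM'.kept⟩

lemma Eliminated.isMarking {M : Finset ℕ} (h : Eliminated Γ X n q r r M m) (hr : r = n ^ q) :
    Γ.IsMarking X n q M where
  valid := h.valid
  row_zero := hr ▸ h.row_zero
  card_le := by
    refine ⟨_, ?_, h.card.le⟩
    intro p hp
    simp only [Finset.coe_filter, Finset.mem_range, Set.mem_ofPred_eq] at hp
    exact h.support p hp.1 hp.2 p hp.1 (h.echelon p hp.1 hp.2).1

lemma select_spec (h : TwinData Γ n (q + 1) r m) (hr : r = n ^ (q + 1)) (hn : 0 < n) (hq : 1 ≤ q)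
    (hFL : ∀ k, m.arr FL k = 0) (hCOV : ∀ k, m.arr COV k = 0) (hHAS : ∀ k, m.arr HAS k = 0)
    (hKE : ∀ k, m.arr KE k = 0)
    (hsize : ∀ u < n, m.arr SIZE u = (Γ.twinClass n u).card)
    (hsmall : m.var BIG = 0 → ∀ u < n, (Γ.twinClass n u).card < q + 1)
    (hbig : m.var BIG ≠ 0 → m.var BU < n ∧ q + 1 ≤ (Γ.twinClass n (m.var BU)).card) :
    ∃ 𝓕, Γ.IsKeptFamily n q 𝓕 ∧ Keeps Γ n 𝓕 (select.sem m) := by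
  simp only [select, sem_ite, eval_var]
  split_ifs with hb
  · have hq' : ∀ u < n, (Γ.twinClass n u).card ≤ q := fun u hu => Nat.lt_succ_iff.1 (hsmall hb u hu)
    obtain ⟨X, hX, hXa⟩ := (greedyCover_spec h hCOV).isApproxCover h.bounded hq'
    rw [sem_block_cons, sem_block_cons, sem_block_cons, sem_block_cons, sem_block_nil]
    have hA₁ := agree_sem greedyCover m
    generalize greedyCover.sem m = m₁ at *
    have h₁ : CoverData Γ X n (q + 1) r m₁ :=
      ⟨h.agree hA₁ rfl, by rw [hA₁.arr rfl]; exact hsize, fun u _ => hXa u⟩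
    have hF₂ := for_rule (x := W) (b := N) (m := m₁) (c := store FL W (.cell COV W))
      (fun j m' => ∀ w < j, m'.arr FL w = m₁.arr COV w) (by simp) (by
        intro i hi m₂ hA hW hP w hw
        have : m₂.arr COV = m₁.arr COV := hA.arr rfl
        simp only [sem_store, Mem.set_arr, Mem.put_arr_self, eval_var, hW, eval_cell, this]
        split_ifs with hwi
        · rw [hwi]
        · exact hP w (by omega))
    rw [h₁.varN] at hF₂
    have hA₂ := agree_sem (for_ W N (store FL W (.cell COV W))) m₁
    generalize (for_ W N (store FL W (.cell COV W))).sem m₁ = m₂ at *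
    have h₂ := h₁.agree hA₂ rfl
    have hK := keepInduced_spec h₂.toGraphData
    have hA₃ := agree_sem keepInduced m₂
    generalize keepInduced.sem m₂ = m₃ at *
    have h₃ := h₂.agree hA₃ rfl
    have hH₃ : ∀ p, m₃.arr HAS p = 0 := by
      rw [hA₃.arr rfl, hA₂.arr rfl, hA₁.arr rfl]; exact hHAS
    have hE₂ : ∀ k, m₂.arr KE k = 0 := by
      rw [hA₂.arr rfl, hA₁.arr rfl]; exact hKE
    obtain ⟨M, hM⟩ := rows_spec (q := q + 1) h₃ hX hr hn (by omega)
      ⟨by simp, by simp, fun p _ hp => absurd (hH₃ p) hp, fun _ _ p _ hp => absurd (hH₃ p) hp,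
        by simp, fun p _ hp => absurd (hH₃ p) hp, by simp [hH₃], by
        intro u hu v hv
        rw [hK u hu v hv, hE₂, hF₂ u hu, hF₂ v hv, hXa, hXa]
        simp [and_assoc]⟩
    refine ⟨_, .cover X M hq' hX (hM.isMarking hr), fun u hu v hv => ?_⟩
    rw [hM.kept u hu v hv]
    simp
  · obtain ⟨hu, hc⟩ := hbig hb
    obtain ⟨F, hF, hFc, hFa⟩ := bigClique_spec h hFL hu hc
    refine ⟨_, .clique _ F hF hFc, ?_⟩
    rw [sem_block_cons, sem_block_cons, sem_block_nil]
    have hA₁ := agree_sem bigClique m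
    generalize bigClique.sem m = m₁ at *
    have h₁ := h.agree hA₁ rfl
    have hE₁ : ∀ k, m₁.arr KE k = 0 := by rw [hA₁.arr rfl]; exact hKE
    intro u hu v hv
    rw [keepInduced_spec h₁.toGraphData u hu v hv, hE₁, hFa, hFa]
    simp [and_assoc]

/-! ### Output -/

/-- The function `L` enumerates the numbers below `n` that are marked on the diagonal of the matrix
`ke` by the numbers below `n'`. -/
structure Listed (n : ℕ) (ke : ℕ → ℕ) (n' : ℕ) (L : ℕ → ℕ) : Prop where
  inj : ∀ i < n', ∀ j < n', L i = L j → i = j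
  mem : ∀ v, (∃ i < n', L i = v) ↔ v < n ∧ ke (v * n + v) ≠ 0

lemma listKept_spec (h : GraphData Γ n q r m) (h0 : m.var NV = 0) :
    Listed n (m.arr KE) ((listKept.sem m).var NV) ((listKept.sem m).arr KEPT) := by
  have := for_rule (x := V) (b := N) (m := m)
    (c := when (.cell KE (.pair V V)) (block [store KEPT NV V, assign NV (NV + 1)]))
    (fun k m' => (∀ i < m'.var NV, ∀ j < m'.var NV, m'.arr KEPT i = m'.arr KEPT j → i = j) ∧
      ∀ v, (∃ i < m'.var NV, m'.arr KEPT i = v) ↔ v < k ∧ m.arr KE (v * n + v) ≠ 0)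
    (by simp [h0]) (by
      intro k hk m₁ hA hV ⟨P1, P2⟩
      have h₁ := h.agree hA rfl
      rw [h.varN] at hk
      have hE : m₁.arr KE = m.arr KE := hA.arr rfl
      have e : (Exp.pair V V).eval m₁ = k * n + k := by
        rw [h₁.pair (by simpa [hV])]; simp [hV]
      simp only [sem_ite, eval_cell, e, hE, sem_skip]
      split_ifs with hc
      · refine ⟨P1, fun v => ?_⟩
        simp only [ne_eq, reduceCtorEq, not_false_eq_true, Mem.set_var_ne, Mem.set_arr]
        rw [P2]
        refine ⟨fun H => ⟨by omega, H.2⟩, fun H => ⟨?_, H.2⟩⟩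
        have : v ≠ k := by rintro rfl; exact H.2 hc
        omega
      · simp only [sem_block_cons, sem_block_nil, sem_store, sem_assign, eval_add, eval_var,
          eval_one, ne_eq, reduceCtorEq, not_false_eq_true, Mem.set_var_ne, Mem.set_arr,
          Mem.put_var, hV, Mem.set_var_self, Mem.put_arr_self]
        have hlt : ∀ i < m₁.var NV, m₁.arr KEPT i < k := fun i hi => ((P2 _).1 ⟨i, hi, rfl⟩).1
        refine ⟨fun i hi j hj hij => ?_, fun v => ?_⟩
        · split_ifs at hij with g1 g2 g2
          · omega
          · have := hlt j (by omega); omega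
          · have := hlt i (by omega); omega
          · exact P1 i (by omega) j (by omega) hij
        · constructor
          · rintro ⟨i, hi, hiv⟩
            split_ifs at hiv with g1
            · subst hiv
              exact ⟨by omega, hc⟩
            · have := (P2 v).1 ⟨i, by omega, hiv⟩
              exact ⟨by omega, this.2⟩
          · rintro ⟨hv, hvc⟩
            rcases Nat.lt_succ_iff_lt_or_eq.1 hv with hv | rfl
            · obtain ⟨i, hi, hiv⟩ := (P2 v).2 ⟨hv, hvc⟩
              exact ⟨i, by omega, by rw [if_neg (by omega), hiv]⟩
            · exact ⟨m₁.var NV, by omega, by simp⟩)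
  rw [h.varN] at this
  exact ⟨this.1, this.2⟩

/-- A number `Z ≤ N` has at most `N` binary digits, so the `N` rounds of the loop output all of
them; the rounds with `Z = 0` have no effect. -/
lemma emitNumber_out (m : Mem) (h : m.var Z ≤ m.var N) :
    (emitNumber.sem m).out = m.out ++ encodeNumber (m.var Z) := by
  have key := for_rule (x := B) (b := N) (m := m) (c := when Z (block [
    emit 1,
    emit (Z - (.half Z + .half Z)),
    assign Z (.half Z)]))
    (fun j m' => m'.out ++ (m'.var Z).bits.flatMap (fun b => [true, b]) =
      m.out ++ (m.var Z).bits.flatMap (fun b => [true, b]) ∧ m'.var Z = m.var Z / 2 ^ j)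
    (by simp) (by
      intro j _ m₁ hA _ ⟨P1, P2⟩
      have hz : m₁.var Z / 2 = m.var Z / 2 ^ (j + 1) := by
        rw [P2, Nat.div_div_eq_div_mul, pow_succ]
      simp only [sem_ite, eval_var, sem_skip]
      split_ifs with hc
      · rw [hc] at hz
        simp only [Mem.set_out, ne_eq, reduceCtorEq, not_false_eq_true, Mem.set_var_ne]
        exact ⟨P1, by rw [hc, ← hz]⟩
      · simp only [sem_block_cons, sem_block_nil, sem_emit, sem_assign, eval_sub, eval_add,
          eval_half, eval_var, eval_one, Mem.push_var, Mem.set_out, Mem.push_out, ne_eq,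
          reduceCtorEq,
          not_false_eq_true, Mem.set_var_ne, Mem.set_var_self, hz, and_true]
        rw [← P1, ← hz]
        have hb : m₁.var Z = Nat.bit (decide (m₁.var Z % 2 = 1)) (m₁.var Z / 2) := by
          rw [Nat.bit_val]
          have := Nat.div_add_mod (m₁.var Z) 2
          rcases Nat.mod_two_eq_zero_or_one (m₁.var Z) with g | g <;> simp [g] <;> omega
        have hbits : (m₁.var Z).bits = decide (m₁.var Z % 2 = 1) :: (m₁.var Z / 2).bits := by
          conv_lhs => rw [hb]
          refine Nat.bits_append_bit _ _ fun h0 => ?_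
          have : m₁.var Z = 1 := by omega
          simp [this]
        have hd : decide (m₁.var Z - (m₁.var Z / 2 + m₁.var Z / 2) ≠ 0) =
            decide (m₁.var Z % 2 = 1) := by
          congr 1
          apply propext
          omega
        rw [hbits, ← hd]
        simp)
  have hz : ((for_ B N (when Z (block [
    emit 1,
    emit (Z - (.half Z + .half Z)),
    assign Z (.half Z)]))).sem m).var Z = 0 := by
    rw [key.2]
    exact Nat.div_eq_of_lt (h.trans_lt Nat.lt_two_pow_self)
  have h1 := key.1
  rw [hz] at h1
  simp only [emitNumber, sem_block_cons, sem_block_nil, sem_emit, Mem.push_out, encodeNumber]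
  simp only [Nat.zero_bits, List.flatMap_nil, List.append_nil] at h1
  rw [h1]
  simp

open Classical in
lemma output_spec (m : Mem) (hn : m.var NV ≤ m.var N) (A : ℕ → ℕ → Prop)
    (hM : ∀ v < m.var N, m.arr MUL v = v * m.var N)
    (hL : ∀ i < m.var NV, m.arr KEPT i < m.var N)
    (hA : ∀ i < m.var NV, ∀ j < m.var NV, A i j ↔
      i ≠ j ∧ m.arr KE (m.arr KEPT i * m.var N + m.arr KEPT j) ≠ 0) :
    (output.sem m).out = m.out ++ (encodeNumber (m.var NV) ++
      (List.range (m.var NV)).flatMap fun i =>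
        ((List.range (m.var NV)).filter fun j => A i j).flatMap (fun j => encodeNumber (j + 1)) ++
          encodeNumber 0) := by
  simp only [output, sem_block_cons, sem_block_nil, sem_assign, eval_var]
  have h1 := emitNumber_out (m.set Z (m.var NV)) (by simpa using hn)
  have hA₁ := agree_sem emitNumber (m.set Z (m.var NV))
  generalize emitNumber.sem (m.set Z (m.var NV)) = m₁ at *
  simp only [Mem.set_out, Mem.set_var_self] at h1
  have hN₁ : m₁.var N = m.var N := by rw [hA₁.var rfl]; simp
  have hV₁ : m₁.var NV = m.var NV := by rw [hA₁.var rfl]; simp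
  have ha₁ : ∀ a, m₁.arr a = m.arr a := fun a => by rw [hA₁.arr (by cases a <;> rfl)]; rfl
  have key := for_rule (x := I) (b := NV) (m := m₁) (c := block [
    for_ J NV (when (.ne I J) (when (.cell KE (.pair (.cell KEPT I) (.cell KEPT J)))
      (block [assign Z (J + 1), emitNumber]))),
    emit 0])
    (fun k m' => m'.out = m.out ++ (encodeNumber (m.var NV) ++
      (List.range k).flatMap fun i =>
        ((List.range (m.var NV)).filter fun j => A i j).flatMap (fun j => encodeNumber (j + 1)) ++
          encodeNumber 0)) (by simp [h1]) ?_
  · rwa [hV₁] at key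
  intro i hi m₂ hA₂ hI hP
  have hN₂ : m₂.var N = m.var N := by rw [hA₂.var rfl, hN₁]
  have hV₂ : m₂.var NV = m.var NV := by rw [hA₂.var rfl, hV₁]
  have ha₂ : ∀ a, m₂.arr a = m.arr a := fun a => by rw [hA₂.arr (by cases a <;> rfl), ha₁]
  rw [hV₁] at hi
  have inner := for_rule (x := J) (b := NV) (m := m₂)
    (c := when (.ne I J) (when (.cell KE (.pair (.cell KEPT I) (.cell KEPT J)))
      (block [assign Z (J + 1), emitNumber])))
    (fun k m' => m'.out = m₂.out ++
      ((List.range k).filter fun j => A i j).flatMap (fun j => encodeNumber (j + 1)))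
    (by simp) (by
      intro j hj m₃ hA₃ hJ hP₃
      rw [hV₂] at hj
      have hN₃ : m₃.var N = m.var N := by rw [hA₃.var rfl, hN₂]
      have hI₃ : m₃.var I = i := by rw [hA₃.var rfl, hI]
      have ha₃ : ∀ a, m₃.arr a = m.arr a := fun a => by rw [hA₃.arr (by cases a <;> rfl), ha₂]
      have hem := emitNumber_out (m₃.set Z (j + 1)) (by simp [hN₃]; omega)
      have hne : i - j + (j - i) = 0 ↔ i = j := by omega
      rw [List.range_succ, List.filter_append, List.flatMap_append, ← List.append_assoc, ← hP₃]
      simp only [sem_ite, eval_add, eval_sub, eval_var, hI₃, hJ, hne, eval_cell, ha₃,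
        hM _ (hL i hi), sem_block_cons, sem_block_nil, sem_assign, eval_one, sem_skip, Mem.set_out]
      have hAij := hA i hi j hj
      by_cases b1 : i = j
      · have : ¬ A i j := fun h => (hAij.1 h).1 b1
        simp [b1, b1 ▸ this]
      · by_cases b2 : m.arr KE (m.arr KEPT i * m.var N + m.arr KEPT j) = 0
        · have : ¬ A i j := fun h => (hAij.1 h).2 b2
          simp [b1, b2, this]
        · have : A i j := hAij.2 ⟨b1, b2⟩
          simp only [b1, b2, if_false, hem]
          simp [this])
  rw [hV₂] at inner
  simp only [sem_block_cons, sem_block_nil, sem_emit, eval_zero, Mem.set_out, Mem.push_out]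
  rw [inner, hP, List.range_succ, List.flatMap_append]
  simp [encodeNumber]

end LoopLang

/-! ### Twin-covers and size of the reduced graph -/

/-- The number with the digits `L` in base `n` after the leading digit `t`. -/
def horner (n t : ℕ) (L : List ℕ) : ℕ := L.foldl (fun z d => z * n + d) t

lemma horner_inj {n t t' : ℕ} {L L' : List ℕ} (hl : L.length = L'.length) (hL : ∀ d ∈ L, d < n)
    (hL' : ∀ d ∈ L', d < n) (h : horner n t L = horner n t' L') : t = t' ∧ L = L' := by
  induction L generalizing t t' L' with
  | nil =>
    obtain rfl : L' = [] := List.length_eq_zero_iff.1 hl.symm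
    exact ⟨h, rfl⟩
  | cons d L ih =>
    obtain _ | ⟨d', L''⟩ := L'
    · simp at hl
    · obtain ⟨h1, rfl⟩ := ih (t := t * n + d) (t' := t' * n + d') (L' := L'')
        (by simpa using hl) (fun e he => hL e (by simp [he]))
        (fun e he => hL' e (by simp [he])) h
      obtain ⟨rfl, rfl⟩ := (Nat.pair_inj (hL d (by simp)) (hL' d' (by simp))).1 h1
      exact ⟨rfl, rfl⟩

/-- The positions in a row that contribute to the coordinate that leaves out the position `i`. -/
def positions (q i : ℕ) : List ℕ := (List.range q).filter fun l => ¬ (l = 0 ∨ l = i)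

lemma mem_positions {q i l : ℕ} : l ∈ positions q i ↔ l < q ∧ l ≠ 0 ∧ l ≠ i := by
  simp [positions]

lemma length_positions {q i : ℕ} (hi : i ∈ Finset.range (q + 1)) (h0 : i ≠ 0) :
    (positions (q + 1) i).length = q - 1 := by
  have h : ((Finset.range (q + 1)).filter fun l => ¬ (l = 0 ∨ l = i)).card =
      (positions (q + 1) i).length := rfl
  have h2 : ((Finset.range (q + 1)).filter fun l => ¬ (l = 0 ∨ l = i)) =
      ((Finset.range (q + 1)).erase 0).erase i := by
    ext l
    simp only [Finset.mem_filter, Finset.mem_erase]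
    tauto
  rw [← h, h2, Finset.card_erase_of_mem (by simpa [h0] using hi),
    Finset.card_erase_of_mem (by simp), Finset.card_range]
  omega

lemma coord_eq_horner (n q t : ℕ) (s : ℕ → ℕ) (i : ℕ) :
    coord n q t s i = horner n t ((positions q i).map s) := by
  rw [coord, horner, List.foldl_map, positions, List.foldl_filter]
  congr 1
  funext z l
  by_cases h : l = 0 ∨ l = i <;> simp [h]

lemma mem_omitted {q t i : ℕ} : i ∈ omitted q t ↔ i < q ∧ i ≠ 0 ∧ (t = 1 ∨ i = 1) := by
  simp [omitted]

namespace SimpleGraph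

section keptGraph

variable {V : Type*} {Γ : SimpleGraph V} {𝓕 : Finset (Finset V)}

/-- The union of the subgraphs that are induced by the sets in `𝓕`. The vertices in none of these
sets are isolated. -/
def keptGraph (Γ : SimpleGraph V) (𝓕 : Finset (Finset V)) : SimpleGraph V where
  Adj u v := Γ.Adj u v ∧ ∃ F ∈ 𝓕, u ∈ F ∧ v ∈ F
  symm := ⟨fun _ _ h => ⟨h.1.symm, h.2.imp fun _ h => ⟨h.1, h.2.2, h.2.1⟩⟩⟩
  loopless := ⟨fun _ h => h.1.ne rfl⟩

/-- Twins remain twins if only subgraphs induced by unions of twin classes are kept. -/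
lemma AreTwins.keptGraph (h𝓕 : ∀ F ∈ 𝓕, ∀ u ∈ F, ∀ v, Γ.AreTwins u v → v ∈ F) {u v : V}
    (h : Γ.AreTwins u v) (ha : (Γ.keptGraph 𝓕).Adj u v) : (Γ.keptGraph 𝓕).AreTwins u v := by
  have key : ∀ u v w, Γ.AreTwins u v → (Γ.keptGraph 𝓕).Adj u v →
      (u = w ∨ (Γ.keptGraph 𝓕).Adj u w) → (v = w ∨ (Γ.keptGraph 𝓕).Adj v w) := by
    rintro u v w h ha (rfl | ⟨hw, F, hF, huF, hwF⟩)
    · exact .inr ha.symm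
    · by_cases hvw : v = w
      · exact .inl hvw
      · exact .inr ⟨h.adj_of_adj hw hvw, F, hF, h𝓕 F hF u huF v h, hwF⟩
  exact areTwins_iff.2 fun w => ⟨key u v w h ha, key v u w h.symm ha.symm⟩

lemma IsTwinCover.keptGraph {Y : Set V} (hY : Γ.IsTwinCover Y)
    (h𝓕 : ∀ F ∈ 𝓕, ∀ u ∈ F, ∀ v, Γ.AreTwins u v → v ∈ F) : (Γ.keptGraph 𝓕).IsTwinCover Y := by
  intro u v huv
  rcases hY huv.1 with h | h | h
  exacts [.inl h, .inr (.inl h), .inr (.inr (h.keptGraph h𝓕 huv))]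

lemma IsTwinCover.comap {W : Type*} {Y : Set V} (hY : Γ.IsTwinCover Y) (f : W ↪ V) :
    (Γ.comap f).IsTwinCover (f ⁻¹' Y) := by
  intro u v huv
  rcases hY huv with h | h | h
  · exact .inl h
  · exact .inr (.inl h)
  · refine .inr (.inr (areTwins_iff.2 fun w => ?_))
    simpa using areTwins_iff.1 h (f w)

end keptGraph

variable {Γ : SimpleGraph ℕ} {n q : ℕ} {𝓕 : Finset (Finset ℕ)}

lemma BoundedBy.lt_of_areTwins (h : Γ.BoundedBy n) {u v : ℕ} (huv : Γ.AreTwins u v) (hu : u < n) :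
    v < n := by
  by_cases hne : u = v
  · exact hne ▸ hu
  · exact h (huv.adj hne).symm

/-- Twin-covers of the input graph are twin-covers of the reduced graph. -/
lemma IsKeptFamily.isTwinCover (h : Γ.IsKeptFamily n q 𝓕) (hb : Γ.BoundedBy n) {Y : Set ℕ}
    (hY : Γ.IsTwinCover Y) : (Γ.keptGraph 𝓕).IsTwinCover Y := by
  cases h with
  | clique u F hF hc =>
    -- the reduced graph is a clique, and all its vertices are twins
    have adj : ∀ v ∈ F, ∀ w ∈ F, v ≠ w → (Γ.keptGraph {F}).Adj v w := fun v hv w hw hne =>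
      ⟨((mem_twinClass.1 (hF hv)).2.symm.trans (mem_twinClass.1 (hF hw)).2).adj hne,
        F, by simp, hv, hw⟩
    rintro v w ⟨-, F', hF', hv, hw⟩
    obtain rfl := Finset.mem_singleton.1 hF'
    have key : ∀ v ∈ F', ∀ z, (v = z ∨ (Γ.keptGraph {F'}).Adj v z) ↔ z ∈ F' := by
      intro v hv z
      constructor
      · rintro (rfl | ⟨-, F'', hF'', -, hz⟩)
        · exact hv
        · rwa [Finset.mem_singleton.1 hF''] at hz
      · intro hz
        by_cases hvz : v = z
        exacts [.inl hvz, .inr (adj v hv z hz hvz)]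
    exact .inr (.inr (areTwins_iff.2 fun z => by rw [key v hv, key w hw]))
  | cover X M hq hX hM =>
    refine hY.keptGraph fun F hF u hu v huv => ?_
    rcases Finset.mem_insert.1 hF with rfl | hF
    · exact hX.closed u hu v huv
    · obtain ⟨x, -, rfl⟩ := Finset.mem_image.1 hF
      obtain ⟨hlt, i, hi, h⟩ := mem_rowClasses.1 hu
      exact mem_rowClasses.2 ⟨hb.lt_of_areTwins huv hlt, i, hi, h.trans huv⟩

lemma ValidRow.exists_adj {X : Finset ℕ} {x : ℕ} (h : Γ.ValidRow X n (q + 1) x) (hq : 1 ≤ q) {i : ℕ}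
    (hi : i < q + 1) : ∃ v, Γ.Adj (digit n x i) v := by
  by_cases h0 : i = 0
  · exact ⟨_, h0 ▸ (h.2 1 (by omega) one_ne_zero).1⟩
  · exact ⟨_, (h.2 i hi h0).1.symm⟩

lemma IsKeptFamily.exists_adj (h : Γ.IsKeptFamily n q 𝓕) (hq : 1 ≤ q) :
    ∀ F ∈ 𝓕, ∀ u ∈ F, ∃ v, Γ.Adj u v := by
  cases h with
  | clique u F hF hc =>
    intro F' hF' v hv
    obtain rfl := Finset.mem_singleton.1 hF'
    obtain ⟨w, hw, hne⟩ := Finset.exists_mem_ne (s := F') (by omega) v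
    exact ⟨w, ((mem_twinClass.1 (hF hv)).2.symm.trans (mem_twinClass.1 (hF hw)).2).adj hne.symm⟩
  | cover X M _ hX hM =>
    intro F hF u hu
    rcases Finset.mem_insert.1 hF with rfl | hF
    · exact hX.exists_adj u hu
    · obtain ⟨x, hx, rfl⟩ := Finset.mem_image.1 hF
      obtain ⟨-, i, hi, h⟩ := mem_rowClasses.1 hu
      obtain ⟨v, hv⟩ := (hM.valid x hx).exists_adj hq hi
      exact h.exists_adj hv

/-- There are at most as many coordinates as pairs of a class size and `q - 1` vertices in `X`. -/
lemma card_le_of_subset_coords {X P : Finset ℕ} (hn : 0 < n)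
    (hq : ∀ u < n, (Γ.twinClass n u).card ≤ q) (hP : (P : Set ℕ) ⊆ Γ.coords X n (q + 1)) :
    P.card ≤ (q + 1) * X.card ^ (q - 1) := by
  have hsub : P ⊆ (Finset.range (q + 1) ×ˢ Fintype.piFinset fun _ : Fin (q - 1) => X).image
      fun p => horner n p.1 (List.ofFn p.2) := by
    intro c hc
    obtain ⟨x, hx, i, hi, rfl⟩ := hP hc
    obtain ⟨hi1, hi0, -⟩ := mem_omitted.1 hi
    have hlen : ((positions (q + 1) i).map (digit n x)).length = q - 1 := by
      rw [List.length_map, length_positions (by simpa using hi1) hi0]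
    refine Finset.mem_image.2 ⟨(Γ.rowSize n x, fun j =>
      ((positions (q + 1) i).map (digit n x)).get (j.cast hlen.symm)), ?_, ?_⟩
    · rw [Finset.mem_product, Finset.mem_range, Fintype.mem_piFinset]
      refine ⟨Nat.lt_succ_of_le (hq _ (digit_lt hn x 0)), fun j => ?_⟩
      have := List.get_mem ((positions (q + 1) i).map (digit n x)) (j.cast hlen.symm)
      obtain ⟨l, hl, he⟩ := List.mem_map.1 this
      dsimp only
      rw [← he]
      obtain ⟨h1, h2, -⟩ := mem_positions.1 hl
      exact (hx.2 l h1 h2).2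
    · rw [coord_eq_horner]
      congr 1
      refine List.ext_get (by rw [List.length_ofFn, hlen]) ?_
      intro k h1 h2
      simp
  refine (Finset.card_le_card hsub).trans (Finset.card_image_le.trans ?_)
  simp

lemma card_rowClasses_le (hn : 0 < n) (hq : ∀ u < n, (Γ.twinClass n u).card ≤ q) (x : ℕ) :
    (Γ.rowClasses n (q + 1) x).card ≤ (q + 1) * q := by
  refine (Finset.card_biUnion_le_card_mul _ _ q fun i _ => hq _ (digit_lt hn x i)).trans ?_
  simp

/-- The factor in the bounds for the size of the reduced graph. -/
def sizeFactor (q : ℕ) : ℕ :=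
  (q + 1) ^ 2 + (2 * q) ^ 2 + (q + 1) * (2 * q) ^ (q - 1) * ((q + 1) * q) ^ 2

/-- The reduced graph has few pairs of vertices that are adjacent or equal. -/
lemma IsKeptFamily.card_le (h : Γ.IsKeptFamily n q 𝓕) (hn : 0 < n) (hq3 : 3 ≤ q) {Y : Finset ℕ}
    (hY : Γ.IsTwinCover (Y : Set ℕ)) {k : ℕ} (hk : Y.card ≤ k) :
    (𝓕.biUnion fun F => F ×ˢ F).card ≤ sizeFactor q * (k ^ (q - 1) + 1) := by
  have hle : ∀ a b c e : ℕ, e ≤ (b + c) * (a + 1) → e ≤ ((q + 1) ^ 2 + b + c) * (a + 1) :=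
    fun a b c e h => h.trans (Nat.mul_le_mul_right _ (by omega))
  cases h with
  | clique u F hF hc =>
    rw [Finset.singleton_biUnion, Finset.card_product, hc, sizeFactor]
    nlinarith [Nat.zero_le ((2 * q) ^ 2 + (q + 1) * (2 * q) ^ (q - 1) * ((q + 1) * q) ^ 2),
      Nat.zero_le (k ^ (q - 1)), Nat.zero_le (((q + 1) ^ 2 + ((2 * q) ^ 2 + (q + 1) *
        (2 * q) ^ (q - 1) * ((q + 1) * q) ^ 2)) * k ^ (q - 1))]
  | cover X M hq hX hM =>
    obtain ⟨P, hP, hMP⟩ := hM.card_le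
    have h1 : X.card ≤ 2 * q * k := by
      have := (hX.card_le Y hY).trans (Nat.mul_le_mul_right _ hk)
      rwa [mul_comm] at this
    have h2 : M.card ≤ (q + 1) * (2 * q) ^ (q - 1) * k ^ (q - 1) := by
      refine (hMP.trans (card_le_of_subset_coords hn hq hP)).trans ?_
      rw [mul_assoc, ← mul_pow]
      exact Nat.mul_le_mul_left _ (Nat.pow_le_pow_left h1 _)
    have h3 : k ^ 2 ≤ k ^ (q - 1) := by
      rcases Nat.eq_zero_or_pos k with rfl | hk0
      · simp
      · exact Nat.pow_le_pow_right hk0 (by omega)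
    have h4 : X.card * X.card ≤ (2 * q) ^ 2 * k ^ (q - 1) := by
      calc X.card * X.card ≤ (2 * q * k) * (2 * q * k) := Nat.mul_le_mul h1 h1
        _ = (2 * q) ^ 2 * k ^ 2 := by ring
        _ ≤ _ := Nat.mul_le_mul_left _ h3
    have h5 : ((M.image (Γ.rowClasses n (q + 1))).biUnion fun F => F ×ˢ F).card ≤
        (q + 1) * (2 * q) ^ (q - 1) * k ^ (q - 1) * ((q + 1) * q) ^ 2 := by
      refine (Finset.card_biUnion_le_card_mul _ _ (((q + 1) * q) ^ 2) ?_).trans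
        (Nat.mul_le_mul_right _ (Finset.card_image_le.trans h2))
      intro F hF
      obtain ⟨x, -, rfl⟩ := Finset.mem_image.1 hF
      rw [Finset.card_product, sq]
      exact Nat.mul_le_mul (card_rowClasses_le hn hq x) (card_rowClasses_le hn hq x)
    rw [Finset.biUnion_insert]
    refine (Finset.card_union_le _ _).trans (hle _ _ _ _ ?_)
    rw [Finset.card_product]
    refine (add_le_add h4 h5).trans ?_
    rw [mul_add_one, add_mul]
    refine le_trans (le_of_eq ?_) (Nat.le_add_right _ _)
    ring

end SimpleGraph

/-! ### Colorings of the reduced graph -/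

/-- If `c` colors an index set with as many elements as there are colors, then the number of
indices without which all colors but `a` still appear is one if all colors appear, and zero or two
otherwise. -/
lemma sum_omit {ι α : Type*} [DecidableEq ι] [DecidableEq α] [Fintype α] (I : Finset ι)
    (hI : I.card = Fintype.card α) (c : ι → α) (a : α) :
    ∑ i ∈ I, (if ∀ b ≠ a, b ∈ (I.erase i).image c then 1 else 0 : ZMod 2) =
      if I.image c = Finset.univ then 1 else 0 := by
  rw [← Finset.sum_filter, Finset.sum_const, nsmul_one]
  by_cases hs : I.image c = Finset.univ
  · have hinj : Set.InjOn c I := Finset.injOn_of_card_image_eq (by rw [hs, hI, Finset.card_univ])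
    obtain ⟨i, hi, rfl⟩ := Finset.mem_image.1 (hs ▸ Finset.mem_univ a : a ∈ I.image c)
    have : I.filter (fun j => ∀ b ≠ c i, b ∈ (I.erase j).image c) = {i} := by
      ext j
      simp only [Finset.mem_filter, Finset.mem_singleton]
      constructor
      · rintro ⟨hj, h⟩
        by_contra hji
        obtain ⟨l, hl, he⟩ := Finset.mem_image.1 (h (c j) fun h => hji (hinj hj hi h))
        rw [Finset.mem_erase] at hl
        exact hl.1 (hinj hl.2 hj he)
      · rintro rfl
        refine ⟨hi, fun b hb => ?_⟩
        obtain ⟨l, hl, rfl⟩ := Finset.mem_image.1 (hs ▸ Finset.mem_univ b : b ∈ I.image c)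
        exact Finset.mem_image_of_mem _ (Finset.mem_erase.2 ⟨fun h => hb (h ▸ rfl), hl⟩)
    rw [this, if_pos hs]
    simp
  · rw [if_neg hs]
    rcases (I.filter fun j => ∀ b ≠ a, b ∈ (I.erase j).image c).eq_empty_or_nonempty with h | h
    · rw [h]
      simp
    · obtain ⟨i, hi⟩ := h
      obtain ⟨hi, h⟩ := Finset.mem_filter.1 hi
      have ha : a ∉ I.image c := by
        intro ha
        refine hs (Finset.eq_univ_of_forall fun b => ?_)
        by_cases hb : b = a
        · exact hb ▸ ha
        · exact Finset.image_subset_image (Finset.erase_subset _ _) (h b hb)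
      have hinj : Set.InjOn c (I.erase i) := by
        refine Finset.injOn_of_card_image_eq (le_antisymm Finset.card_image_le ?_)
        rw [Finset.card_erase_of_mem hi, hI, ← Finset.card_univ,
          ← Finset.card_erase_of_mem (Finset.mem_univ a)]
        exact Finset.card_le_card fun b hb => h b (Finset.ne_of_mem_erase hb)
      obtain ⟨j, hj, hji⟩ := Finset.mem_image.1
        (h (c i) fun h => ha (h ▸ Finset.mem_image_of_mem c hi))
      have hj' := Finset.mem_erase.1 hj
      have : I.filter (fun j => ∀ b ≠ a, b ∈ (I.erase j).image c) = {i, j} := by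
        ext l
        simp only [Finset.mem_filter, Finset.mem_insert, Finset.mem_singleton]
        constructor
        · rintro ⟨hl, hl'⟩
          by_contra! hne
          obtain ⟨k, hk, he⟩ := Finset.mem_image.1
            (hl' (c l) fun h => ha (h ▸ Finset.mem_image_of_mem c hl))
          have hl2 : l ∈ I.erase i := Finset.mem_erase.2 ⟨hne.1, hl⟩
          rw [Finset.mem_erase] at hk
          by_cases hki : k = i
          · subst hki
            exact hne.2 (hinj hj hl2 (hji.trans he)).symm
          · exact hk.1 (hinj (Finset.mem_erase.2 ⟨hki, hk.2⟩) hl2 he)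
        · rintro (rfl | rfl)
          · exact ⟨hi, h⟩
          · refine ⟨hj'.2, fun b hb => ?_⟩
            obtain ⟨k, hk, rfl⟩ := Finset.mem_image.1 (h b hb)
            by_cases hkl : k = l
            · subst hkl
              exact Finset.mem_image.2 ⟨i, Finset.mem_erase.2 ⟨hj'.1.symm, hi⟩, hji.symm⟩
            · exact Finset.mem_image_of_mem c
                (Finset.mem_erase.2 ⟨hkl, (Finset.mem_erase.1 hk).2⟩)
      rw [this, Finset.card_pair hj'.1.symm]
      rfl

lemma exists_subset_image {ι α : Type*} [DecidableEq α] {J : Finset ι} {S : Finset α}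
    (h : S.card ≤ J.card) (hS : S.Nonempty) : ∃ f : ι → α, (∀ i, f i ∈ S) ∧ S ⊆ J.image f := by
  classical
  obtain ⟨J', hJ', hc⟩ := Finset.exists_subset_card_eq h
  let e := Finset.equivOfCardEq hc
  obtain ⟨a, ha⟩ := hS
  refine ⟨fun i => if hi : i ∈ J' then e ⟨i, hi⟩ else a, fun i => ?_, fun b hb => ?_⟩
  · dsimp only
    split_ifs
    exacts [(e _).2, ha]
  · refine Finset.mem_image.2 ⟨e.symm ⟨b, hb⟩, hJ' (e.symm _).2, ?_⟩
    simp

lemma exists_injOn_mem {ι α : Type*} [Nonempty α] {C : Finset ι} {U : Finset α}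
    (h : C.card ≤ U.card) : ∃ f : ι → α, Set.InjOn f C ∧ ∀ i ∈ C, f i ∈ U := by
  classical
  obtain ⟨U', hU', hc⟩ := Finset.exists_subset_card_eq h
  let e := Finset.equivOfCardEq hc.symm
  refine ⟨fun i => if hi : i ∈ C then e ⟨i, hi⟩ else Classical.arbitrary α, ?_, ?_⟩
  · intro i hi j hj hij
    rw [Finset.mem_coe] at hi hj
    simpa [hi, hj, Subtype.ext_iff] using hij
  · intro i hi
    simpa [hi] using hU' (e ⟨i, hi⟩).2

lemma exists_digit_eq {n : ℕ} (q : ℕ) (s : ℕ → ℕ) (hs : ∀ i < q, s i < n) :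
    ∃ x < n ^ q, ∀ i < q, digit n x i = s i := by
  induction q generalizing s with
  | zero => exact ⟨0, by simp, by simp⟩
  | succ q ih =>
    obtain ⟨x, hx, h⟩ := ih (fun i => s (i + 1)) fun i hi => hs _ (by omega)
    have h0 := hs 0 (by omega)
    refine ⟨s 0 + n * x, ?_, ?_⟩
    · calc s 0 + n * x < n + n * x := by omega
        _ = n * (x + 1) := by ring
        _ ≤ n * n ^ q := Nat.mul_le_mul_left _ hx
        _ = n ^ (q + 1) := by ring
    · rintro (_ | i) hi
      · simp [digit, Nat.mod_eq_of_lt h0]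
      · rw [← h i (by omega), digit, digit, pow_succ', ← Nat.div_div_eq_div_mul,
          Nat.add_mul_div_left _ _ (by omega), Nat.div_eq_of_lt h0, zero_add]

namespace SimpleGraph

variable {Γ : SimpleGraph ℕ} {n q : ℕ} {𝓕 : Finset (Finset ℕ)}

/-- The condition on the set of the colors of `q - 1` vertices by which the functional is defined
that detects the rows of vertices with `t` twins which cannot be colored. -/
def Detects (a : Fin q) (t : ℕ) (S : Finset (Fin q)) : Prop :=
  (t = 1 → ∀ b ≠ a, b ∈ S) ∧ (t ≠ 1 → q - t < S.card)

open Classical in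
/-- The functional that belongs to a coloring. A coordinate is a number whose digits in base `n` are
a class size `t` and `q - 1` vertices. -/
noncomputable def colorFunctional (χ : ℕ → Fin q) (n : ℕ) (a : Fin q) (z : ℕ) : ZMod 2 :=
  if ∃ t L, L.length = q - 1 ∧ (∀ d ∈ L, d < n) ∧ z = horner n t L ∧
    Detects a t (L.map χ).toFinset then 1 else 0

open Classical in
lemma colorFunctional_coord (χ : ℕ → Fin q) (a : Fin q) (hn : 0 < n) (t x : ℕ) {i : ℕ}
    (hi : i ∈ omitted (q + 1) t) :
    colorFunctional χ n a (coord n (q + 1) t (digit n x) i) =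
      if Detects a t (((omitted (q + 1) 1).erase i).image fun l => χ (digit n x l)) then 1
      else 0 := by
  obtain ⟨h1, h2, -⟩ := mem_omitted.1 hi
  have hS : (((positions (q + 1) i).map (digit n x)).map χ).toFinset =
      ((omitted (q + 1) 1).erase i).image fun l => χ (digit n x l) := by
    ext b
    simp only [List.mem_toFinset, List.mem_map, exists_exists_and_eq_and, mem_positions,
      Finset.mem_image, Finset.mem_erase, mem_omitted, true_or, and_true]
    exact exists_congr fun l => and_congr_left fun _ => by tauto
  rw [colorFunctional, ← hS, coord_eq_horner]
  have hlen : ((positions (q + 1) i).map (digit n x)).length = q - 1 := by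
    rw [List.length_map, length_positions (by simpa using h1) h2]
  have hlt : ∀ d ∈ (positions (q + 1) i).map (digit n x), d < n := by
    intro d hd
    obtain ⟨l, -, rfl⟩ := List.mem_map.1 hd
    exact digit_lt hn x l
  congr 1
  refine propext ⟨?_, fun h => ⟨_, _, hlen, hlt, rfl, h⟩⟩
  rintro ⟨t', L, h3, h4, h5, h6⟩
  obtain ⟨rfl, rfl⟩ := horner_inj (hlen.trans h3.symm) hlt h4 h5
  exact h6

lemma card_omitted_one (q : ℕ) : (omitted (q + 1) 1).card = q := by
  have : omitted (q + 1) 1 = (Finset.range (q + 1)).erase 0 := by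
    ext i
    simp [mem_omitted, and_comm]
  rw [this, Finset.card_erase_of_mem (by simp)]
  simp

/-- The functional of a coloring is nonzero at the vector of a row if and only if the colors of the
neighbors in the row leave too few colors for the twin class of the row. -/
lemma rowVal_colorFunctional (χ : ℕ → Fin q) (a : Fin q) (hn : 0 < n) (x : ℕ) :
    (Γ.rowSize n x = 1 → (Γ.rowVal n (q + 1) (colorFunctional χ n a) x ≠ 0 ↔
      (omitted (q + 1) 1).image (fun l => χ (digit n x l)) = Finset.univ)) ∧
    (Γ.rowSize n x ≠ 1 → (Γ.rowVal n (q + 1) (colorFunctional χ n a) x ≠ 0 ↔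
      q - Γ.rowSize n x <
        (((omitted (q + 1) 1).erase 1).image fun l => χ (digit n x l)).card)) := by
  classical
  have hq : 0 < q := a.pos
  rw [rowVal, Finset.sum_congr rfl fun i hi => colorFunctional_coord χ a hn _ x hi]
  constructor
  · intro ht
    have := sum_omit (omitted (q + 1) 1) (by simp [card_omitted_one]) (fun l => χ (digit n x l)) a
    rw [ht, (Finset.sum_congr rfl fun i _ => by simp only [Detects]; split_ifs <;> simp_all).trans
      this]
    split_ifs with h <;> simp [h]
  · intro ht
    have : omitted (q + 1) (Γ.rowSize n x) = {1} := by
      ext i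
      simp only [mem_omitted, ht, false_or, Finset.mem_singleton]
      omega
    rw [this, Finset.sum_singleton]
    simp [Detects, ht]

/-- Cliques of twins can be colored if each of them has as many free colors as vertices. -/
lemma IsApproxCover.colorable {X : Finset ℕ} {q' : ℕ} (hX : Γ.IsApproxCover n q' X)
    (hb : Γ.BoundedBy n) (hq : 0 < q) (χ : ℕ → Fin q)
    (hχ : ∀ u ∈ X, ∀ v ∈ X, Γ.Adj u v → χ u ≠ χ v)
    (h : ∀ u < n, u ∉ X → ∀ U : Finset (Fin q), (∀ c, c ∈ U ↔ ∃ v ∈ X, Γ.Adj u v ∧ χ v = c) →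
      U.card + (Γ.twinClass n u).card ≤ q) : Γ.Colorable q := by
  classical
  have : NeZero q := ⟨hq.ne'⟩
  have hg : ∀ (C : Finset ℕ) (U : Finset (Fin q)), ∃ f : ℕ → Fin q, C.card ≤ U.card →
      Set.InjOn f C ∧ ∀ i ∈ C, f i ∈ U := by
    intro C U
    by_cases hCU : C.card ≤ U.card
    · obtain ⟨f, hf⟩ := exists_injOn_mem hCU
      exact ⟨f, fun _ => hf⟩
    · exact ⟨χ, fun h => absurd h hCU⟩
  choose g hg using hg
  let free (u : ℕ) : Finset (Fin q) := Finset.univ.filter fun c => ¬ ∃ v ∈ X, Γ.Adj u v ∧ χ v = c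
  have hfree : ∀ u < n, u ∉ X → (Γ.twinClass n u).card ≤ (free u).card := by
    intro u hu huX
    have h1 := h u hu huX (Finset.univ.filter fun c => ∃ v ∈ X, Γ.Adj u v ∧ χ v = c) (by simp)
    have h2 := Finset.card_filter_add_card_filter_not (s := (Finset.univ : Finset (Fin q)))
      (fun c => ∃ v ∈ X, Γ.Adj u v ∧ χ v = c)
    simp only [Finset.card_univ, Fintype.card_fin] at h2
    change _ + (free u).card = q at h2
    omega
  have hself : ∀ u < n, u ∈ Γ.twinClass n u := fun u hu => mem_twinClass.2 ⟨hu, .refl u⟩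
  let χ' (u : ℕ) : Fin q := if u ∈ X then χ u else g (Γ.twinClass n u) (free u) u
  have hmix : ∀ u v, u ∈ X → v ∉ X → Γ.Adj u v → χ' u ≠ χ' v := by
    intro u v hu hv huv he
    have hvn := hb huv.symm
    simp only [χ', hu, hv, if_true, if_false] at he
    have := (hg _ _ (hfree v hvn hv)).2 v (hself v hvn)
    rw [← he] at this
    exact (Finset.mem_filter.1 this).2 ⟨u, hu, huv.symm, rfl⟩
  refine ⟨Coloring.mk χ' fun {u v} huv => ?_⟩
  by_cases hu : u ∈ X
  · by_cases hv : v ∈ X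
    · simpa [χ', hu, hv] using hχ u hu v hv huv
    · exact hmix u v hu hv huv
  · by_cases hv : v ∈ X
    · exact (hmix v u hv hu huv.symm).symm
    · have htw : Γ.AreTwins u v := by
        rcases hX.cover huv with h | h | h
        exacts [absurd h hu, absurd h hv, h]
      have hfr : free u = free v := by
        have : ∀ x ∈ X, (Γ.Adj u x ↔ Γ.Adj v x) := fun x hx =>
          ⟨fun h => htw.adj_of_adj h fun h => hv (h ▸ hx),
            fun h => htw.symm.adj_of_adj h fun h => hu (h ▸ hx)⟩
        ext c
        simp only [free, Finset.mem_filter, Finset.mem_univ, true_and]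
        refine not_congr (exists_congr fun x => and_congr_right fun hx => ?_)
        rw [this x hx]
      simp only [χ', hu, hv, if_false]
      rw [← hfr, ← htw.twinClass_eq n]
      intro he
      exact huv.ne ((hg _ _ (hfree u (hb huv) hu)).1 (hself u (hb huv))
        (mem_twinClass.2 ⟨hb huv.symm, htw⟩) he)

/-- A coloring of the reduced graph leaves enough colors for the vertices of the marked rows, so
that its functional vanishes at their vectors. -/
lemma rowVal_eq_zero {X : Finset ℕ} {x : ℕ} (hX : Γ.IsApproxCover n q X) (hn : 0 < n)
    (hx : Γ.ValidRow X n (q + 1) x) (hF : Γ.rowClasses n (q + 1) x ∈ 𝓕)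
    (χ : (Γ.keptGraph 𝓕).Coloring (Fin q)) (a : Fin q) :
    Γ.rowVal n (q + 1) (colorFunctional χ n a) x = 0 := by
  classical
  set u := digit n x 0 with hu
  have hmem : ∀ {i v}, i < q + 1 → Γ.AreTwins (digit n x i) v → v < n →
      v ∈ Γ.rowClasses n (q + 1) x := fun hi h hv => mem_rowClasses.2 ⟨hv, _, hi, h⟩
  have h1 : (Finset.image χ (Γ.twinClass n u)).card = Γ.rowSize n x := by
    refine Finset.card_image_of_injOn fun v hv w hw h => ?_
    obtain ⟨hv1, hv2⟩ := mem_twinClass.1 hv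
    obtain ⟨hw1, hw2⟩ := mem_twinClass.1 hw
    by_contra hne
    exact χ.valid ⟨(hv2.symm.trans hw2).adj hne, _, hF, hmem (by omega) hv2 hv1,
      hmem (by omega) hw2 hw1⟩ h
  have h2 : Disjoint (Finset.image χ (Γ.twinClass n u))
      ((omitted (q + 1) 1).image fun l => χ (digit n x l)) := by
    rw [Finset.disjoint_left]
    intro c hc hc'
    obtain ⟨v, hv, rfl⟩ := Finset.mem_image.1 hc
    obtain ⟨l, hl, he⟩ := Finset.mem_image.1 hc'
    obtain ⟨hv1, hv2⟩ := mem_twinClass.1 hv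
    obtain ⟨hl1, hl2, -⟩ := mem_omitted.1 hl
    obtain ⟨h3, h4⟩ := hx.2 l hl1 hl2
    refine χ.valid ⟨hv2.adj_of_adj h3 ?_, _, hF, hmem (by omega) hv2 hv1,
      hmem hl1 (.refl _) (digit_lt hn x l)⟩ he.symm
    rintro rfl
    exact hx.1 (hX.closed _ h4 _ hv2.symm)
  have h3 : Γ.rowSize n x + ((omitted (q + 1) 1).image fun l => χ (digit n x l)).card ≤ q := by
    rw [← h1, ← Finset.card_union_of_disjoint h2]
    exact (Finset.card_le_univ _).trans (by simp)
  by_contra hne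
  by_cases ht : Γ.rowSize n x = 1
  · have := ((rowVal_colorFunctional χ a hn x).1 ht).1 hne
    rw [this, Finset.card_univ, Fintype.card_fin] at h3
    omega
  · have h4 := ((rowVal_colorFunctional χ a hn x).2 ht).1 hne
    have := Finset.card_le_card (Finset.image_subset_image (f := fun l => χ (digit n x l))
      (Finset.erase_subset 1 (omitted (q + 1) 1)))
    omega

/-- The reduced graph has the same colorings with `q` colors. -/
lemma IsKeptFamily.colorable (h : Γ.IsKeptFamily n q 𝓕) (hb : Γ.BoundedBy n) (hn : 0 < n)
    (hq : 2 ≤ q) (hc : (Γ.keptGraph 𝓕).Colorable q) : Γ.Colorable q := by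
  classical
  obtain ⟨χ⟩ := hc
  cases h with
  | clique u F hF hFc =>
    exfalso
    have := Finset.card_le_univ (F.image χ)
    rw [Finset.card_image_of_injOn, hFc, Fintype.card_fin] at this
    · omega
    · intro v hv w hw h
      by_contra hne
      exact χ.valid ⟨((mem_twinClass.1 (hF hv)).2.symm.trans (mem_twinClass.1 (hF hw)).2).adj hne,
        F, by simp, hv, hw⟩ h
  | cover X M hsz hX hM =>
    refine hX.colorable hb (by omega) χ
      (fun u hu v hv huv => χ.valid ⟨huv, X, by simp, hu, hv⟩) fun u hu huX U hU => ?_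
    by_contra! hlt
    set t := (Γ.twinClass n u).card with ht
    have ht1 : 1 ≤ t := Finset.card_pos.2 ⟨u, mem_twinClass.2 ⟨hu, .refl u⟩⟩
    have htq : t ≤ q := hsz u hu
    let a : Fin q := ⟨0, by omega⟩
    have hzero := hM.row_zero (colorFunctional χ n a) fun x hx => rowVal_eq_zero hX hn
      (hM.valid x hx) (Finset.mem_insert_of_mem (Finset.mem_image_of_mem _ hx)) χ a
    -- A row of `u` whose neighbors have too many colors contradicts the vanishing. If `t ≥ 2`, then
    -- `q - t + 1` colors are too many, and these fit into the positions other than `1`.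
    let J : Finset ℕ := if t = 1 then omitted (q + 1) 1 else (omitted (q + 1) 1).erase 1
    have hJ : q - t + 1 ≤ J.card := by
      by_cases h1 : t = 1
      · simp only [J, h1, if_true, card_omitted_one]
        omega
      · simp only [J, h1, if_false]
        rw [Finset.card_erase_of_mem (mem_omitted.2 (by omega)), card_omitted_one]
        omega
    obtain ⟨S, hSU, hS⟩ := Finset.exists_subset_card_eq (s := U) (n := q - t + 1) (by omega)
    obtain ⟨f, hf1, hf2⟩ := exists_subset_image (hS ▸ hJ) (Finset.card_pos.1 (by omega))
    choose! pick hpick using fun c => (hU c).1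
    let s (l : ℕ) : ℕ := if l = 0 then u else pick (f l)
    have hs0 : s 0 = u := rfl
    have hs : ∀ l, l ≠ 0 → s l ∈ X ∧ Γ.Adj u (s l) ∧ χ (s l) = f l := by
      intro l hl
      simp only [s, hl, if_false]
      exact hpick (f l) (hSU (hf1 l))
    obtain ⟨x, hx, hdig⟩ := exists_digit_eq (n := n) (q + 1) s fun i _ => by
      by_cases hi : i = 0
      · exact hi ▸ hu
      · exact hX.lt _ (hs i hi).1
    have hd0 : digit n x 0 = u := hdig 0 (by omega)
    have hrs : Γ.rowSize n x = t := by rw [rowSize, hd0]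
    have hval : Γ.ValidRow X n (q + 1) x := by
      refine ⟨hd0 ▸ huX, fun i hi hi0 => ?_⟩
      rw [hd0, hdig i hi]
      exact ⟨(hs i hi0).2.1, (hs i hi0).1⟩
    have himg : J.image (fun l => χ (digit n x l)) = J.image f := by
      refine Finset.image_congr fun l hl => ?_
      have : l ∈ omitted (q + 1) 1 := by
        simp only [J] at hl
        split_ifs at hl
        exacts [hl, Finset.mem_of_mem_erase hl]
      obtain ⟨h1, h2, -⟩ := mem_omitted.1 this
      rw [hdig l h1, (hs l h2).2.2]
    have hcard : q - t < (J.image fun l => χ (digit n x l)).card := by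
      rw [himg]
      have := Finset.card_le_card hf2
      omega
    refine absurd (hzero x hx hval) ?_
    by_cases h1 : t = 1
    · simp only [J, h1, if_true] at hcard
      refine ((rowVal_colorFunctional χ a hn x).1 (hrs.trans h1)).2
        ((Finset.card_eq_iff_eq_univ _).1 (le_antisymm (Finset.card_le_univ _) ?_))
      rw [Fintype.card_fin]
      omega
    · simp only [J, h1, if_false] at hcard
      rw [← hrs] at h1 hcard
      exact ((rowVal_colorFunctional χ a hn x).2 h1).2 hcard

end SimpleGraph

/-! ### The reduced graph -/

namespace SimpleGraph

variable {Γ : SimpleGraph ℕ} {n q k : ℕ} {𝓕 : Finset (Finset ℕ)}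

/-- The graph `G'` is isomorphic to the union of the subgraphs of `Γ` induced by the sets in `𝓕`,
by a map whose range consists of the members of these sets. -/
structure IsReduced (Γ : SimpleGraph ℕ) (𝓕 : Finset (Finset ℕ)) (G' : FinGraph)
    (f : Fin G'.1 ↪ ℕ) : Prop where
  mem_range : ∀ v, (∃ i, f i = v) ↔ ∃ F ∈ 𝓕, v ∈ F
  adj : ∀ i j, G'.2.Adj i j ↔ (Γ.keptGraph 𝓕).Adj (f i) (f j)

variable {G G' : FinGraph} {f : Fin G'.1 ↪ ℕ}

lemma IsReduced.eq_comap (h : Γ.IsReduced 𝓕 G' f) : G'.2 = (Γ.keptGraph 𝓕).comap f := by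
  ext i j
  exact h.adj i j

lemma IsReduced.colorable_keptGraph (h : Γ.IsReduced 𝓕 G' f) (hq : 0 < q) (hc : G'.2.Colorable q) :
    (Γ.keptGraph 𝓕).Colorable q := by
  obtain ⟨χ⟩ := hc
  refine ⟨Coloring.mk (Function.extend f χ fun _ => ⟨0, hq⟩) fun {u v} huv => ?_⟩
  obtain ⟨-, F, hF, hu, hv⟩ := id huv
  obtain ⟨i, rfl⟩ := (h.mem_range u).2 ⟨F, hF, hu⟩
  obtain ⟨j, rfl⟩ := (h.mem_range v).2 ⟨F, hF, hv⟩
  rw [f.injective.extend_apply, f.injective.extend_apply]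
  exact χ.valid ((h.adj i j).2 huv)

lemma _root_.FinGraph.onNat_boundedBy (G : FinGraph) : G.onNat.BoundedBy G.1 :=
  fun _ _ h => (FinGraph.onNat_adj_lt h).1

lemma _root_.FinGraph.isTwinCover_onNat {Y : Finset (Fin G.1)}
    (hY : G.2.IsTwinCover (Y : Set (Fin G.1))) :
    G.onNat.IsTwinCover ((Y.map Fin.valEmbedding : Finset ℕ) : Set ℕ) := by
  intro u v huv
  obtain ⟨hu, hv⟩ := FinGraph.onNat_adj_lt huv
  lift u to Fin G.1 using hu
  lift v to Fin G.1 using hv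
  rcases hY ((G.onNat_adj_coe u v).1 huv) with h | h | h
  · exact .inl (Finset.mem_coe.2 (Finset.mem_map_of_mem _ h))
  · exact .inr (.inl (Finset.mem_coe.2 (Finset.mem_map_of_mem _ h)))
  · refine .inr (.inr (areTwins_iff.2 fun w => ?_))
    by_cases hw : w < G.1
    · lift w to Fin G.1 using hw
      simpa only [G.onNat_adj_coe, Fin.val_inj] using areTwins_iff.1 h w
    · have h1 : ∀ x : Fin G.1, ¬ ((x : ℕ) = w ∨ G.onNat.Adj x w) := by
        rintro x (rfl | h)
        exacts [hw x.2, hw (FinGraph.onNat_adj_lt h).2]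
      simp only [h1]

lemma IsReduced.lt (h : G.onNat.IsReduced 𝓕 G' f) (h𝓕 : G.onNat.IsKeptFamily n q 𝓕) (hq : 1 ≤ q)
    (i : Fin G'.1) : f i < G.1 := by
  obtain ⟨F, hF, hi⟩ := (h.mem_range _).1 ⟨i, rfl⟩
  obtain ⟨v, hv⟩ := h𝓕.exists_adj hq F hF _ hi
  exact (FinGraph.onNat_adj_lt hv).1

lemma IsReduced.isContained (h : G.onNat.IsReduced 𝓕 G' f) (h𝓕 : G.onNat.IsKeptFamily n q 𝓕)
    (hq : 1 ≤ q) : G'.2.IsContained G.2 := by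
  refine ⟨⟨⟨fun i => ⟨f i, h.lt h𝓕 hq i⟩, fun {i j} hij => ?_⟩, fun i j hij => ?_⟩⟩
  · exact (G.onNat_adj_coe _ _).1 ((h.adj i j).1 hij).1
  · exact f.injective (congrArg Fin.val hij)

lemma IsReduced.colorable_iff (h : G.onNat.IsReduced 𝓕 G' f) (h𝓕 : G.onNat.IsKeptFamily n q 𝓕)
    (hn : G.1 < n) (hq : 2 ≤ q) : G'.2.Colorable q ↔ G.2.Colorable q := by
  constructor
  · intro hc
    have := h𝓕.colorable (fun u v huv => (G.onNat_boundedBy huv).trans hn) (by omega) hq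
      (h.colorable_keptGraph (by omega) hc)
    exact this.of_hom ⟨Fin.val, fun {i j} => (G.onNat_adj_coe i j).2⟩
  · obtain ⟨c⟩ := h.isContained h𝓕 (by omega)
    exact fun hc => hc.of_hom c.toHom

lemma IsReduced.validTwinCover (h : G.onNat.IsReduced 𝓕 G' f) (h𝓕 : G.onNat.IsKeptFamily n q 𝓕)
    (hn : G.1 < n) (hk : (coloringByTwinCover q).Valid G k) :
    (coloringByTwinCover q).Valid G' k := by
  obtain ⟨Y, hY, hYk⟩ := hk
  have := (h𝓕.isTwinCover (fun u v huv => (G.onNat_boundedBy huv).trans hn)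
    (FinGraph.isTwinCover_onNat hY)).comap f
  refine ⟨(Y.map Fin.valEmbedding).preimage f f.injective.injOn, ?_, ?_⟩
  · rw [h.eq_comap, Finset.coe_preimage]
    exact this
  · refine le_trans ?_ ((Finset.card_map (s := Y) Fin.valEmbedding).trans_le hYk)
    exact Finset.card_le_card_of_injOn f (fun i hi => by simpa using hi) f.injective.injOn

lemma IsReduced.validVertexCover (h : G.onNat.IsReduced 𝓕 G' f) (h𝓕 : G.onNat.IsKeptFamily n q 𝓕)
    (hq : 1 ≤ q) (hk : (coloringByVertexCover q).Valid G k) :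
    (coloringByVertexCover q).Valid G' k := by
  obtain ⟨Y, hY, hYk⟩ := hk
  obtain ⟨c⟩ := h.isContained h𝓕 hq
  refine ⟨Y.preimage c c.injective.injOn, fun i j hij => ?_, ?_⟩
  · simpa using hY (c.toHom.map_rel hij)
  · exact (Finset.card_le_card_of_injOn c (fun i hi => by simpa using hi)
      c.injective.injOn).trans hYk

end SimpleGraph

lemma validTwinCover_of_validVertexCover {q k : ℕ} {G : FinGraph}
    (h : (coloringByVertexCover q).Valid G k) : (coloringByTwinCover q).Valid G k := by
  obtain ⟨Y, hY, hYk⟩ := h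
  exact ⟨Y, fun u v huv => (hY huv).imp_right .inl, hYk⟩

/-! ### The length of the code -/

lemma length_encodeNumber (n : ℕ) : (encodeNumber n).length = 2 * n.size + 1 := by
  simp [encodeNumber, List.length_flatMap, Nat.size_eq_bits_len, mul_comm]

open Classical in
/-- Each pair of equal or adjacent vertices contributes at most one number to the code, and one more
number is the number of vertices. -/
lemma length_encodeGraph_le (G : FinGraph) : (encodeGraph G).length ≤ (2 * G.1.size + 1) *
    (1 + ((Finset.univ : Finset (Fin G.1 × Fin G.1)).filter
      fun p => p.1 = p.2 ∨ G.2.Adj p.1 p.2).card) := by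
  have hadj : ((Finset.univ : Finset (Fin G.1 × Fin G.1)).filter
      fun p => p.1 = p.2 ∨ G.2.Adj p.1 p.2).card =
      ((List.finRange G.1).map fun v =>
        ((List.finRange G.1).filter fun w => G.2.Adj v w).length + 1).sum := by
    rw [← Fin.sum_univ_def, Finset.card_filter, Fintype.sum_prod_type]
    refine Finset.sum_congr rfl fun v _ => ?_
    have h1 : (Finset.univ.filter fun w => G.2.Adj v w).card =
      ((List.finRange G.1).filter fun w => G.2.Adj v w).length := rfl
    rw [← Finset.card_filter, ← h1, ← Finset.card_insert_of_notMem (a := v) (by simp)]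
    congr 1
    ext w
    simp [eq_comm]
  have hrow : ∀ v : Fin G.1, ((((List.finRange G.1).filter fun w => G.2.Adj v w).flatMap
      (fun w : Fin G.1 => encodeNumber ((w : ℕ) + 1))) ++ encodeNumber 0).length ≤
      (2 * G.1.size + 1) * (((List.finRange G.1).filter fun w => G.2.Adj v w).length + 1) := by
    intro v
    rw [List.length_append, List.length_flatMap]
    have h1 := List.sum_le_card_nsmul (((List.finRange G.1).filter fun w => G.2.Adj v w).map
      fun w : Fin G.1 => (encodeNumber ((w : ℕ) + 1)).length) (2 * G.1.size + 1) (by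
        intro x hx
        obtain ⟨w, -, rfl⟩ := List.mem_map.1 hx
        rw [length_encodeNumber]
        have := Nat.size_le_size (show (w : ℕ) + 1 ≤ G.1 from w.2)
        omega)
    rw [List.length_map, smul_eq_mul, mul_comm] at h1
    have h2 : (encodeNumber 0).length = 1 := by simp [encodeNumber]
    rw [h2, mul_add_one]
    omega
  rw [encodeGraph, List.length_append, List.length_flatMap, length_encodeNumber, hadj, mul_add,
    mul_one, ← smul_eq_mul (2 * G.1.size + 1), List.smul_sum, List.map_map]
  exact Nat.add_le_add_left (List.sum_le_sum fun v _ => hrow v) _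

open Classical in
lemma SimpleGraph.IsReduced.card_pairs_le {Γ : SimpleGraph ℕ} {𝓕 : Finset (Finset ℕ)}
    {G' : FinGraph} {f : Fin G'.1 ↪ ℕ} (h : Γ.IsReduced 𝓕 G' f) :
    ((Finset.univ : Finset (Fin G'.1 × Fin G'.1)).filter
      fun p => p.1 = p.2 ∨ G'.2.Adj p.1 p.2).card ≤ (𝓕.biUnion fun F => F ×ˢ F).card := by
  refine Finset.card_le_card_of_injOn (fun p => (f p.1, f p.2)) ?_ ?_
  · rintro ⟨i, j⟩ hij
    simp only [Finset.coe_biUnion, Set.mem_iUnion, Finset.mem_coe, Finset.mem_product, exists_prop]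
    rcases (Finset.mem_filter.1 hij).2 with he | ha
    · obtain ⟨F, hF, hi⟩ := (h.mem_range _).1 ⟨i, rfl⟩
      exact ⟨F, hF, hi, by rwa [← show i = j from he]⟩
    · obtain ⟨-, F, hF, hi, hj⟩ := (h.adj i j).1 ha
      exact ⟨F, hF, hi, hj⟩
  · rintro ⟨i, j⟩ - ⟨i', j'⟩ - he
    simpa using he

lemma card_le_card_pairs (G : FinGraph) [DecidablePred fun p : Fin G.1 × Fin G.1 =>
    p.1 = p.2 ∨ G.2.Adj p.1 p.2] : G.1 ≤ ((Finset.univ : Finset (Fin G.1 × Fin G.1)).filter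
      fun p => p.1 = p.2 ∨ G.2.Adj p.1 p.2).card := by
  refine (Finset.card_fin G.1).symm.trans_le (Finset.card_le_card_of_injOn (fun i => (i, i))
    (by simp) fun i _ j _ h => (Prod.ext_iff.1 h).1)

open SimpleGraph in
/-- The constant in the size of the kernel. -/
def kernelConst (q : ℕ) : ℕ :=
  (2 * (2 * sizeFactor q + 2 * (q - 1)) + 1) * (1 + 2 * sizeFactor q) + sizeFactor q + 1

/-- The arithmetic of the size bound: a number of vertices bounded by `A (k ^ d + 1)` has
`O(log k)` binary digits. -/
lemma code_bound (A d k n L P : ℕ) (hn : n ≤ P) (hP : P ≤ A * (k ^ d + 1))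
    (hL : L ≤ (2 * n.size + 1) * (1 + P)) :
    L ≤ ((2 * (2 * A + 2 * d) + 1) * (1 + 2 * A) + A + 1) * (k ^ d * Nat.log 2 k + 1) := by
  rcases Nat.lt_or_ge k 2 with hk | hk
  · have h1 : k ^ d ≤ 1 := pow_le_one₀ (Nat.zero_le _) (by omega)
    have hP' : P ≤ 2 * A := hP.trans (by nlinarith)
    have hsize : n.size ≤ 2 * A :=
      Nat.size_le.2 ((hn.trans hP').trans_lt Nat.lt_two_pow_self)
    calc L ≤ (2 * n.size + 1) * (1 + P) := hL
      _ ≤ (2 * (2 * A + 2 * d) + 1) * (1 + 2 * A) := Nat.mul_le_mul (by omega) (by omega)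
      _ ≤ (2 * (2 * A + 2 * d) + 1) * (1 + 2 * A) + A + 1 := by omega
      _ ≤ _ := Nat.le_mul_of_pos_right _ (Nat.succ_pos _)
  · set l := Nat.log 2 k with hl
    have hl1 : 1 ≤ l := Nat.log_pos (by norm_num) hk
    have hkl : k < 2 ^ (l + 1) := Nat.lt_pow_succ_log_self (by norm_num) k
    have hk0 : 1 ≤ k ^ d := Nat.one_le_pow _ _ (by omega)
    have hP' : P ≤ 2 * A * k ^ d := hP.trans (by nlinarith)
    have hsize : n.size ≤ (2 * A + 2 * d) * l := by
      rw [Nat.size_le]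
      calc n ≤ 2 * A * k ^ d := hn.trans hP'
        _ < 2 ^ (2 * A) * (2 ^ (2 * l)) ^ d := by
          refine Nat.mul_lt_mul_of_lt_of_le Nat.lt_two_pow_self (Nat.pow_le_pow_left ?_ _)
            (by positivity)
          exact hkl.le.trans (Nat.pow_le_pow_right (by norm_num) (by omega))
        _ = 2 ^ (2 * A + 2 * l * d) := by rw [← pow_mul, pow_add]
        _ ≤ 2 ^ ((2 * A + 2 * d) * l) := Nat.pow_le_pow_right (by norm_num) (by nlinarith)
    calc L ≤ (2 * n.size + 1) * (1 + P) := hL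
      _ ≤ ((2 * (2 * A + 2 * d) + 1) * l) * ((1 + 2 * A) * k ^ d) :=
          Nat.mul_le_mul (by nlinarith) (by nlinarith)
      _ = (2 * (2 * A + 2 * d) + 1) * (1 + 2 * A) * (k ^ d * l) := by ring
      _ ≤ _ := Nat.mul_le_mul (by omega) (by omega)

lemma le_kernel_size {C d k : ℕ} (hC : 1 ≤ C) (hd : 1 ≤ d) : k ≤ C * (k ^ d * Nat.log 2 k + 1) := by
  rcases Nat.lt_or_ge k 2 with hk | hk
  · exact (by omega : k ≤ 1 * 1).trans (Nat.mul_le_mul hC (by omega))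
  · have h1 : 1 ≤ Nat.log 2 k := Nat.log_pos (by norm_num) hk
    calc k = k ^ 1 := (pow_one k).symm
      _ ≤ k ^ d := Nat.pow_le_pow_right (by omega) hd
      _ ≤ k ^ d * Nat.log 2 k := Nat.le_mul_of_pos_right _ h1
      _ ≤ 1 * (k ^ d * Nat.log 2 k + 1) := by omega
      _ ≤ _ := Nat.mul_le_mul_right _ hC

/-! ### Correctness of the program -/

namespace LoopLang

open Cmd Reg Arr

/-- The memory before the main part of the program is run. -/
def initMem (w : List Bool) (q : ℕ) : Mem := powers.sem ((Mem.start w).set Q (q + 1))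

lemma initMem_var {w : List Bool} {q : ℕ} {r : Reg} (h : powers.writes r = false) (hQ : r ≠ Q)
    (hN : r ≠ N) : (initMem w q).var r = 0 := by
  rw [initMem, sem_var _ h, Mem.set_var_ne _ _ hQ, Mem.start]
  simp [hN]

lemma initMem_arr (w : List Bool) (q : ℕ) (a : Arr) :
    (initMem w q).arr a = (Mem.start w).arr a := by
  rw [initMem, sem_arr _ (by cases a <;> rfl)]
  rfl

lemma initMem_arr_eq_zero {w : List Bool} {q : ℕ} {a : Arr} (h : a ≠ INP) (k : ℕ) :
    (initMem w q).arr a k = 0 := by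
  rw [initMem_arr, Mem.start]
  simp [h]

lemma initMem_N (w : List Bool) (q : ℕ) : (initMem w q).var N = w.length := by
  rw [initMem, sem_var _ rfl, Mem.set_var_ne _ _ (by decide)]
  rfl

lemma initMem_Q (w : List Bool) (q : ℕ) : (initMem w q).var Q = q + 1 := by
  rw [initMem, sem_var _ rfl, Mem.set_var_self]

lemma initMem_R (w : List Bool) (q : ℕ) : (initMem w q).var R = w.length ^ (q + 1) := by
  rw [initMem, powers_R, Mem.set_var_self, Mem.set_var_ne _ _ (by decide)]
  rfl

/-- The main part of the program selects the reduced graph. -/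
lemma main_spec (G : FinGraph) {q n : ℕ} (hq : 1 ≤ q) (hn : n = (encodeGraph G).length) {m : Mem}
    (hm : m = main.sem (initMem (encodeGraph G) q)) : ∃ 𝓕, G.onNat.IsKeptFamily n q 𝓕 ∧
      Keeps G.onNat n 𝓕 m ∧ Listed n (m.arr KE) (m.var NV) (m.arr KEPT) ∧
      (∀ v < n, m.arr MUL v = v * n) ∧ m.var N = n ∧ m.out = [] := by
  have hn0 : 0 < n := hn ▸ (Nat.zero_le _).trans_lt (lt_length_encodeGraph G)
  have hle : n ≤ n ^ (q + 1) := Nat.le_self_pow (by omega) n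
  have hout : m.out = [] := by rw [hm, sem_out _ rfl, initMem, sem_out _ rfl]; rfl
  set m₀ := initMem (encodeGraph G) q with hm₀
  have hN₀ : m₀.var N = n := hn ▸ initMem_N _ _
  have hQ₀ : m₀.var Q = q + 1 := initMem_Q _ _
  have hR₀ : m₀.var R = n ^ (q + 1) := hn ▸ initMem_R _ _
  have hv₀ : ∀ r, powers.writes r = false → r ≠ Q → r ≠ N → m₀.var r = 0 :=
    fun r => initMem_var
  have ha₀ : ∀ a, a ≠ INP → ∀ k, m₀.arr a k = 0 := fun a => initMem_arr_eq_zero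
  have hI₀ : ∀ j, m₀.arr INP j = ((encodeGraph G).getD j false).toNat := fun j => by
    rw [hm₀, initMem_arr]; rfl
  clear_value m₀
  simp only [main, sem_block_cons, sem_block_nil] at hm
  have hT₁ := tables_spec m₀ (hN₀ ▸ hn0) (hv₀ _ rfl (by decide) (by decide))
    (hv₀ _ rfl (by decide) (by decide)) (hv₀ _ rfl (by decide) (by decide))
  have hA₁ := agree_sem tables m₀
  generalize tables.sem m₀ = m₁ at *
  have hN₁ : m₁.var N = n := (hA₁.var rfl).trans hN₀
  have hQ₁ : m₁.var Q = q + 1 := (hA₁.var rfl).trans hQ₀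
  have hR₁ : m₁.var R = n ^ (q + 1) := (hA₁.var rfl).trans hR₀
  rw [hN₀, hR₀] at hT₁
  have hP₂ := parse_spec G m₁ (by
      have h1 : ∀ r, tables.writes r = false → powers.writes r = false → r ≠ Q → r ≠ N →
        m₁.var r = 0 := fun r h1 h2 h3 h4 => (hA₁.var h1).trans (hv₀ r h2 h3 h4)
      have h2 : m₁.arr CN = fun _ => 0 := (hA₁.arr rfl).trans (funext (ha₀ CN (by decide)))
      rw [Mem.reader, h1 PH rfl rfl (by decide) (by decide), h1 VAL rfl rfl (by decide) (by decide),
        h1 PW rfl rfl (by decide) (by decide), h1 HD rfl rfl (by decide) (by decide),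
        h1 VT rfl rfl (by decide) (by decide), h2])
    (hN₁.trans hn) (fun j => by rw [hA₁.arr rfl]; exact hI₀ j) (by rw [hN₁, hR₁]; exact hT₁)
    (by rw [hN₁, hR₁]; exact hle)
  have hA₂ := agree_sem parse m₁
  generalize parse.sem m₁ = m₂ at *
  rw [hN₁] at hP₂
  have h₂ : GraphData G.onNat n (q + 1) (n ^ (q + 1)) m₂ :=
    { varN := (hA₂.var rfl).trans hN₁
      varQ := (hA₂.var rfl).trans hQ₁
      varR := (hA₂.var rfl).trans hR₁
      tables := ⟨by rw [hA₂.arr rfl]; exact hT₁.mul, by rw [hA₂.arr rfl]; exact hT₁.div,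
        by rw [hA₂.arr rfl]; exact hT₁.mod⟩
      le := hle
      bounded := fun u v huv => (G.onNat_boundedBy huv).trans (hn ▸ lt_length_encodeGraph G)
      nbhds := hP₂ }
  have hNT := nonTwins_spec h₂ (by rw [hA₂.arr rfl, hA₁.arr rfl]; exact ha₀ _ (by decide))
  have hA₃ := agree_sem nonTwins m₂
  generalize nonTwins.sem m₂ = m₃ at *
  have h₃ : TwinData G.onNat n (q + 1) (n ^ (q + 1)) m₃ := ⟨h₂.agree hA₃ rfl, hNT⟩
  have hCS := classSizes_spec h₃ (by
    rw [hA₃.var rfl, hA₂.var rfl, hA₁.var rfl]; exact hv₀ _ rfl (by decide) (by decide))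
  have hA₄ := agree_sem classSizes m₃
  generalize classSizes.sem m₃ = m₄ at *
  have h₄ := h₃.agree hA₄ rfl
  have harr : ∀ a, classSizes.stores a = false → nonTwins.stores a = false →
      parse.stores a = false → tables.stores a = false → a ≠ INP → ∀ k, m₄.arr a k = 0 := by
    intro a h1 h2 h3 h4 h5
    rw [hA₄.arr h1, hA₃.arr h2, hA₂.arr h3, hA₁.arr h4]
    exact ha₀ a h5
  obtain ⟨𝓕, hF, hK⟩ := select_spec h₄ rfl hn0 hq (harr _ rfl rfl rfl rfl (by decide))
    (harr _ rfl rfl rfl rfl (by decide)) (harr _ rfl rfl rfl rfl (by decide))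
    (harr _ rfl rfl rfl rfl (by decide)) hCS.1 hCS.2.1 hCS.2.2
  have hA₅ := agree_sem select m₄
  generalize select.sem m₄ = m₅ at *
  have h₅ := h₄.toGraphData.agree hA₅ rfl
  have hL := listKept_spec h₅ (by
    rw [hA₅.var rfl, hA₄.var rfl, hA₃.var rfl, hA₂.var rfl, hA₁.var rfl]
    exact hv₀ _ rfl (by decide) (by decide))
  have hA₆ := agree_sem listKept m₅
  rw [← hm] at hA₆ hL
  have h₆ := h₅.agree hA₆ rfl
  have hKE : m.arr KE = m₅.arr KE := hA₆.arr rfl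
  refine ⟨𝓕, hF, ?_, hKE ▸ hL, fun v hv => h₆.tables.mul v (hv.trans_le hle), h₆.varN, hout⟩
  rw [Keeps, hKE]
  exact hK

/-- The output of the program is the code of a reduced graph. -/
lemma kernelization_out (G : FinGraph) {q n : ℕ} (hq : 1 ≤ q) (hn : n = (encodeGraph G).length) :
    ∃ (𝓕 : Finset (Finset ℕ)) (G' : FinGraph) (f : Fin G'.1 ↪ ℕ), G.onNat.IsKeptFamily n q 𝓕 ∧
      G.onNat.IsReduced 𝓕 G' f ∧ (main.sem (initMem (encodeGraph G) q)).var NV ≤ n ∧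
      (output.sem (main.sem (initMem (encodeGraph G) q))).out = encodeGraph G' := by
  classical
  generalize hm : main.sem (initMem (encodeGraph G) q) = m
  obtain ⟨𝓕, hF, hK, hL, hmul, hN, hout⟩ := main_spec G hq hn hm.symm
  have hlt : ∀ i < m.var NV, m.arr KEPT i < n := fun i hi => ((hL.mem _).1 ⟨i, hi, rfl⟩).1
  have hF𝓕 : ∀ F ∈ 𝓕, ∀ v ∈ F, v < n := by
    intro F hF' v hv
    obtain ⟨w, hw⟩ := hF.exists_adj hq F hF' v hv
    exact (FinGraph.onNat_adj_lt hw).1.trans (hn ▸ lt_length_encodeGraph G)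
  let f : Fin (m.var NV) ↪ ℕ :=
    ⟨fun i => m.arr KEPT i, fun i j h => Fin.ext (hL.inj i i.2 j j.2 h)⟩
  have hle : m.var NV ≤ n := by
    have := Finset.card_le_card_of_injOn (s := Finset.univ) (t := Finset.range n) f
      (fun i _ => Finset.mem_coe.2 (Finset.mem_range.2 (hlt i i.2))) f.injective.injOn
    simpa using this
  let G' : FinGraph := ⟨m.var NV, (G.onNat.keptGraph 𝓕).comap f⟩
  refine ⟨𝓕, G', f, hF, ⟨fun v => ?_, fun i j => Iff.rfl⟩, hle, ?_⟩
  · constructor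
    · rintro ⟨i, rfl⟩
      obtain ⟨h1, h2⟩ := (hL.mem _).1 ⟨i, i.2, rfl⟩
      obtain ⟨⟨F, hF, hv, -⟩, -⟩ := (hK _ h1 _ h1).1 h2
      exact ⟨F, hF, hv⟩
    · rintro ⟨F, hF', hv⟩
      have hvn := hF𝓕 F hF' v hv
      obtain ⟨i, hi, he⟩ := (hL.mem v).2 ⟨hvn, (hK v hvn v hvn).2 ⟨⟨F, hF', hv, hv⟩, .inl rfl⟩⟩
      exact ⟨⟨i, hi⟩, he⟩
  · have hadj : ∀ i j, G'.2.Adj i j ↔ (G.onNat.keptGraph 𝓕).Adj (m.arr KEPT i) (m.arr KEPT j) :=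
      fun i j => Iff.rfl
    rw [output_spec m (hN ▸ hle)
      (fun i j => (G.onNat.keptGraph 𝓕).Adj (m.arr KEPT i) (m.arr KEPT j))
      (hN ▸ hmul) (hN ▸ hlt), encodeGraph_eq G'
      (fun i j => (G.onNat.keptGraph 𝓕).Adj (m.arr KEPT i) (m.arr KEPT j)) hadj, hout,
      List.nil_append]
    intro i hi j hj
    rw [hN, hK _ (hlt i hi) _ (hlt j hj)]
    constructor
    · rintro ⟨h1, h2⟩
      exact ⟨fun h => h1.ne (by rw [h]), h2, .inr h1⟩
    · rintro ⟨h1, h2, h3⟩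
      exact ⟨h3.resolve_left fun h => h1 (hL.inj i hi j hj h), h2⟩

lemma _root_.Polynomial.eval_le_eval_of_le (p : Polynomial ℕ) {a b : ℕ} (h : a ≤ b) :
    p.eval a ≤ p.eval b := by
  rw [Polynomial.eval_eq_sum_range, Polynomial.eval_eq_sum_range]
  exact Finset.sum_le_sum fun i _ => Nat.mul_le_mul_left _ (Nat.pow_le_pow_left h i)

/-- A bound for the running time, as a polynomial in the length of the input. All loops in `main`
are bounded by `N`, `Q` or `R = N ^ Q`. -/
noncomputable def runningTime (q : ℕ) : Polynomial ℕ :=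
  2 + (powers.time.comp (.X + .C (q + 1)) +
    (main.time.comp (.X ^ (q + 1) + .X + .C (q + 1)) + output.time))

/-- The program outputs the code of a reduced graph in polynomial time. This graph does not depend
on the parameter, which the program leaves alone. -/
lemma kernelization_spec (G : FinGraph) {q : ℕ} (hq : 1 ≤ q) :
    ∃ (𝓕 : Finset (Finset ℕ)) (G' : FinGraph) (f : Fin G'.1 ↪ ℕ),
      G.onNat.IsKeptFamily (encodeGraph G).length q 𝓕 ∧ G.onNat.IsReduced 𝓕 G' f ∧
      ∀ k, RAM.OutputsWithin (kernelization q).compile (encodeGraph G) k (encodeGraph G') k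
        ((runningTime q).eval ((encodeGraph G).length + k)) := by
  obtain ⟨𝓕, G', f, hF, hG', hNV, hout⟩ := kernelization_out G hq rfl
  refine ⟨𝓕, G', f, hF, hG', fun k => ?_⟩
  set w := encodeGraph G with hw
  set n := w.length with hn
  have hN := initMem_N w q
  have hQ := initMem_Q w q
  have hR := initMem_R w q
  rw [← hn] at hN hR
  have hmN : (main.sem (initMem w q)).var N = n :=
    (Cmd.ok_sem_var ok_main (by simp) _).trans hN
  have e₁ := RAM.Exec.assign Q.id (.lit (q + 1)) (RAM.initState w k)
  have s₁ := (Sim.start w k).set Q (q + 1)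
  obtain ⟨t₂, ht₂, S₂, e₂, s₂⟩ := Cmd.ok_exec ok_powers (K := n + (q + 1)) (by
    intro r hr
    simp only [List.mem_cons, List.not_mem_nil, or_false] at hr
    rcases hr with rfl | rfl
    · rw [Mem.set_var_ne _ _ (by decide)]
      exact Nat.le_add_right _ _
    · simp) s₁
  obtain ⟨t₃, ht₃, S₃, e₃, s₃⟩ := Cmd.ok_exec ok_main (K := n ^ (q + 1) + n + (q + 1)) (by
    intro r hr
    simp only [List.mem_cons, List.not_mem_nil, or_false] at hr
    change (initMem w q).var r ≤ _
    rcases hr with rfl | rfl | rfl <;> omega) s₂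
  obtain ⟨t₄, ht₄, S₄, e₄, s₄⟩ := Cmd.ok_exec ok_output (K := n) (by
    intro r hr
    simp only [List.mem_cons, List.not_mem_nil, or_false] at hr
    rcases hr with rfl | rfl
    exacts [hmN.le, hNV]) s₃
  refine ⟨_, ?_, S₄, .seq e₁ (.seq e₂ (.seq e₃ e₄)), s₄.out.trans hout, s₄.param⟩
  refine le_trans ?_ ((runningTime q).eval_le_eval_of_le (Nat.le_add_right n k))
  simp only [runningTime, Polynomial.eval_add, Polynomial.eval_comp, Polynomial.eval_pow,
    Polynomial.eval_X, Polynomial.eval_C, Polynomial.eval_ofNat]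
  exact Nat.add_le_add le_rfl (Nat.add_le_add ht₂ (Nat.add_le_add ht₃ ht₄))

end LoopLang

/-! ### The kernel -/

theorem mainTheorem2 (q : ℕ) (hq : 3 ≤ q) :
    ∃ (C : ℕ) (R : FinGraph → FinGraph),
      IsKernel encodeGraph (coloringByTwinCover q) (fun x => (R x.1, x.2))
        (fun k => C * (k ^ (q - 1) * Nat.log 2 k + 1)) ∧
      IsKernel encodeGraph (coloringByVertexCover q) (fun x => (R x.1, x.2))
        (fun k => C * (k ^ (q - 1) * Nat.log 2 k + 1)) ∧
      (∀ (G : FinGraph) (k : ℕ), (coloringByTwinCover q).Valid G k →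
        (R G).1 ≤ C * (k ^ (q - 1) + 1)) ∧
      ∀ G : FinGraph, (R G).2.IsContained G.2 := by
  classical
  choose 𝓕 R f hF hR hrun using fun G => LoopLang.kernelization_spec G (q := q) (by omega)
  have hn := lt_length_encodeGraph
  have hpairs : ∀ G k, (coloringByTwinCover q).Valid G k →
      ((𝓕 G).biUnion fun F => F ×ˢ F).card ≤ SimpleGraph.sizeFactor q * (k ^ (q - 1) + 1) := by
    rintro G k ⟨Y, hY, hk⟩
    exact (hF G).card_le (by have := hn G; omega) hq (FinGraph.isTwinCover_onNat hY)
      ((Finset.card_map _).trans_le hk)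
  have hle : ∀ G k, (coloringByTwinCover q).Valid G k →
      (R G).1 ≤ SimpleGraph.sizeFactor q * (k ^ (q - 1) + 1) := fun G k h =>
    (card_le_card_pairs _).trans ((hR G).card_pairs_le.trans (hpairs G k h))
  have hlen : ∀ G k, (coloringByTwinCover q).Valid G k → (encodeGraph (R G)).length ≤
      kernelConst q * (k ^ (q - 1) * Nat.log 2 k + 1) := fun G k h =>
    code_bound _ _ _ _ _ _ (card_le_card_pairs _) ((hR G).card_pairs_le.trans (hpairs G k h))
      (length_encodeGraph_le _)
  have hk : ∀ k, k ≤ kernelConst q * (k ^ (q - 1) * Nat.log 2 k + 1) := fun k =>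
    le_kernel_size (Nat.succ_pos _) (by omega)
  have hpoly : ∃ (p : RAM.Prog) (T : Polynomial ℕ), ∀ (G : FinGraph) (k : ℕ),
      RAM.OutputsWithin p (encodeGraph G) k (encodeGraph (R G)) k
        (T.eval ((encodeGraph G).length + k)) := ⟨_, _, hrun⟩
  refine ⟨kernelConst q, R, ⟨hpoly, ?_, ?_, ?_⟩, ⟨hpoly, ?_, ?_, ?_⟩, ?_, ?_⟩
  · exact fun G k h => (hR G).validTwinCover (hF G) (hn G) h
  · exact fun G k _ => (hR G).colorable_iff (hF G) (hn G) (by omega)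
  · exact fun G k h => ⟨hlen G k h, hk k⟩
  · exact fun G k h => (hR G).validVertexCover (hF G) (by omega) h
  · exact fun G k _ => (hR G).colorable_iff (hF G) (hn G) (by omega)
  · exact fun G k h => ⟨hlen G k (validTwinCover_of_validVertexCover h), hk k⟩
  · exact fun G k h => (hle G k h).trans (Nat.mul_le_mul_right _ (by rw [kernelConst]; omega))
  · exact fun G => (hR G).isContained (hF G) (by omega)
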